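/- **Setting.** Let $\mu:\mathbb R\to\mathbb R$ be differentiable and increasing with $\mu(x)+\mu(-x)=1$ and $0<\kappa_\mu\le\dot\mu(x)\le L_\mu$ for all $x\in\mathbb R$, let $\theta^*\in\mathbb R^d$ with $\|\theta^*\|_2\le 1$, and let $A>0$. In each round $t=1,\dots,T$ ($T\ge 2$) a finite non-empty set of arms $\mathcal A_t\subset\mathbb R^d$ is presented, with $\|x\|_2\le A$ for all $x\in\mathcal A_t$; the learner selects $x_t,y_t\in\mathcal A_t$ and observes $o_t\in\{0,1\}$. Let $\mathcal F_t$ be a filtration for which the selection in round $t$ (the pair, and the branch and layer of the algorithm in which it is made) is $\mathcal F_t$-measurable and $o_t$ is $\mathcal F_{t+1}$-measurable, and assume $\mathbb E[o_t\mid\mathcal F_t]=p_t:=\mu((x_t-y_t)^\top\theta^*)$. Put $\epsilon_t=o_t-p_t$ and $\sigma_t^2=\mathbb E[\epsilon_t^2\mid\mathcal F_t]$. The average regret is $\mathrm{Regret}(T)=\frac12\sum_{t=1}^T\big[2\max_{x\in\mathcal A_t}x^\top\theta^*-(x_t+y_t)^\top\theta^*\big]$. **Algorithm VACDB** (inputs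 $\alpha,\delta,\kappa_\mu,L_\mu,\mu$; $L=\lceil\log_2(1/\alpha)\rceil$). For every layer $\ell\in\{1,\dots,L\}$ start with $\hat\Sigma_{1,\ell}=2^{-2\ell}I$, $\hat\theta_{1,\ell}=0$, $\Psi_{1,\ell}=\emptyset$, $\hat\beta_{1,\ell}=2^{-\ell}(1+1/\kappa_\mu)$. In round $t$ put $\mathcal A_{t,1}=\mathcal A_t$, $\ell=1$, and repeat until a pair is selected: 1. (exploitation) if $\|x-y\|_{\hat\Sigma_{t,\ell}^{-1}}\le\alpha$ for all $x,y\in\mathcal A_{t,\ell}$, select a maximizer $(x_t,y_t)$ over $\mathcal A_{t,\ell}^2$ of $(x+y)^\top\hat\theta_{t,\ell}+\hat\beta_{t,\ell}\|x-y\|_{\hat\Sigma_{t,\ell}^{-1}}$; 2. (elimination) otherwise, if $\|x-y\|_{\hat\Sigma_{t,\ell}^{-1}}\le2^{-\ell}$ for all $x,y\in\mathcal A_{t,\ell}$, let $\mathcal A_{t,\ell+1}=\{x\in\mathcal A_{t,\ell}: x^\top\hat\theta_{t,\ell}\ge\max_{x'\in\mathcal A_{t,\ell}}x'^\top\hat\theta_{t,\ell}-2^{-\ell}\hat\beta_{t,\ell}\}$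 and increase $\ell$ by one; 3. (exploration) otherwise select any $x_t,y_t\in\mathcal A_{t,\ell}$ with $\|x_t-y_t\|_{\hat\Sigma_{t,\ell}^{-1}}>2^{-\ell}$, put $w_t=2^{-\ell}/\|x_t-y_t\|_{\hat\Sigma_{t,\ell}^{-1}}$ and $\Psi_{t+1,\ell}=\Psi_{t,\ell}\cup\{t\}$. After an exploration of layer $\ell$ in round $t$, put $\hat\Sigma_{t+1,\ell}=\hat\Sigma_{t,\ell}+w_t^2(x_t-y_t)(x_t-y_t)^\top$, let $\hat\theta_{t+1,\ell}$ be the solution $\theta$ of $$2^{-2\ell}\kappa_\mu\theta+\sum_{s\in\Psi_{t+1,\ell}}w_s^2\big(\mu((x_s-y_s)^\top\theta)-o_s\big)(x_s-y_s)=0,$$ and compute $\hat\beta_{t+1,\ell}$ from the formula $$\hat\beta_{t,\ell}=\tfrac{16\cdot2^{-\ell}}{\kappa_\mu}\sqrt{\big(8\widehat{\mathrm{Var}}_{t,\ell}+18\log\tfrac{4(t+1)^2L}{\delta}\big)\log\tfrac{4t^2L}{\delta}}+\tfrac{6\cdot2^{-\ell}}{\kappa_\mu}\log\tfrac{4t^2L}{\delta}+2^{-\ell+1},$$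 where $\widehat{\mathrm{Var}}_{t,\ell}=\sum_{s\in\Psi_{t,\ell}}w_s^2\big(o_s-\mu((x_s-y_s)^\top\hat\theta_{t,\ell})\big)^2$ if $2^\ell\ge64\frac{L_\mu}{\kappa_\mu}\sqrt{\log(4(t+1)^2L/\delta)}$, and $\widehat{\mathrm{Var}}_{t,\ell}=|\Psi_{t,\ell}|$ otherwise. All quantities of the other layers are kept. **Theorem.** There is an absolute integer $k\ge0$, and for every $A>0$ a constant $C=C(A)>0$, such that for all $d$, $T\ge2$, $\delta\in(0,1)$, $\kappa_\mu,L_\mu,\mu,\theta^*$ and every environment as above, the run of VACDB with $\alpha=T^{-3/2}$ satisfies, with probability at least $1-2\delta$, $$\mathrm{Regret}(T)\le C\log^k(T/\delta)\left(\frac d{\kappa_\mu}\sqrt{\sum_{t=1}^T\sigma_t^2}+d\Big(\frac{L_\mu^2}{\kappa_\mu^2}+\frac1{\kappa_\mu}\Big)\right).$$ On the same event, if all comparisons between distinct arms are deterministic (that is, $\sigma_t^2=0$ in every round $t\le T$ with $x_t\ne y_t$), then $\mathrm{Regret}(T)\le C\log^k(T/\delta)\,d\big(\frac{L_\mu^2}{\kappa_\mu^2}+\frac1{\kappa_\mu}\big)$,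 which is $\tilde O(d)$ for fixed $\kappa_\mu,L_\mu$. -/

import Mathlib

open MeasureTheory

noncomputable section

namespace VACDB

/-- Feature space `ℝ^d` with the Euclidean norm and inner product. -/
abbrev Vec (d : ℕ) := EuclideanSpace ℝ (Fin d)

/-- Assumptions on the link function: differentiable, increasing, `μ(x) + μ(-x) = 1`, and
`0 < κ ≤ μ' ≤ Lμ` everywhere. The function is real valued; that it gives a probability where a
comparison is made is part of the feedback model. -/
structure IsLink (μ : ℝ → ℝ) (κ Lμ : ℝ) : Prop where
  differentiable : Differentiable ℝ μ
  monotone : Monotone μ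
  symm : ∀ x, μ x + μ (-x) = 1
  kappa_pos : 0 < κ
  le_deriv : ∀ x, κ ≤ deriv μ x
  deriv_le : ∀ x, deriv μ x ≤ Lμ

/-- The inputs of the algorithm. -/
structure Params where
  α : ℝ
  δ : ℝ
  κ : ℝ
  Lμ : ℝ
  μ : ℝ → ℝ

/-- The number of layers `L = ⌈log₂ (1/α)⌉`. -/
def Params.numLayers (p : Params) : ℕ := ⌈Real.logb 2 (1 / p.α)⌉₊

/-- What happens in the rounds `t = 1, 2, …` : the set of arms presented, the pair selected, the
feedback (`1` if `x t` wins, `0` if `y t` wins), and the branch of the algorithm in which the pair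
was selected: `some ℓ` for exploration in layer `ℓ`, `none` for exploitation. -/
structure Trajectory (d : ℕ) where
  arms : ℕ → Finset (Vec d)
  x : ℕ → Vec d
  y : ℕ → Vec d
  o : ℕ → ℝ
  layer : ℕ → Option ℕ

/-- The weighted norm `‖v‖_M = √(vᵀ M v)`. -/
def wnorm {d : ℕ} (M : Matrix (Fin d) (Fin d) ℝ) (v : Vec d) : ℝ :=
  Real.sqrt (v.ofLp ⬝ᵥ M.mulVec v.ofLp)

namespace Trajectory

variable {d : ℕ}

/-- The difference `x_t - y_t`. -/
def z (τ : Trajectory d) (t : ℕ) : Vec d := τ.x t - τ.y t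

/-- The index set `Ψ_{t,ℓ}` : the rounds before `t` that explored layer `ℓ`. -/
def idx (τ : Trajectory d) (t ℓ : ℕ) : Finset ℕ :=
  {s ∈ Finset.Ico 1 t | τ.layer s = some ℓ}

open Classical in
/-- The matrix `Σ̂_{t,ℓ}` : it starts (at `t = 1`) as `2^{-2ℓ} I`, and a round `t` that explores
layer `ℓ` adds `w_t² (x_t - y_t)(x_t - y_t)ᵀ` with `w_t = 2^{-ℓ} / ‖x_t - y_t‖_{Σ̂_{t,ℓ}⁻¹}`. -/
def cov (τ : Trajectory d) : ℕ → ℕ → Matrix (Fin d) (Fin d) ℝ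
  | 0, ℓ => ((1 / 2 : ℝ) ^ (2 * ℓ)) • 1
  | t + 1, ℓ =>
    if 1 ≤ t ∧ τ.layer t = some ℓ then
      cov τ t ℓ + (((1 / 2 : ℝ) ^ ℓ / wnorm (cov τ t ℓ)⁻¹ (τ.z t)) ^ 2) •
        Matrix.vecMulVec (τ.z t).ofLp (τ.z t).ofLp
    else cov τ t ℓ

/-- The width `‖x - y‖_{Σ̂_{t,ℓ}⁻¹}` of a pair of arms. -/
def width (τ : Trajectory d) (t ℓ : ℕ) (x y : Vec d) : ℝ := wnorm (τ.cov t ℓ)⁻¹ (x - y)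

/-- The weight `w_t` of an exploration round (it is not used for the other rounds). -/
def weight (τ : Trajectory d) (t : ℕ) : ℝ :=
  match τ.layer t with
  | some ℓ => (1 / 2 : ℝ) ^ ℓ / τ.width t ℓ (τ.x t) (τ.y t)
  | none => 0

/-- The equation of the regularized maximum likelihood estimator of layer `ℓ` at time `t`:
`2^{-2ℓ} κ θ + ∑_{s ∈ Ψ_{t,ℓ}} w_s² (μ((x_s - y_s)ᵀ θ) - o_s) (x_s - y_s) = 0`. -/
def IsMLE (p : Params) (τ : Trajectory d) (t ℓ : ℕ) (θ : Vec d) : Prop :=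
  ((1 / 2 : ℝ) ^ (2 * ℓ) * p.κ) • θ +
    ∑ s ∈ τ.idx t ℓ, (τ.weight s ^ 2 * (p.μ (inner ℝ (τ.z s) θ) - τ.o s)) • τ.z s = 0

open Classical in
/-- The estimator `θ̂_{t,ℓ}` : zero at `t = 1`; recomputed, as the solution of the equation above,
after a round that explored layer `ℓ`, and kept otherwise. -/
def est (p : Params) (τ : Trajectory d) : ℕ → ℕ → Vec d
  | 0, _ => 0
  | t + 1, ℓ =>
    if 1 ≤ t ∧ τ.layer t = some ℓ then Classical.epsilon (τ.IsMLE p (t + 1) ℓ)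
    else est p τ t ℓ

open Classical in
/-- The variance estimator of layer `ℓ` at time `t`. -/
def varEst (p : Params) (τ : Trajectory d) (t ℓ : ℕ) : ℝ :=
  if 64 * (p.Lμ / p.κ) * Real.sqrt (Real.log (4 * (t + 1) ^ 2 * p.numLayers / p.δ)) ≤ 2 ^ ℓ then
    ∑ s ∈ τ.idx t ℓ, τ.weight s ^ 2 * (τ.o s - p.μ (inner ℝ (τ.z s) (τ.est p t ℓ))) ^ 2
  else ((τ.idx t ℓ).card : ℝ)

/-- The variance-aware confidence radius, as computed at time `t`. -/
def bonus (p : Params) (τ : Trajectory d) (t ℓ : ℕ) : ℝ :=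
  16 * (1 / 2) ^ ℓ / p.κ *
      Real.sqrt ((8 * τ.varEst p t ℓ + 18 * Real.log (4 * (t + 1) ^ 2 * p.numLayers / p.δ)) *
        Real.log (4 * t ^ 2 * p.numLayers / p.δ)) +
    6 * (1 / 2) ^ ℓ / p.κ * Real.log (4 * t ^ 2 * p.numLayers / p.δ) + 2 * (1 / 2) ^ ℓ

open Classical in
/-- The radius `β̂_{t,ℓ}` in use in round `t` : `2^{-ℓ} (1 + 1/κ)` at `t = 1`, recomputed after a
round that explored layer `ℓ`, and kept otherwise. -/
def rad (p : Params) (τ : Trajectory d) : ℕ → ℕ → ℝ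
  | 0, ℓ => (1 / 2) ^ ℓ * (1 + 1 / p.κ)
  | t + 1, ℓ =>
    if 1 ≤ t ∧ τ.layer t = some ℓ then τ.bonus p (t + 1) ℓ else rad p τ t ℓ

open Classical in
/-- `LoopReaches p τ t ℓ B` : in round `t` the while loop arrives at layer `ℓ` with `B` as the set
of surviving arms `A_{t,ℓ}`. The constructor `eliminate` is the elimination branch. -/
inductive LoopReaches (p : Params) (τ : Trajectory d) (t : ℕ) : ℕ → Finset (Vec d) → Prop
  | start : LoopReaches p τ t 1 (τ.arms t)
  | eliminate (ℓ : ℕ) (B : Finset (Vec d)) (reached : LoopReaches p τ t ℓ B)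
      (not_exploit : ¬ ∀ x ∈ B, ∀ y ∈ B, τ.width t ℓ x y ≤ p.α)
      (narrow : ∀ x ∈ B, ∀ y ∈ B, τ.width t ℓ x y ≤ (1 / 2) ^ ℓ) :
      LoopReaches p τ t (ℓ + 1)
        {x ∈ B | ∀ x' ∈ B, inner ℝ x' (τ.est p t ℓ) - (1 / 2) ^ ℓ * τ.rad p t ℓ
          ≤ inner ℝ x (τ.est p t ℓ)}

/-- The symmetric selection score
`(x + y)ᵀ θ̂_{t,ℓ} + β̂_{t,ℓ} ‖x - y‖_{Σ̂_{t,ℓ}⁻¹}`. -/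
def score (p : Params) (τ : Trajectory d) (t ℓ : ℕ) (x y : Vec d) : ℝ :=
  inner ℝ (x + y) (τ.est p t ℓ) + τ.rad p t ℓ * τ.width t ℓ x y

/-- `Selects p τ t x y b` : in round `t` the algorithm may leave the while loop with the pair
`(x, y)` and the branch `b`. Ties are broken in an arbitrary way. -/
inductive Selects (p : Params) (τ : Trajectory d) (t : ℕ) : Vec d → Vec d → Option ℕ → Prop
  | exploit (ℓ : ℕ) (B : Finset (Vec d)) (x y : Vec d) (reached : LoopReaches p τ t ℓ B)
      (all_le : ∀ x' ∈ B, ∀ y' ∈ B, τ.width t ℓ x' y' ≤ p.α)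
      (hx : x ∈ B) (hy : y ∈ B)
      (isMax : ∀ x' ∈ B, ∀ y' ∈ B, τ.score p t ℓ x' y' ≤ τ.score p t ℓ x y) :
      Selects p τ t x y none
  | explore (ℓ : ℕ) (B : Finset (Vec d)) (x y : Vec d) (reached : LoopReaches p τ t ℓ B)
      (not_exploit : ¬ ∀ x' ∈ B, ∀ y' ∈ B, τ.width t ℓ x' y' ≤ p.α)
      (hx : x ∈ B) (hy : y ∈ B) (wide : (1 / 2) ^ ℓ < τ.width t ℓ x y) :
      Selects p τ t x y (some ℓ)

/-- The trajectory is an execution of the algorithm over `T` rounds. -/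
def IsRun (p : Params) (τ : Trajectory d) (T : ℕ) : Prop :=
  ∀ t ∈ Finset.Icc 1 T, τ.Selects p t (τ.x t) (τ.y t) (τ.layer t)

/-- The average regret `½ ∑_{t ≤ T} (2 max_{x ∈ A_t} xᵀθ - (x_t + y_t)ᵀθ)`. -/
def regret (τ : Trajectory d) (θ : Vec d) (T : ℕ) : ℝ :=
  (1 / 2) * ∑ t ∈ Finset.Icc 1 T,
    (2 * (⨆ x : {x // x ∈ τ.arms t}, inner ℝ x.1 θ) - inner ℝ (τ.x t + τ.y t) θ)

end Trajectory

section Model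

variable {d : ℕ} {Ω : Type*} [mΩ : MeasurableSpace Ω]

/-- The success probability `p_t = μ((x_t - y_t)ᵀ θ)` of the comparison of round `t`. -/
def prob (μ : ℝ → ℝ) (θ : Vec d) (τ : Ω → Trajectory d) (t : ℕ) (ω : Ω) : ℝ :=
  μ (inner ℝ ((τ ω).z t) θ)

/-- The stochastic model of `T` rounds. `ℱ t` is the information available when the feedback of
round `t` is drawn: it contains the feedback of the earlier rounds and the selection of round `t`.
Arms have norm at most `A`, and given `ℱ t` the feedback is a Bernoulli variable with mean
`p_t`. -/
structure IsDuelingModel (P : Measure Ω) (ℱ : Filtration ℕ mΩ) (τ : Ω → Trajectory d)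
    (μ : ℝ → ℝ) (θ : Vec d) (A : ℝ) (T : ℕ) : Prop where
  norm_arm_le : ∀ t ∈ Finset.Icc 1 T, ∀ ω, ∀ x ∈ (τ ω).arms t, ‖x‖ ≤ A
  measurable_x : ∀ t ∈ Finset.Icc 1 T, Measurable[ℱ t] fun ω => (τ ω).x t
  measurable_y : ∀ t ∈ Finset.Icc 1 T, Measurable[ℱ t] fun ω => (τ ω).y t
  measurable_layer : ∀ t ∈ Finset.Icc 1 T, ∀ ℓ, MeasurableSet[ℱ t] {ω | (τ ω).layer t = some ℓ}
  measurable_o : ∀ t ∈ Finset.Icc 1 T, Measurable[ℱ (t + 1)] fun ω => (τ ω).o t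
  binary : ∀ t ∈ Finset.Icc 1 T, ∀ ω, (τ ω).o t = 0 ∨ (τ ω).o t = 1
  condMean : ∀ t ∈ Finset.Icc 1 T, P[fun ω => (τ ω).o t | ℱ t] =ᵐ[P] prob μ θ τ t

/-- The conditional variance `σ_t² = E[ε_t² | ℱ_t]` of the noise `ε_t = o_t - p_t`. -/
def noiseVar (P : Measure Ω) (ℱ : Filtration ℕ mΩ) (τ : Ω → Trajectory d)
    (μ : ℝ → ℝ) (θ : Vec d) (t : ℕ) : Ω → ℝ :=
  P[fun ω => ((τ ω).o t - prob μ θ τ t ω) ^ 2 | ℱ t]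

end Model

end VACDB

end

/-!
On a concentration event of probability at least `1 - 2δ` the regret bound is deterministic.

*Confidence.* Fix a layer `ℓ`, write `S = ∑ w_s² ε_s z_s` for its noise sum, `Σ` for its matrix and
`V = ∑ w_s² σ_s²`. The estimating equation and the strong monotonicity of the link give
`‖θ̂ - θ‖_Σ ≤ 2^{-ℓ} + ‖S‖_{Σ⁻¹} / κ` (`wnorm_est_sub_le`). The weights make every exploration of
the layer have `‖w_t z_t‖_{Σ⁻¹} = 2^{-ℓ}` exactly, so a dimension-free Bernstein bound
`‖S‖_{Σ⁻¹} ≤ 2^{-ℓ} (5 √(V ι) + 5 ι)` holds, with `ι` the logarithmic factor. In the layers where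
the variance is estimated, the prediction errors of the estimator are so small that `V` may be
replaced by its estimate (`sqrt_var_le`) and, conversely, the estimate is at most of order `V` plus
lower order terms (`sqrt_varEst_le`). As the link is real valued, `κ` need not be bounded; the terms
in `κ` that this comparison creates are paid by the difference between `2^{-ℓ+1}` in the radius and
the bias `2^{-ℓ}`.

*Bernstein bound.* The process `H = √(1 + s² 4^ℓ ‖S‖²_{Σ⁻¹})` satisfies a scalar recursion: adding
a rank-one term to `Σ` only decreases the dual norm, and the square root lies below its tangent
(`IsRun.height_succ_le`). Hence `exp (H - (17/8) s² V)` is a supermartingale. Markov's inequality at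
a fixed time, and a union over the scales `s = 1/m`, give the bound even though `V` is random
(`noiseSum_le_of_height_le`); no stopping time is needed, because the radius already pays for a
union over the rounds. The comparison of `V` with the realized sum `∑ w_s² ε_s²` is obtained in the
same way.

*Regret.* Given confidence, the best arm is never eliminated (`LoopReaches.best_mem`), so a round
that explores layer `ℓ + 1` costs at most of order `2^{-ℓ}` times the radius of layer `ℓ`, which is
`2^{-ℓ} (√V / κ + 1 / κ + 1)` up to logarithms. The determinant of `Σ` grows by the factor
`1 + 4^{-ℓ}` at each exploration, so layer `ℓ` is explored `O(4^ℓ d)` times up to logarithms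
(`IsRun.card_idx_le`), and the powers of two cancel. In the layers below the threshold for
estimating the variance, `4^ℓ` is of order `(Lμ / κ)²` and the trivial bound of the regret suffices.
Exploitation rounds cost `α = T^{-3/2}` times the radius. Only rounds with `x_t ≠ y_t` explore,
which gives the deterministic case.
-/

noncomputable section

namespace VACDB

open Matrix

/-! ### Weighted norms -/

variable {d : ℕ}

/-- The bilinear form `uᵀ M v`. -/
def form (M : Matrix (Fin d) (Fin d) ℝ) (u v : Vec d) : ℝ := u.ofLp ⬝ᵥ M *ᵥ v.ofLp

lemma inner_eq_dot (u v : Vec d) : inner ℝ u v = u.ofLp ⬝ᵥ v.ofLp := by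
  rw [EuclideanSpace.inner_eq_star_dotProduct, dotProduct_comm]; simp

lemma form_add_left (M : Matrix (Fin d) (Fin d) ℝ) (u u' v : Vec d) :
    form M (u + u') v = form M u v + form M u' v := by
  simp [form, add_dotProduct]

lemma form_add_right (M : Matrix (Fin d) (Fin d) ℝ) (u v v' : Vec d) :
    form M u (v + v') = form M u v + form M u v' := by
  simp [form, mulVec_add, dotProduct_add]

lemma form_smul_left (M : Matrix (Fin d) (Fin d) ℝ) (c : ℝ) (u v : Vec d) :
    form M (c • u) v = c * form M u v := by
  simp [form]

lemma form_smul_right (M : Matrix (Fin d) (Fin d) ℝ) (c : ℝ) (u v : Vec d) :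
    form M u (c • v) = c * form M u v := by
  simp [form, mulVec_smul]

lemma form_comm {M : Matrix (Fin d) (Fin d) ℝ} (hM : M.PosDef) (u v : Vec d) :
    form M u v = form M v u := by
  have h : Mᵀ = M := by simpa [IsHermitian] using hM.isHermitian
  rw [form, form, dotProduct_mulVec, ← mulVec_transpose, h, dotProduct_comm]

lemma form_self_nonneg {M : Matrix (Fin d) (Fin d) ℝ} (hM : M.PosDef) (u : Vec d) :
    0 ≤ form M u u := by
  simpa [form] using hM.posSemidef.dotProduct_mulVec_nonneg u.ofLp

lemma wnorm_eq (M : Matrix (Fin d) (Fin d) ℝ) (u : Vec d) : wnorm M u = √(form M u u) := rfl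

lemma wnorm_nonneg (M : Matrix (Fin d) (Fin d) ℝ) (u : Vec d) : 0 ≤ wnorm M u := Real.sqrt_nonneg _

lemma wnorm_sq {M : Matrix (Fin d) (Fin d) ℝ} (hM : M.PosDef) (u : Vec d) :
    wnorm M u ^ 2 = form M u u := Real.sq_sqrt (form_self_nonneg hM u)

lemma wnorm_smul (M : Matrix (Fin d) (Fin d) ℝ) (c : ℝ) (u : Vec d) :
    wnorm M (c • u) = |c| * wnorm M u := by
  rw [wnorm_eq, form_smul_left, form_smul_right, ← mul_assoc, ← sq, Real.sqrt_mul (sq_nonneg c),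
    Real.sqrt_sq_eq_abs, wnorm_eq]

lemma abs_form_le {M : Matrix (Fin d) (Fin d) ℝ} (hM : M.PosDef) (u v : Vec d) :
    |form M u v| ≤ wnorm M u * wnorm M v := by
  have h : ∀ r : ℝ, 0 ≤ form M v v * (r * r) + 2 * form M u v * r + form M u u := by
    intro r
    have := form_self_nonneg hM (u + r • v)
    rw [form_add_left, form_add_right, form_add_right, form_smul_left, form_smul_left,
      form_smul_right, form_smul_right, form_comm hM v u] at this
    linarith
  have hd := discrim_le_zero h
  rw [discrim] at hd
  apply abs_le_of_sq_le_sq _ (mul_nonneg (wnorm_nonneg _ _) (wnorm_nonneg _ _))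
  rw [mul_pow, wnorm_sq hM, wnorm_sq hM]
  linarith

lemma form_inv_mulVec {M : Matrix (Fin d) (Fin d) ℝ} (hM : M.PosDef) (u v : Vec d) :
    form M⁻¹ u (WithLp.toLp 2 (M *ᵥ v.ofLp)) = inner ℝ u v := by
  rw [form, inner_eq_dot, mulVec_mulVec, nonsing_inv_mul _ ((isUnit_iff_isUnit_det _).1 hM.isUnit),
    one_mulVec]

lemma form_mulVec_inv {M : Matrix (Fin d) (Fin d) ℝ} (hM : M.PosDef) (u v : Vec d) :
    form M u (WithLp.toLp 2 (M⁻¹ *ᵥ v.ofLp)) = inner ℝ u v := by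
  rw [form, inner_eq_dot, mulVec_mulVec, mul_nonsing_inv _ ((isUnit_iff_isUnit_det _).1 hM.isUnit),
    one_mulVec]

lemma wnorm_inv_mulVec {M : Matrix (Fin d) (Fin d) ℝ} (hM : M.PosDef) (v : Vec d) :
    wnorm M⁻¹ (WithLp.toLp 2 (M *ᵥ v.ofLp)) = wnorm M v := by
  rw [wnorm_eq, form_inv_mulVec hM, inner_eq_dot, wnorm_eq, form, dotProduct_comm]

/-- Cauchy–Schwarz for a weighted norm and its dual norm. -/
lemma abs_inner_le {M : Matrix (Fin d) (Fin d) ℝ} (hM : M.PosDef) (u v : Vec d) :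
    |inner ℝ u v| ≤ wnorm M⁻¹ u * wnorm M v := by
  rw [← form_inv_mulVec hM, ← wnorm_inv_mulVec hM]
  exact abs_form_le hM.inv _ _

/-- The dual weighted norm decreases when a positive semidefinite matrix is added: with
`u = N⁻¹ v`, `vᵀ N⁻¹ v = 2 uᵀ v - uᵀ N u ≤ 2 uᵀ v - uᵀ M u ≤ vᵀ M⁻¹ v`. -/
lemma form_inv_anti {M N : Matrix (Fin d) (Fin d) ℝ} (hM : M.PosDef) (hN : N.PosDef)
    (h : ∀ u, form M u u ≤ form N u u) (v : Vec d) : form N⁻¹ v v ≤ form M⁻¹ v v := by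
  set u : Vec d := WithLp.toLp 2 (N⁻¹ *ᵥ v.ofLp) with hu
  set x : Vec d := WithLp.toLp 2 (M⁻¹ *ᵥ v.ofLp) with hx
  have h1 : form N u u = inner ℝ u v := form_mulVec_inv hN u v
  have h2 : form N⁻¹ v v = inner ℝ u v := by
    rw [form, inner_eq_dot, dotProduct_comm]
  have h3 : form M⁻¹ v v = inner ℝ x v := by
    rw [form, inner_eq_dot, dotProduct_comm]
  have h4 : form M u x = inner ℝ u v := form_mulVec_inv hM u v
  have h5 : form M x x = inner ℝ x v := form_mulVec_inv hM x v
  have h6 := form_self_nonneg hM (u + (-1 : ℝ) • x)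
  rw [form_add_left, form_add_right, form_add_right, form_smul_left, form_smul_left,
    form_smul_right, form_smul_right, form_comm hM x u, h4, h5] at h6
  have := h u
  linarith

lemma form_vecMulVec (z u v : Vec d) :
    form (vecMulVec z.ofLp z.ofLp) u v = inner ℝ z u * inner ℝ z v := by
  rw [form, vecMulVec_mulVec, inner_eq_dot, inner_eq_dot, dotProduct_comm z.ofLp u.ofLp]
  simp [dotProduct_smul, mul_comm]

lemma form_add_mat (M N : Matrix (Fin d) (Fin d) ℝ) (u v : Vec d) :
    form (M + N) u v = form M u v + form N u v := by
  simp [form, add_mulVec, dotProduct_add]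

lemma form_smul_mat (c : ℝ) (M : Matrix (Fin d) (Fin d) ℝ) (u v : Vec d) :
    form (c • M) u v = c * form M u v := by
  simp [form, smul_mulVec, dotProduct_smul]

lemma form_one (u v : Vec d) : form 1 u v = inner ℝ u v := by
  simp [form, inner_eq_dot]

lemma posDef_add_smul_vecMulVec {M : Matrix (Fin d) (Fin d) ℝ} (hM : M.PosDef) {c : ℝ} (hc : 0 ≤ c)
    (z : Vec d) : (M + c • vecMulVec z.ofLp z.ofLp).PosDef := by
  have := posSemidef_vecMulVec_self_star z.ofLp
  exact hM.add_posSemidef (PosSemidef.smul (by simpa using this) hc)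

lemma det_add_smul_vecMulVec {M : Matrix (Fin d) (Fin d) ℝ} (hM : M.PosDef) (c : ℝ) (z : Vec d) :
    (M + c • vecMulVec z.ofLp z.ofLp).det = M.det * (1 + c * form M⁻¹ z z) := by
  have h : c • vecMulVec z.ofLp z.ofLp
      = replicateCol Unit (c • z.ofLp) * replicateRow Unit z.ofLp := by
    rw [← vecMulVec_eq, smul_vecMulVec]
  rw [h, det_add_replicateCol_mul_replicateRow ((isUnit_iff_isUnit_det _).1 hM.isUnit)]
  congr 1
  simp [Matrix.mul_apply, det_unique, form, mulVec, dotProduct, Finset.mul_sum, Finset.sum_mul]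
  rw [Finset.sum_comm]
  refine Finset.sum_congr rfl fun i _ => Finset.sum_congr rfl fun j _ => by ring

lemma det_le_pow {M : Matrix (Fin d) (Fin d) ℝ} (hM : M.PosDef) {b : ℝ}
    (h : ∀ u : Vec d, form M u u ≤ b * ‖u‖ ^ 2) : M.det ≤ b ^ d := by
  rw [hM.isHermitian.det_eq_prod_eigenvalues]
  have : ∀ i, hM.isHermitian.eigenvalues i ≤ b := by
    intro i
    have h1 := h (hM.isHermitian.eigenvectorBasis i)
    rw [hM.isHermitian.eigenvectorBasis.orthonormal.1 i] at h1
    rw [hM.isHermitian.eigenvalues_eq]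
    simpa [form] using h1
  calc ∏ i, ((hM.isHermitian.eigenvalues i : ℝ) : ℝ) ≤ ∏ i : Fin d, b :=
        Finset.prod_le_prod (fun i _ => (hM.eigenvalues_pos i).le) (fun i _ => this i)
    _ = b ^ d := by simp

/-! ### The link function, the estimator, and the run of the algorithm -/

lemma IsLink.lipschitz {μ : ℝ → ℝ} {κ Lμ : ℝ} (h : IsLink μ κ Lμ) (a b : ℝ) :
    |μ a - μ b| ≤ Lμ * |a - b| := by
  have := Convex.norm_image_sub_le_of_norm_deriv_le (f := μ) (C := Lμ) (s := Set.univ) (x := b)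
    (y := a) (fun x _ => h.differentiable x) (fun x _ => by
      rw [Real.norm_eq_abs, abs_of_nonneg (h.kappa_pos.le.trans (h.le_deriv x))]
      exact h.deriv_le x) convex_univ trivial trivial
  simpa using this

lemma IsLink.strongly_monotone {μ : ℝ → ℝ} {κ Lμ : ℝ} (h : IsLink μ κ Lμ) (a b : ℝ) :
    κ * (a - b) ^ 2 ≤ (μ a - μ b) * (a - b) := by
  have key : ∀ u v : ℝ, u ≤ v → κ * (v - u) ≤ μ v - μ u := fun u v huv =>
    mul_sub_le_image_sub_of_le_deriv h.differentiable h.le_deriv huv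
  rcases le_total a b with hab | hab
  · nlinarith [key a b hab, sub_nonneg.2 hab]
  · nlinarith [key b a hab, sub_nonneg.2 hab]

lemma IsLink.kappa_le {μ : ℝ → ℝ} {κ Lμ : ℝ} (h : IsLink μ κ Lμ) : κ ≤ Lμ :=
  (h.le_deriv 0).trans (h.deriv_le 0)

/-- A regularized generalized linear estimating equation is solvable: it is the vanishing of the
gradient of `c/2 ‖θ‖² + ∑ a_s (∫₀^{⟨z_s, θ⟩} μ - o_s ⟨z_s, θ⟩)`, which is continuous and
coercive. -/
lemma exists_estimating_eq {d : ℕ} {μ : ℝ → ℝ} (hμ : Monotone μ) (hc : Continuous μ) {c : ℝ}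
    (hc0 : 0 < c) (I : Finset ℕ) (a o : ℕ → ℝ) (ha : ∀ s, 0 ≤ a s) (z : ℕ → Vec d) :
    ∃ θ : Vec d, c • θ + ∑ s ∈ I, (a s * (μ (inner ℝ (z s) θ) - o s)) • z s = 0 := by
  set m : ℝ → ℝ := fun u => ∫ r in (0 : ℝ)..u, μ r with hm
  have hmd : ∀ u, HasDerivAt m (μ u) u := fun u =>
    intervalIntegral.integral_hasDerivAt_right (hc.intervalIntegrable _ _)
      (hc.stronglyMeasurableAtFilter _ _) hc.continuousAt
  have hmc : Continuous m := continuous_iff_continuousAt.2 fun u => (hmd u).continuousAt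
  have hmlow : ∀ u, μ 0 * u ≤ m u := by
    intro u
    rcases le_total 0 u with hu | hu
    · have := intervalIntegral.integral_mono_on (μ := volume) hu (f := fun _ => μ 0) (g := μ)
        (by simp) (hc.intervalIntegrable _ _) (fun x hx => hμ hx.1)
      simpa [mul_comm] using this
    · have := intervalIntegral.integral_mono_on (μ := volume) hu (f := μ) (g := fun _ => μ 0)
        (hc.intervalIntegrable _ _) (by simp) (fun x hx => hμ hx.2)
      rw [hm]; simp only
      rw [intervalIntegral.integral_symm]
      simp at this
      linarith
  set F : Vec d → ℝ := fun θ => c / 2 * ‖θ‖ ^ 2 +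
    ∑ s ∈ I, a s * (m (inner ℝ (z s) θ) - o s * inner ℝ (z s) θ) with hF
  have hFc : Continuous F := by
    refine Continuous.add (by fun_prop) (continuous_finsetSum _ fun s _ => ?_)
    refine continuous_const.mul (Continuous.sub (hmc.comp (by fun_prop)) (by fun_prop))
  set K : ℝ := ∑ s ∈ I, a s * |μ 0 - o s| * ‖z s‖ with hK
  have hlow : ∀ θ, ‖θ‖ * (c / 2 * ‖θ‖ - K) ≤ F θ := by
    intro θ
    have : ∀ s ∈ I, -(a s * |μ 0 - o s| * ‖z s‖ * ‖θ‖) ≤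
        a s * (m (inner ℝ (z s) θ) - o s * inner ℝ (z s) θ) := by
      intro s _
      have h1 := abs_real_inner_le_norm (z s) θ
      have h2 : |(μ 0 - o s) * inner ℝ (z s) θ| ≤ |μ 0 - o s| * (‖z s‖ * ‖θ‖) := by
        rw [abs_mul]; gcongr
      have h3 := (abs_le.1 h2).1
      have h4 := hmlow (inner ℝ (z s) θ)
      have h5 : -(|μ 0 - o s| * (‖z s‖ * ‖θ‖)) ≤
        m (inner ℝ (z s) θ) - o s * inner ℝ (z s) θ := by linarith
      have := mul_le_mul_of_nonneg_left h5 (ha s)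
      linarith
    have h2 := Finset.sum_le_sum this
    rw [Finset.sum_neg_distrib, ← Finset.sum_mul] at h2
    simp only [hF]
    rw [← hK] at h2
    linarith
  have htend : Filter.Tendsto F (Filter.cocompact _) Filter.atTop := by
    refine Filter.tendsto_atTop_mono hlow ?_
    have hn := tendsto_norm_cocompact_atTop (E := Vec d)
    refine hn.atTop_mul_atTop₀ ?_
    exact Filter.tendsto_atTop_add_const_right _ _ (hn.const_mul_atTop (by positivity))
  obtain ⟨θ, hθ⟩ := hFc.exists_forall_le htend
  refine ⟨θ, ?_⟩
  -- The derivative at the minimizer, in the direction of the gradient `v`, is `‖v‖²`.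
  set v : Vec d := c • θ + ∑ s ∈ I, (a s * (μ (inner ℝ (z s) θ) - o s)) • z s with hv
  have hder : HasDerivAt (fun r : ℝ => F (θ + r • v)) (inner ℝ v v) 0 := by
    have hin : ∀ w : Vec d, HasDerivAt (fun r : ℝ => inner ℝ w (θ + r • v)) (inner ℝ w v) 0 := by
      intro w
      have h : (fun r : ℝ => inner ℝ w (θ + r • v)) =
          fun r : ℝ => inner ℝ w θ + r * inner ℝ w v := by
        funext r; rw [inner_add_right, inner_smul_right]
      rw [h]
      simpa using ((hasDerivAt_id (0 : ℝ)).mul_const (inner ℝ w v)).const_add (inner ℝ w θ)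
    have h1 : HasDerivAt (fun r : ℝ => c / 2 * ‖θ + r • v‖ ^ 2) (c * inner ℝ θ v) 0 := by
      have h : (fun r : ℝ => c / 2 * ‖θ + r • v‖ ^ 2) = fun r : ℝ =>
          c / 2 * (‖θ‖ ^ 2 + r * (2 * inner ℝ θ v) + r ^ 2 * ‖v‖ ^ 2) := by
        funext r
        rw [norm_add_sq_real, inner_smul_right, norm_smul, mul_pow, Real.norm_eq_abs, sq_abs]; ring
      rw [h]
      have := ((((hasDerivAt_id (0 : ℝ)).mul_const (2 * inner ℝ θ v)).const_add (‖θ‖ ^ 2)).add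
        (((hasDerivAt_id (0 : ℝ)).pow 2).mul_const (‖v‖ ^ 2))).const_mul (c / 2)
      refine this.congr_deriv ?_
      simp
      ring
    have h2 : ∀ s ∈ I, HasDerivAt (fun r : ℝ => a s * (m (inner ℝ (z s) (θ + r • v)) -
        o s * inner ℝ (z s) (θ + r • v)))
        (a s * (μ (inner ℝ (z s) θ) - o s) * inner ℝ (z s) v) 0 := by
      intro s _
      have e : HasDerivAt m (μ (inner ℝ (z s) θ)) (inner ℝ (z s) (θ + (0 : ℝ) • v)) := by
        simpa using hmd (inner ℝ (z s) θ)
      have := ((e.comp 0 (hin (z s))).sub ((hin (z s)).const_mul (o s))).const_mul (a s)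
      refine this.congr_deriv ?_
      ring
    have h3 := h1.add (HasDerivAt.fun_sum h2)
    refine h3.congr_deriv ?_
    have e : ∀ w : Vec d, inner ℝ v w = c * inner ℝ θ w +
        ∑ s ∈ I, a s * (μ (inner ℝ (z s) θ) - o s) * inner ℝ (z s) w := by
      intro w
      rw [hv, inner_add_left, real_inner_smul_left, sum_inner]
      simp only [real_inner_smul_left]
    exact (e v).symm
  have hmin : IsLocalMin (fun r : ℝ => F (θ + r • v)) 0 :=
    Filter.Eventually.of_forall fun r => by simpa using hθ (θ + r • v)
  have := hmin.hasDerivAt_eq_zero hder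
  exact inner_self_eq_zero.1 this

namespace Trajectory
variable {d : ℕ} (p : Params) (τ : Trajectory d)

lemma idx_zero (ℓ : ℕ) : τ.idx 0 ℓ = ∅ := by simp [idx]

lemma idx_one (ℓ : ℕ) : τ.idx 1 ℓ = ∅ := by simp [idx]

lemma mem_idx {t ℓ s : ℕ} : s ∈ τ.idx t ℓ ↔ (1 ≤ s ∧ s < t) ∧ τ.layer s = some ℓ := by
  simp [idx]

lemma idx_succ_pos {t ℓ : ℕ} (h : 1 ≤ t ∧ τ.layer t = some ℓ) :
    τ.idx (t + 1) ℓ = insert t (τ.idx t ℓ) := by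
  ext s
  rw [Finset.mem_insert, mem_idx, mem_idx]
  constructor
  · rintro ⟨⟨h1, h2⟩, h3⟩
    rcases Nat.lt_succ_iff_lt_or_eq.1 h2 with h4 | h4
    · exact Or.inr ⟨⟨h1, h4⟩, h3⟩
    · exact Or.inl h4
  · rintro (rfl | ⟨⟨h1, h2⟩, h3⟩)
    · exact ⟨⟨h.1, Nat.lt_succ_self _⟩, h.2⟩
    · exact ⟨⟨h1, h2.trans (Nat.lt_succ_self _)⟩, h3⟩

lemma idx_succ_neg {t ℓ : ℕ} (h : ¬ (1 ≤ t ∧ τ.layer t = some ℓ)) :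
    τ.idx (t + 1) ℓ = τ.idx t ℓ := by
  ext s
  rw [mem_idx, mem_idx]
  constructor
  · rintro ⟨⟨h1, h2⟩, h3⟩
    rcases Nat.lt_succ_iff_lt_or_eq.1 h2 with h4 | rfl
    · exact ⟨⟨h1, h4⟩, h3⟩
    · exact absurd ⟨h1, h3⟩ h
  · rintro ⟨⟨h1, h2⟩, h3⟩
    exact ⟨⟨h1, h2.trans (Nat.lt_succ_self _)⟩, h3⟩

lemma notMem_idx_self (t ℓ : ℕ) : t ∉ τ.idx t ℓ := by simp [mem_idx]

lemma idx_mono {t t' : ℕ} (h : t ≤ t') (ℓ : ℕ) : τ.idx t ℓ ⊆ τ.idx t' ℓ := by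
  intro s hs
  rw [mem_idx] at hs ⊢
  exact ⟨⟨hs.1.1, hs.1.2.trans_le h⟩, hs.2⟩

lemma card_idx_le (t ℓ : ℕ) : (τ.idx (t + 1) ℓ).card ≤ t := by
  refine (Finset.card_filter_le _ _).trans ?_
  simp

lemma weight_eq {t ℓ : ℕ} (h : τ.layer t = some ℓ) :
    τ.weight t = (1 / 2 : ℝ) ^ ℓ / wnorm (τ.cov t ℓ)⁻¹ (τ.z t) := by
  simp [weight, h, width, z]

lemma cov_succ_pos {t ℓ : ℕ} (h : 1 ≤ t ∧ τ.layer t = some ℓ) :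
    τ.cov (t + 1) ℓ = τ.cov t ℓ + (τ.weight t ^ 2) • vecMulVec (τ.z t).ofLp (τ.z t).ofLp := by
  rw [cov, if_pos h, weight_eq τ h.2]

lemma cov_succ_neg {t ℓ : ℕ} (h : ¬ (1 ≤ t ∧ τ.layer t = some ℓ)) :
    τ.cov (t + 1) ℓ = τ.cov t ℓ := by
  rw [cov, if_neg h]

lemma cov_posDef (t ℓ : ℕ) : (τ.cov t ℓ).PosDef := by
  induction t with
  | zero => rw [cov]; exact PosDef.one.smul (by positivity)
  | succ t ih =>
    by_cases h : 1 ≤ t ∧ τ.layer t = some ℓ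
    · rw [cov_succ_pos τ h]
      exact posDef_add_smul_vecMulVec ih (sq_nonneg _) _
    · rw [cov_succ_neg τ h]; exact ih

lemma form_cov (t ℓ : ℕ) (u : Vec d) : form (τ.cov t ℓ) u u =
    (1 / 2 : ℝ) ^ (2 * ℓ) * ‖u‖ ^ 2 + ∑ s ∈ τ.idx t ℓ, τ.weight s ^ 2 * inner ℝ (τ.z s) u ^ 2 := by
  induction t with
  | zero => rw [cov, form_smul_mat, form_one, idx_zero, real_inner_self_eq_norm_sq]; simp
  | succ t ih =>
    by_cases h : 1 ≤ t ∧ τ.layer t = some ℓ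
    · rw [cov_succ_pos τ h, form_add_mat, ih, idx_succ_pos τ h,
        Finset.sum_insert (notMem_idx_self τ t ℓ), form_smul_mat, form_vecMulVec]
      ring
    · rw [cov_succ_neg τ h, ih, idx_succ_neg τ h]

/-- The estimator solves its defining equation at all times, not only just after an update. -/
lemma isMLE_est {Lμ : ℝ} (hp : IsLink p.μ p.κ Lμ) (t ℓ : ℕ) : τ.IsMLE p t ℓ (τ.est p t ℓ) := by
  induction t with
  | zero => simp [IsMLE, est, idx_zero]
  | succ t ih =>
    by_cases h : 1 ≤ t ∧ τ.layer t = some ℓ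
    · rw [est, if_pos h]
      apply Classical.epsilon_spec (p := τ.IsMLE p (t + 1) ℓ)
      exact exists_estimating_eq hp.monotone hp.differentiable.continuous
        (mul_pos (by positivity) hp.kappa_pos) _ (fun s => τ.weight s ^ 2) τ.o
        (fun s => sq_nonneg _) τ.z
    · rw [est, if_neg h, IsMLE, idx_succ_neg τ h]; exact ih

/-- The radius in use is the initial one, or the bonus at the last update, since when the data of
the layer have not changed. -/
lemma rad_spec (t ℓ : ℕ) :
    (τ.idx t ℓ = ∅ ∧ τ.rad p t ℓ = (1 / 2) ^ ℓ * (1 + 1 / p.κ)) ∨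
    ∃ t₀, 1 ≤ t₀ ∧ t₀ ≤ t ∧ τ.idx t₀ ℓ = τ.idx t ℓ ∧ τ.est p t₀ ℓ = τ.est p t ℓ ∧
      τ.cov t₀ ℓ = τ.cov t ℓ ∧ τ.rad p t ℓ = τ.bonus p t₀ ℓ := by
  induction t with
  | zero => left; simp [idx_zero, rad]
  | succ t ih =>
    by_cases h : 1 ≤ t ∧ τ.layer t = some ℓ
    · right
      exact ⟨t + 1, by omega, le_rfl, rfl, rfl, rfl, by rw [rad, if_pos h]⟩
    · rw [idx_succ_neg τ h, rad, if_neg h, est, if_neg h, cov_succ_neg τ h]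
      rcases ih with h1 | ⟨t₀, h0, h1, h2⟩
      · exact Or.inl h1
      · exact Or.inr ⟨t₀, h0, h1.trans (Nat.le_succ t), h2⟩

lemma half_pow_numLayers_le {p : Params} (hα : 0 < p.α) : (1 / 2 : ℝ) ^ p.numLayers ≤ p.α := by
  have h1 : Real.logb 2 (1 / p.α) ≤ p.numLayers := Nat.le_ceil _
  rw [Real.logb_le_iff_le_rpow (by norm_num) (by positivity), Real.rpow_natCast] at h1
  rw [one_div, inv_pow, inv_le_comm₀ (by positivity) hα]
  simpa using h1

variable {p τ}

lemma LoopReaches.one_le {t ℓ : ℕ} {B : Finset (Vec d)} (h : τ.LoopReaches p t ℓ B) : 1 ≤ ℓ := by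
  induction h <;> omega

lemma LoopReaches.subset {t ℓ : ℕ} {B : Finset (Vec d)} (h : τ.LoopReaches p t ℓ B) :
    B ⊆ τ.arms t := by
  induction h with
  | start => exact subset_rfl
  | eliminate ℓ B _ _ _ ih => exact (Finset.filter_subset _ _).trans ih

lemma LoopReaches.le_numLayers {t ℓ : ℕ} {B : Finset (Vec d)} (h : τ.LoopReaches p t ℓ B)
    (hα : 0 < p.α) (hL : 1 ≤ p.numLayers) : ℓ ≤ p.numLayers := by
  cases h with
  | start => exact hL
  | eliminate ℓ B _ h1 h2 =>
    by_contra hcon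
    -- Reaching a layer above `L` would require `2^{-L} > α`.
    refine h1 fun x hx y hy => (h2 x hx y hy).trans (le_trans ?_ (half_pow_numLayers_le hα))
    exact pow_le_pow_of_le_one (by norm_num) (by norm_num) (by omega)

variable {T : ℕ}

lemma IsRun.explored (h : τ.IsRun p T) {t ℓ : ℕ} (h1 : 1 ≤ t) (h2 : t ≤ T)
    (hl : τ.layer t = some ℓ) : ∃ B, τ.LoopReaches p t ℓ B ∧ τ.x t ∈ B ∧ τ.y t ∈ B ∧
      (1 / 2 : ℝ) ^ ℓ < wnorm (τ.cov t ℓ)⁻¹ (τ.z t) := by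
  have := h t (Finset.mem_Icc.2 ⟨h1, h2⟩)
  rw [hl] at this
  cases this with
  | explore ℓ B x y h1 h2 h3 h4 h5 => exact ⟨B, h1, h3, h4, h5⟩

lemma IsRun.exploited (h : τ.IsRun p T) {t : ℕ} (h1 : 1 ≤ t) (h2 : t ≤ T)
    (hl : τ.layer t = none) : ∃ ℓ B, τ.LoopReaches p t ℓ B ∧ τ.x t ∈ B ∧ τ.y t ∈ B ∧
      (∀ x' ∈ B, ∀ y' ∈ B, τ.width t ℓ x' y' ≤ p.α) ∧
      (∀ x' ∈ B, ∀ y' ∈ B, τ.score p t ℓ x' y' ≤ τ.score p t ℓ (τ.x t) (τ.y t)) := by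
  have := h t (Finset.mem_Icc.2 ⟨h1, h2⟩)
  rw [hl] at this
  cases this with
  | exploit ℓ B x y h1 h2 h3 h4 h5 => exact ⟨ℓ, B, h1, h3, h4, h2, h5⟩

lemma IsRun.mem_arms (h : τ.IsRun p T) {t : ℕ} (h1 : 1 ≤ t) (h2 : t ≤ T) :
    τ.x t ∈ τ.arms t ∧ τ.y t ∈ τ.arms t := by
  rcases hl : τ.layer t with _ | ℓ
  · obtain ⟨ℓ, B, hB, hx, hy, -⟩ := h.exploited h1 h2 hl
    exact ⟨hB.subset hx, hB.subset hy⟩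
  · obtain ⟨B, hB, hx, hy, -⟩ := h.explored h1 h2 hl
    exact ⟨hB.subset hx, hB.subset hy⟩

lemma IsRun.weight_pos (h : τ.IsRun p T) {t ℓ : ℕ} (h1 : 1 ≤ t) (h2 : t ≤ T)
    (hl : τ.layer t = some ℓ) : 0 < τ.weight t := by
  obtain ⟨B, -, -, -, hw⟩ := h.explored h1 h2 hl
  rw [weight_eq τ hl]
  have : (0 : ℝ) < (1 / 2) ^ ℓ := by positivity
  exact div_pos this (this.trans hw)

lemma IsRun.weight_le_one (h : τ.IsRun p T) {t ℓ : ℕ} (h1 : 1 ≤ t) (h2 : t ≤ T)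
    (hl : τ.layer t = some ℓ) : τ.weight t ≤ 1 := by
  obtain ⟨B, -, -, -, hw⟩ := h.explored h1 h2 hl
  rw [weight_eq τ hl]
  have : (0 : ℝ) < (1 / 2) ^ ℓ := by positivity
  exact (div_le_one (this.trans hw)).2 hw.le

/-- The weights make all explorations of a layer equally informative. -/
lemma IsRun.wnorm_weight_smul (h : τ.IsRun p T) {t ℓ : ℕ} (h1 : 1 ≤ t) (h2 : t ≤ T)
    (hl : τ.layer t = some ℓ) : τ.weight t * wnorm (τ.cov t ℓ)⁻¹ (τ.z t) = (1 / 2) ^ ℓ := by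
  obtain ⟨B, -, -, -, hw⟩ := h.explored h1 h2 hl
  rw [weight_eq τ hl]
  have : (0 : ℝ) < (1 / 2) ^ ℓ := by positivity
  exact div_mul_cancel₀ _ (this.trans hw).ne'

lemma IsRun.x_ne_y (h : τ.IsRun p T) {t ℓ : ℕ} (h1 : 1 ≤ t) (h2 : t ≤ T)
    (hl : τ.layer t = some ℓ) : τ.x t ≠ τ.y t := by
  obtain ⟨B, -, -, -, hw⟩ := h.explored h1 h2 hl
  intro he
  have : τ.z t = (0 : ℝ) • τ.z t := by simp [z, he]
  rw [this, wnorm_smul, abs_zero, zero_mul] at hw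
  have : (0 : ℝ) < (1 / 2) ^ ℓ := by positivity
  linarith

lemma IsRun.det_cov (h : τ.IsRun p T) {t : ℕ} (ht : t ≤ T + 1) (ℓ : ℕ) :
    (τ.cov t ℓ).det =
      ((1 / 2 : ℝ) ^ (2 * ℓ)) ^ d * (1 + (1 / 2 : ℝ) ^ (2 * ℓ)) ^ (τ.idx t ℓ).card := by
  induction t with
  | zero => rw [cov, det_smul, idx_zero]; simp
  | succ t ih =>
    by_cases hl : 1 ≤ t ∧ τ.layer t = some ℓ
    · have h3 := h.wnorm_weight_smul hl.1 (by omega) hl.2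
      rw [cov_succ_pos τ hl, det_add_smul_vecMulVec (cov_posDef τ t ℓ), ih (by omega),
        idx_succ_pos τ hl, Finset.card_insert_of_notMem (notMem_idx_self τ t ℓ),
        pow_succ (1 + _ : ℝ), ← wnorm_sq (cov_posDef τ t ℓ).inv, ← mul_pow, h3, mul_assoc]
      congr 3
      rw [← pow_mul, mul_comm]
    · rw [cov_succ_neg τ hl, idx_succ_neg τ hl, ih (by omega)]

lemma IsRun.norm_z_le (h : τ.IsRun p T) {A : ℝ}
    (hA : ∀ t ∈ Finset.Icc 1 T, ∀ x ∈ τ.arms t, ‖x‖ ≤ A) {t : ℕ} (h1 : 1 ≤ t) (h2 : t ≤ T) :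
    ‖τ.z t‖ ≤ 2 * A := by
  obtain ⟨hx, hy⟩ := h.mem_arms h1 h2
  have hx' := hA t (Finset.mem_Icc.2 ⟨h1, h2⟩) _ hx
  have hy' := hA t (Finset.mem_Icc.2 ⟨h1, h2⟩) _ hy
  exact (norm_sub_le _ _).trans (by linarith)

/-- The elliptical potential bound on the number of explorations of a layer. -/
lemma IsRun.card_idx_le (h : τ.IsRun p T) {A : ℝ}
    (hA : ∀ t ∈ Finset.Icc 1 T, ∀ x ∈ τ.arms t, ‖x‖ ≤ A) {t : ℕ} (ht : t ≤ T + 1) (ℓ : ℕ) :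
    ((τ.idx t ℓ).card : ℝ) ≤ 2 * 4 ^ ℓ * d * Real.log (1 + 4 ^ ℓ * (4 * A ^ 2 * T)) := by
  set q : ℝ := (1 / 2 : ℝ) ^ (2 * ℓ) with hq
  have hq0 : 0 < q := by positivity
  have hq1 : q ≤ 1 := pow_le_one₀ (by norm_num) (by norm_num)
  have hq4 : (4 : ℝ) ^ ℓ = 1 / q := by
    rw [hq, pow_mul, one_div, ← inv_pow]; norm_num
  have hform : ∀ u : Vec d, form (τ.cov t ℓ) u u ≤ (q + 4 * A ^ 2 * T) * ‖u‖ ^ 2 := by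
    intro u
    rw [form_cov, add_mul]
    gcongr
    have hs : ∀ s ∈ τ.idx t ℓ, τ.weight s ^ 2 * inner ℝ (τ.z s) u ^ 2 ≤ 4 * A ^ 2 * ‖u‖ ^ 2 := by
      intro s hs
      rw [mem_idx] at hs
      have h1 := h.weight_le_one hs.1.1 (by omega) hs.2
      have h0 := (h.weight_pos hs.1.1 (by omega) hs.2).le
      have hz := h.norm_z_le hA hs.1.1 (by omega)
      have h2 : inner ℝ (τ.z s) u ^ 2 ≤ (2 * A * ‖u‖) ^ 2 := by
        rw [← sq_abs]
        gcongr
        exact (abs_real_inner_le_norm _ _).trans (by gcongr)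
      calc τ.weight s ^ 2 * inner ℝ (τ.z s) u ^ 2 ≤ 1 ^ 2 * (2 * A * ‖u‖) ^ 2 := by gcongr
        _ = _ := by ring
    refine (Finset.sum_le_card_nsmul _ _ _ hs).trans ?_
    rw [nsmul_eq_mul]
    have : ((τ.idx t ℓ).card : ℝ) ≤ T := by
      have := (Finset.card_le_card (idx_mono τ ht ℓ)).trans (Trajectory.card_idx_le τ T ℓ)
      exact_mod_cast this
    nlinarith [mul_nonneg (sq_nonneg A) (sq_nonneg ‖u‖)]
  have hdet := det_le_pow (cov_posDef τ t ℓ) hform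
  rw [h.det_cov ht ℓ, ← hq] at hdet
  have hB : 0 ≤ 4 * A ^ 2 * (T : ℝ) := by positivity
  have h1 : (1 + q) ^ (τ.idx t ℓ).card ≤ (1 + 4 ^ ℓ * (4 * A ^ 2 * T)) ^ d := by
    have e : q + 4 * A ^ 2 * T = q * (1 + 4 ^ ℓ * (4 * A ^ 2 * T)) := by
      rw [hq4]; field_simp
    rw [e, mul_pow] at hdet
    exact le_of_mul_le_mul_left hdet (by positivity)
  have h2 := Real.log_le_log (by positivity) h1
  rw [Real.log_pow, Real.log_pow] at h2
  -- Each exploration raises the log-determinant by at least `4^{-ℓ} / 2`.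
  have h3 : q / 2 ≤ Real.log (1 + q) := by
    refine le_trans ?_ (Real.le_log_one_add_of_nonneg hq0.le)
    rw [div_le_div_iff₀ (by norm_num) (by positivity)]
    nlinarith
  have h4 : ((τ.idx t ℓ).card : ℝ) * (q / 2) ≤ d * Real.log (1 + 4 ^ ℓ * (4 * A ^ 2 * T)) :=
    le_trans (by gcongr) h2
  calc ((τ.idx t ℓ).card : ℝ) = 2 * 4 ^ ℓ * (((τ.idx t ℓ).card : ℝ) * (q / 2)) := by
        rw [hq4]; field_simp
    _ ≤ 2 * 4 ^ ℓ * (d * Real.log (1 + 4 ^ ℓ * (4 * A ^ 2 * T))) := by gcongr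
    _ = _ := by ring

end Trajectory

/-! ### Confidence ellipsoids with the variance-aware radius -/

/-- The logarithmic factor `log (4 x² L / δ)` of the confidence radius. -/
def Params.logTerm (p : Params) (x : ℝ) : ℝ := Real.log (4 * x ^ 2 * p.numLayers / p.δ)

/-- What is required of the inputs of the algorithm: a link function, a positive accuracy, a
confidence level in `(0, 1)`, and at least one layer. -/
structure Params.Valid (p : Params) : Prop where
  link : IsLink p.μ p.κ p.Lμ
  alpha_pos : 0 < p.α
  delta_pos : 0 < p.δ
  delta_lt_one : p.δ < 1
  one_le_numLayers : 1 ≤ p.numLayers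

lemma Params.Valid.four_le {p : Params} (hp : p.Valid) {x : ℝ} (hx : 1 ≤ x) :
    4 ≤ 4 * x ^ 2 * p.numLayers / p.δ := by
  rw [le_div_iff₀ hp.delta_pos]
  have h1 : (1 : ℝ) ≤ p.numLayers := by exact_mod_cast hp.one_le_numLayers
  have h2 : 1 ≤ x ^ 2 := one_le_pow₀ hx
  have h3 : 1 ≤ x ^ 2 * p.numLayers := one_le_mul_of_one_le_of_one_le h2 h1
  have := hp.delta_lt_one
  nlinarith

lemma Params.Valid.one_le_logTerm {p : Params} (hp : p.Valid) {x : ℝ} (hx : 1 ≤ x) :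
    1 ≤ p.logTerm x := by
  rw [Params.logTerm, Real.le_log_iff_exp_le (by linarith [hp.four_le hx])]
  linarith [hp.four_le hx, Real.exp_one_lt_d9]

lemma Params.Valid.logTerm_mono {p : Params} (hp : p.Valid) {x y : ℝ} (hx : 1 ≤ x) (h : x ≤ y) :
    p.logTerm x ≤ p.logTerm y := by
  have := hp.delta_pos
  apply Real.log_le_log (by linarith [hp.four_le hx])
  gcongr

namespace Trajectory
variable {d : ℕ}

/-- The noise `ε_t = o_t - μ((x_t - y_t)ᵀ θ)`. -/
def noise (μ : ℝ → ℝ) (θ : Vec d) (τ : Trajectory d) (t : ℕ) : ℝ :=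
  τ.o t - μ (inner ℝ (τ.z t) θ)

/-- The martingale `∑ w_s² ε_s (x_s - y_s)` of layer `ℓ`. -/
def noiseSum (μ : ℝ → ℝ) (θ : Vec d) (τ : Trajectory d) (t ℓ : ℕ) : Vec d :=
  ∑ s ∈ τ.idx t ℓ, (τ.weight s ^ 2 * τ.noise μ θ s) • τ.z s

/-- The weighted sum `∑ w_s² v_s` over the explorations of layer `ℓ` before round `t`. -/
def wsum (τ : Trajectory d) (v : ℕ → ℝ) (t ℓ : ℕ) : ℝ := ∑ s ∈ τ.idx t ℓ, τ.weight s ^ 2 * v s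

/-- The concentration event of layer `ℓ` at time `t`: a Bernstein bound for the noise sum in the
dual norm, and two-sided comparison of realized and conditional variances. -/
structure Concentrated (p : Params) (τ : Trajectory d) (θ : Vec d) (v : ℕ → ℝ) (t ℓ : ℕ) :
    Prop where
  noiseSum_le : wnorm (τ.cov t ℓ)⁻¹ (τ.noiseSum p.μ θ t ℓ) ≤
    (1 / 2) ^ ℓ * (5 * √(τ.wsum v t ℓ * p.logTerm t) + 5 * p.logTerm t)
  var_le : τ.wsum v t ℓ ≤
    2 * τ.wsum (fun s => τ.noise p.μ θ s ^ 2) t ℓ + 4 * p.logTerm (t + 1)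
  sq_le : τ.wsum (fun s => τ.noise p.μ θ s ^ 2) t ℓ ≤
    2 * τ.wsum v t ℓ + 2 * p.logTerm (t + 1)

lemma wsum_nonneg (τ : Trajectory d) {v : ℕ → ℝ} {t ℓ : ℕ} (hv : ∀ s ∈ τ.idx t ℓ, 0 ≤ v s) :
    0 ≤ τ.wsum v t ℓ :=
  Finset.sum_nonneg fun s hs => mul_nonneg (sq_nonneg _) (hv s hs)

/-- The error of the estimator is at most the norm of the noise sum plus the bias of the
regularization. -/
lemma wnorm_est_sub_le {p : Params} (hp : p.Valid) (τ : Trajectory d) {θ : Vec d} (hθ : ‖θ‖ ≤ 1)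
    (t ℓ : ℕ) : wnorm (τ.cov t ℓ) (τ.est p t ℓ - θ) ≤
      (1 / 2) ^ ℓ + wnorm (τ.cov t ℓ)⁻¹ (τ.noiseSum p.μ θ t ℓ) / p.κ := by
  set Δ := τ.est p t ℓ - θ with hΔ
  set W := wnorm (τ.cov t ℓ) Δ with hW
  have hκ := hp.link.kappa_pos
  have hW0 : 0 ≤ W := wnorm_nonneg _ _
  have hmle := isMLE_est p τ hp.link t ℓ
  rw [IsMLE] at hmle
  have h1 := congrArg (fun v => inner ℝ v Δ) hmle
  simp only [inner_add_left, real_inner_smul_left, sum_inner, inner_zero_left] at h1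
  have h2 : inner ℝ (τ.noiseSum p.μ θ t ℓ) Δ =
      ∑ s ∈ τ.idx t ℓ, τ.weight s ^ 2 * τ.noise p.μ θ s * inner ℝ (τ.z s) Δ := by
    rw [noiseSum, sum_inner]; simp only [real_inner_smul_left]
  have h3 : ∑ s ∈ τ.idx t ℓ, τ.weight s ^ 2 * (p.κ * inner ℝ (τ.z s) Δ ^ 2) ≤
      ∑ s ∈ τ.idx t ℓ, (τ.weight s ^ 2 * τ.noise p.μ θ s * inner ℝ (τ.z s) Δ +
        τ.weight s ^ 2 * (p.μ (inner ℝ (τ.z s) (τ.est p t ℓ)) - τ.o s) * inner ℝ (τ.z s) Δ) := by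
    refine Finset.sum_le_sum fun s _ => ?_
    have := hp.link.strongly_monotone (inner ℝ (τ.z s) (τ.est p t ℓ)) (inner ℝ (τ.z s) θ)
    rw [← inner_sub_right, ← hΔ] at this
    have := mul_le_mul_of_nonneg_left this (sq_nonneg (τ.weight s))
    refine this.trans (le_of_eq ?_)
    rw [noise]; ring
  rw [Finset.sum_add_distrib, ← h2] at h3
  have h4 : ∑ s ∈ τ.idx t ℓ, τ.weight s ^ 2 * (p.κ * inner ℝ (τ.z s) Δ ^ 2) =
      p.κ * (W ^ 2 - (1 / 2 : ℝ) ^ (2 * ℓ) * ‖Δ‖ ^ 2) := by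
    rw [hW, wnorm_sq (cov_posDef τ t ℓ), form_cov, add_sub_cancel_left, Finset.mul_sum]
    exact Finset.sum_congr rfl fun s _ => by ring
  have h5 : inner ℝ (τ.est p t ℓ) Δ = ‖Δ‖ ^ 2 + inner ℝ θ Δ := by
    have : τ.est p t ℓ = Δ + θ := by rw [hΔ]; abel
    rw [this, inner_add_left, real_inner_self_eq_norm_sq]
  have h6 : -(‖Δ‖) ≤ inner ℝ θ Δ := by
    have := abs_real_inner_le_norm θ Δ
    have h' : ‖θ‖ * ‖Δ‖ ≤ 1 * ‖Δ‖ := by gcongr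
    linarith [(abs_le.1 this).1]
  have h7 : (1 / 2 : ℝ) ^ ℓ * ‖Δ‖ ≤ W := by
    apply le_of_sq_le_sq _ hW0
    rw [hW, wnorm_sq (cov_posDef τ t ℓ), form_cov, mul_pow, ← pow_mul, mul_comm ℓ 2]
    have : 0 ≤ ∑ s ∈ τ.idx t ℓ, τ.weight s ^ 2 * inner ℝ (τ.z s) Δ ^ 2 :=
      Finset.sum_nonneg fun s _ => by positivity
    linarith
  have h8 := (le_abs_self _).trans (abs_inner_le (cov_posDef τ t ℓ) (τ.noiseSum p.μ θ t ℓ) Δ)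
  set N := wnorm (τ.cov t ℓ)⁻¹ (τ.noiseSum p.μ θ t ℓ)
  rw [h4] at h3
  rw [h5] at h1
  have hq : (1 / 2 : ℝ) ^ (2 * ℓ) = (1 / 2) ^ ℓ * (1 / 2) ^ ℓ := by rw [two_mul, pow_add]
  set r : ℝ := (1 / 2) ^ ℓ
  have hr : 0 < r := by positivity
  rw [hq] at h1 h3
  -- The bias is at most `κ 2^{-ℓ} W`, because `‖θ‖ ≤ 1` and `2^{-ℓ} ‖Δ‖ ≤ W`.
  have h9 : p.κ * W ^ 2 ≤ (N + p.κ * r) * W := by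
    have e1 : r * r * p.κ * (-‖Δ‖) ≤ r * r * p.κ * inner ℝ θ Δ := by gcongr
    have e2 : p.κ * r * (r * ‖Δ‖) ≤ p.κ * r * W := by gcongr
    linarith
  rcases hW0.eq_or_lt with h0 | h0
  · rw [← h0]
    have : 0 ≤ N := wnorm_nonneg _ _
    positivity
  · have h10 : p.κ * W ≤ N + p.κ * r := by
      have : (p.κ * W) * W ≤ (N + p.κ * r) * W := by linarith
      exact le_of_mul_le_mul_right this h0
    rw [← sub_le_iff_le_add', le_div_iff₀ hκ]
    linarith

/-- The prediction errors at the compared pairs are controlled by the estimation error. -/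
lemma wsum_sq_sub_le {p : Params} (hp : p.Valid) (τ : Trajectory d) (θ : Vec d) (t ℓ : ℕ) :
    τ.wsum (fun s => (p.μ (inner ℝ (τ.z s) (τ.est p t ℓ)) - p.μ (inner ℝ (τ.z s) θ)) ^ 2) t ℓ ≤
      p.Lμ ^ 2 * wnorm (τ.cov t ℓ) (τ.est p t ℓ - θ) ^ 2 := by
  rw [wnorm_sq (cov_posDef τ t ℓ), form_cov, mul_add, Finset.mul_sum, wsum]
  have : 0 ≤ p.Lμ ^ 2 * ((1 / 2 : ℝ) ^ (2 * ℓ) * ‖τ.est p t ℓ - θ‖ ^ 2) := by positivity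
  refine le_trans (Finset.sum_le_sum fun s _ => ?_) (le_add_of_nonneg_left this)
  have h := hp.link.lipschitz (inner ℝ (τ.z s) (τ.est p t ℓ)) (inner ℝ (τ.z s) θ)
  rw [← inner_sub_right] at h
  have h2 : (p.μ (inner ℝ (τ.z s) (τ.est p t ℓ)) - p.μ (inner ℝ (τ.z s) θ)) ^ 2 ≤
      (p.Lμ * |inner ℝ (τ.z s) (τ.est p t ℓ - θ)|) ^ 2 := by
    rw [← sq_abs (_ - _)]; gcongr
  rw [mul_pow, sq_abs] at h2
  calc τ.weight s ^ 2 * _ ≤ τ.weight s ^ 2 * _ := mul_le_mul_of_nonneg_left h2 (sq_nonneg _)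
    _ = _ := by ring

/-- Realized squared residuals and squared noises are comparable up to the prediction errors. -/
lemma wsum_sq_le_of_add (τ : Trajectory d) {f g h : ℕ → ℝ} (t ℓ : ℕ) (hf : ∀ s, f s = g s + h s) :
    τ.wsum (fun s => f s ^ 2) t ℓ ≤
      2 * τ.wsum (fun s => g s ^ 2) t ℓ + 2 * τ.wsum (fun s => h s ^ 2) t ℓ := by
  rw [wsum, wsum, wsum, Finset.mul_sum, Finset.mul_sum, ← Finset.sum_add_distrib]
  refine Finset.sum_le_sum fun s _ => ?_
  have : f s ^ 2 ≤ 2 * g s ^ 2 + 2 * h s ^ 2 := by rw [hf]; nlinarith [sq_nonneg (g s - h s)]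
  calc τ.weight s ^ 2 * f s ^ 2 ≤ τ.weight s ^ 2 * (2 * g s ^ 2 + 2 * h s ^ 2) := by gcongr
    _ = _ := by ring

end Trajectory

/-- In a layer where the variance is estimated, the weighted prediction error `D` is small: `r` is
the width of the layer, `W` the estimation error. -/
lemma prediction_error_le {κ Lμ r i i' V W D : ℝ} (hκ : 0 < κ) (hr : 0 < r)
    (hi0 : 0 < i) (hi : i ≤ i') (hV : 0 ≤ V) (hW0 : 0 ≤ W) (hD : D ≤ Lμ ^ 2 * W ^ 2) (hL : 0 < Lμ)
    (hW : W ≤ r + r * (5 * √(V * i) + 5 * i) / κ) (hthr : 64 * (Lμ / κ) * √i' ≤ 1 / r) :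
    D * i' ≤ (3 * κ ^ 2 + 75 * (V * i) + 75 * (i * i)) / 4096 := by
  set u := √(V * i) with hu
  have hu2 : u ^ 2 = V * i := Real.sq_sqrt (by positivity)
  have hu0 : 0 ≤ u := Real.sqrt_nonneg _
  have hi'0 : 0 < i' := hi0.trans_le hi
  have hs : √i' ^ 2 = i' := Real.sq_sqrt hi'0.le
  have h1 : 64 * Lμ * r * √i' ≤ κ := by
    rw [le_div_iff₀ hr] at hthr
    calc 64 * Lμ * r * √i' = 64 * (Lμ / κ) * √i' * r * κ := by field_simp
      _ ≤ 1 * κ := by gcongr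
      _ = κ := one_mul κ
  have h2 : κ * W ≤ r * (κ + 5 * u + 5 * i) := by
    calc κ * W ≤ κ * (r + r * (5 * u + 5 * i) / κ) := by gcongr
      _ = _ := by field_simp; ring
  have h3 : κ * (64 * Lμ * W * √i') ≤ κ * (κ + 5 * u + 5 * i) := by
    calc κ * (64 * Lμ * W * √i') = 64 * Lμ * √i' * (κ * W) := by ring
      _ ≤ 64 * Lμ * √i' * (r * (κ + 5 * u + 5 * i)) := by gcongr
      _ = (64 * Lμ * r * √i') * (κ + 5 * u + 5 * i) := by ring
      _ ≤ κ * (κ + 5 * u + 5 * i) := by gcongr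
  have h4 := le_of_mul_le_mul_left h3 hκ
  have h5 : (64 * Lμ * W * √i') ^ 2 ≤ (κ + 5 * u + 5 * i) ^ 2 := by gcongr
  have h6 : (κ + 5 * u + 5 * i) ^ 2 ≤ 3 * (κ ^ 2 + 25 * u ^ 2 + 25 * (i * i)) := by
    nlinarith [sq_nonneg (κ - 5 * u), sq_nonneg (κ - 5 * i), sq_nonneg (5 * u - 5 * i)]
  have h7 : D * i' ≤ Lμ ^ 2 * W ^ 2 * i' := by gcongr
  have h8 : (64 * Lμ * W * √i') ^ 2 = 4096 * (Lμ ^ 2 * W ^ 2 * i') := by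
    rw [mul_pow, hs]; ring
  rw [hu2] at h6
  linarith

lemma sqrt_add_le_add (a b : ℝ) : √(a + b) ≤ √a + √b := by
  rcases le_total 0 a with ha | ha
  · rcases le_total 0 b with hb | hb
    · rw [Real.sqrt_le_left (by positivity), add_sq, Real.sq_sqrt ha, Real.sq_sqrt hb]
      have : 0 ≤ √a * √b := by positivity
      linarith
    · exact (Real.sqrt_le_sqrt (by linarith)).trans (le_add_of_nonneg_right (Real.sqrt_nonneg _))
  · exact (Real.sqrt_le_sqrt (by linarith)).trans (le_add_of_nonneg_left (Real.sqrt_nonneg _))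

/-- The estimated variance `Y` may replace the true variance `V` in the confidence radius. The term
`κ` on the right is paid by the difference of `2^{-ℓ+1}` and `2^{-ℓ}`. -/
lemma sqrt_var_le {κ i i' V Q Y D : ℝ} (hκ : 0 < κ) (hi0 : 0 < i) (hi : i ≤ i') (hV : 0 ≤ V)
    (hD : D * i' ≤ (3 * κ ^ 2 + 75 * (V * i) + 75 * (i * i)) / 4096)
    (hVQ : V ≤ 2 * Q + 4 * i') (hQ : Q ≤ 2 * Y + 2 * D) (hY : 0 ≤ Y) :
    5 * √(V * i) ≤ 16 * √((8 * Y + 18 * i') * i) + κ := by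
  have hi'0 : 0 < i' := hi0.trans_le hi
  have h1 : V * i' ≤ (4 * Y + 4 * D + 4 * i') * i' := by gcongr; linarith
  have h2 : V * i ≤ V * i' := by gcongr
  have h3 : i * i ≤ i' * i' := by gcongr
  have h4 : V * i' ≤ 8 * Y * i' + 18 * i' * i' + κ ^ 2 / 300 := by nlinarith [mul_nonneg hY hi'0.le]
  have h5 : V * i ≤ (8 * Y + 18 * i') * i + (κ / 17) ^ 2 := by
    have e : V * i' * (i / i') ≤ (8 * Y * i' + 18 * i' * i' + κ ^ 2 / 300) * (i / i') := by gcongr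
    have e1 : V * i' * (i / i') = V * i := by field_simp
    have e2 : (8 * Y * i' + 18 * i' * i' + κ ^ 2 / 300) * (i / i') =
      (8 * Y + 18 * i') * i + κ ^ 2 / 300 * (i / i') := by field_simp
    have e3 : i / i' ≤ 1 := (div_le_one hi'0).2 hi
    have e4 : κ ^ 2 / 300 * (i / i') ≤ κ ^ 2 / 300 * 1 := by gcongr
    rw [e1, e2] at e
    nlinarith [sq_nonneg κ]
  have h6 := (Real.sqrt_le_sqrt h5).trans (sqrt_add_le_add _ _)
  rw [Real.sqrt_sq (by positivity)] at h6
  have := Real.sqrt_nonneg ((8 * Y + 18 * i') * i)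
  linarith

/-- The estimated variance is not much larger than the true one. -/
lemma sqrt_varEst_le {κ i i' V Q Y D : ℝ} (hκ : 0 < κ) (hi0 : 0 < i) (hi : i ≤ i') (hV : 0 ≤ V)
    (hD : D * i' ≤ (3 * κ ^ 2 + 75 * (V * i) + 75 * (i * i)) / 4096) (hD0 : 0 ≤ D)
    (hQV : Q ≤ 2 * V + 2 * i') (hY : Y ≤ 2 * Q + 2 * D) :
    √((8 * Y + 18 * i') * i) ≤ 6 * √(V * i) + 8 * i' + κ := by
  have hi'0 : 0 < i' := hi0.trans_le hi
  have h1 : D * i ≤ D * i' := by gcongr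
  have h2 : i * i ≤ i' * i' := by gcongr
  have h3 : i' * i ≤ i' * i' := by gcongr
  have h4 : Y * i ≤ (4 * V + 4 * i' + 2 * D) * i := by gcongr; linarith
  have h5 : 0 ≤ V * i := by positivity
  have h6 : (8 * Y + 18 * i') * i ≤ 36 * (V * i) + 64 * (i' * i') + κ ^ 2 := by
    nlinarith [sq_nonneg κ]
  rw [Real.sqrt_le_left (by positivity)]
  refine h6.trans ?_
  have h7 : √(V * i) ^ 2 = V * i := Real.sq_sqrt h5
  have h8 := Real.sqrt_nonneg (V * i)
  nlinarith [mul_nonneg h8 hi'0.le, mul_nonneg h8 hκ.le, mul_pos hi'0 hκ]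

namespace Trajectory
variable {d : ℕ} {p : Params} {τ : Trajectory d} {T : ℕ} {θ : Vec d} {v : ℕ → ℝ}

lemma bonus_eq (p : Params) (τ : Trajectory d) (t ℓ : ℕ) : τ.bonus p t ℓ =
    16 * (1 / 2) ^ ℓ / p.κ *
      √((8 * τ.varEst p t ℓ + 18 * p.logTerm (t + 1)) * p.logTerm t) +
    6 * (1 / 2) ^ ℓ / p.κ * p.logTerm t + 2 * (1 / 2) ^ ℓ := rfl

/-- The variance is estimated in layer `ℓ` at time `t`. -/
def Estimated (p : Params) (t ℓ : ℕ) : Prop :=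
  64 * (p.Lμ / p.κ) * √(p.logTerm (t + 1)) ≤ 2 ^ ℓ

lemma varEst_of_estimated {t ℓ : ℕ} (h : Estimated p t ℓ) : τ.varEst p t ℓ =
    τ.wsum (fun s => (τ.o s - p.μ (inner ℝ (τ.z s) (τ.est p t ℓ))) ^ 2) t ℓ := by
  exact (if_pos h).trans rfl

lemma varEst_of_not_estimated {t ℓ : ℕ} (h : ¬ Estimated p t ℓ) :
    τ.varEst p t ℓ = ((τ.idx t ℓ).card : ℝ) := by
  exact if_neg h

lemma IsRun.wsum_le_card (h : τ.IsRun p T) (hv : ∀ s ∈ Finset.Icc 1 T, 0 ≤ v s ∧ v s ≤ 1) {t : ℕ}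
    (ht : t ≤ T + 1) (ℓ : ℕ) : τ.wsum v t ℓ ≤ ((τ.idx t ℓ).card : ℝ) := by
  rw [wsum, Finset.card_eq_sum_ones, Nat.cast_sum]
  refine Finset.sum_le_sum fun s hs => ?_
  rw [mem_idx] at hs
  obtain ⟨h0, h1⟩ := hv s (Finset.mem_Icc.2 ⟨hs.1.1, by omega⟩)
  have h2 := h.weight_le_one hs.1.1 (by omega) hs.2
  have h3 := (h.weight_pos hs.1.1 (by omega) hs.2).le
  calc τ.weight s ^ 2 * v s ≤ 1 ^ 2 * 1 := by gcongr
    _ = _ := by norm_num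

lemma Concentrated.wnorm_le (hp : p.Valid) (hθ : ‖θ‖ ≤ 1) {t ℓ : ℕ}
    (hc : τ.Concentrated p θ v t ℓ) : wnorm (τ.cov t ℓ) (τ.est p t ℓ - θ) ≤ (1 / 2) ^ ℓ +
      (1 / 2) ^ ℓ * (5 * √(τ.wsum v t ℓ * p.logTerm t) + 5 * p.logTerm t) / p.κ := by
  refine (wnorm_est_sub_le hp τ hθ t ℓ).trans ?_
  have := hp.link.kappa_pos
  gcongr
  exact hc.noiseSum_le

lemma Concentrated.prediction_error (hp : p.Valid) (hθ : ‖θ‖ ≤ 1) {t ℓ : ℕ} (ht1 : 1 ≤ t)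
    (hV : 0 ≤ τ.wsum v t ℓ) (hc : τ.Concentrated p θ v t ℓ) (hest : Estimated p t ℓ) :
    τ.wsum (fun s => (p.μ (inner ℝ (τ.z s) (τ.est p t ℓ)) - p.μ (inner ℝ (τ.z s) θ)) ^ 2) t ℓ *
      p.logTerm (t + 1) ≤ (3 * p.κ ^ 2 + 75 * (τ.wsum v t ℓ * p.logTerm t) +
        75 * (p.logTerm t * p.logTerm t)) / 4096 := by
  have h1 : (1 : ℝ) ≤ t := by exact_mod_cast ht1
  refine prediction_error_le hp.link.kappa_pos (r := (1 / 2) ^ ℓ) (by positivity)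
    (by linarith [hp.one_le_logTerm h1]) (hp.logTerm_mono h1 (by linarith)) hV (wnorm_nonneg _ _)
    (wsum_sq_sub_le hp τ θ t ℓ) (hp.link.kappa_pos.trans_le hp.link.kappa_le)
    (hc.wnorm_le hp hθ) ?_
  rw [Estimated] at hest
  simpa using hest

/-- On the concentration event the ellipsoid of radius `bonus` around the estimator contains the
parameter. -/
lemma Concentrated.wnorm_le_bonus (hp : p.Valid) (hrun : τ.IsRun p T) (hθ : ‖θ‖ ≤ 1)
    (hv : ∀ s ∈ Finset.Icc 1 T, 0 ≤ v s ∧ v s ≤ 1) {t ℓ : ℕ} (ht1 : 1 ≤ t) (ht : t ≤ T)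
    (hc : τ.Concentrated p θ v t ℓ) :
    wnorm (τ.cov t ℓ) (τ.est p t ℓ - θ) ≤ τ.bonus p t ℓ := by
  have h1 : (1 : ℝ) ≤ t := by exact_mod_cast ht1
  have hi1 := hp.one_le_logTerm h1
  have hi := hp.logTerm_mono h1 (y := t + 1) (by linarith)
  have hκ := hp.link.kappa_pos
  have hV : 0 ≤ τ.wsum v t ℓ := wsum_nonneg τ fun s hs => by
    rw [mem_idx] at hs
    exact (hv s (Finset.mem_Icc.2 ⟨hs.1.1, by omega⟩)).1
  have hmain : 5 * √(τ.wsum v t ℓ * p.logTerm t) ≤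
      16 * √((8 * τ.varEst p t ℓ + 18 * p.logTerm (t + 1)) * p.logTerm t) + p.κ := by
    by_cases hest : Estimated p t ℓ
    · have hD := hc.prediction_error hp hθ ht1 hV hest
      refine sqrt_var_le hκ (by linarith) hi hV hD hc.var_le ?_ ?_
      · rw [varEst_of_estimated hest]
        exact wsum_sq_le_of_add τ t ℓ fun s => by rw [noise]; ring
      · rw [varEst_of_estimated hest]
        exact wsum_nonneg τ fun s _ => sq_nonneg _
    · -- Here the variance proxy is the number of explorations, an upper bound of `V`.
      rw [varEst_of_not_estimated hest]
      have h2 := hrun.wsum_le_card hv (t := t) (by omega) ℓ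
      have h3 : √(τ.wsum v t ℓ * p.logTerm t) ≤
          √((8 * ((τ.idx t ℓ).card : ℝ) + 18 * p.logTerm (t + 1)) * p.logTerm t) := by
        apply Real.sqrt_le_sqrt
        gcongr
        linarith
      have := Real.sqrt_nonneg (τ.wsum v t ℓ * p.logTerm t)
      linarith
  refine (hc.wnorm_le hp hθ).trans ?_
  rw [bonus_eq]
  have hr : (0 : ℝ) < (1 / 2) ^ ℓ := by positivity
  set r : ℝ := (1 / 2) ^ ℓ
  set X := √((8 * τ.varEst p t ℓ + 18 * p.logTerm (t + 1)) * p.logTerm t)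
  calc r + r * (5 * √(τ.wsum v t ℓ * p.logTerm t) + 5 * p.logTerm t) / p.κ
      ≤ r + r * ((16 * X + p.κ) + 6 * p.logTerm t) / p.κ := by gcongr; norm_num
    _ = _ := by field_simp; ring

/-- On the concentration event the ellipsoid of radius `rad` around the estimator contains the
parameter. -/
lemma wnorm_le_rad (hp : p.Valid) (hrun : τ.IsRun p T) (hθ : ‖θ‖ ≤ 1)
    (hv : ∀ s ∈ Finset.Icc 1 T, 0 ≤ v s ∧ v s ≤ 1) {t ℓ : ℕ} (ht : t ≤ T)
    (hc : ∀ t ∈ Finset.Icc 1 T, τ.Concentrated p θ v t ℓ) :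
    wnorm (τ.cov t ℓ) (τ.est p t ℓ - θ) ≤ τ.rad p t ℓ := by
  rcases rad_spec p τ t ℓ with ⟨h1, h2⟩ | ⟨t₀, h0, h1, h2, h3, h4, h5⟩
  · rw [h2]
    refine (wnorm_est_sub_le hp τ hθ t ℓ).trans ?_
    have e : τ.noiseSum p.μ θ t ℓ = (0 : ℝ) • 0 := by simp [noiseSum, h1]
    rw [e, wnorm_smul]
    have := hp.link.kappa_pos
    have : (0 : ℝ) ≤ (1 / 2) ^ ℓ * (1 / p.κ) := by positivity
    simp only [abs_zero, zero_mul, zero_div]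
    linarith
  · rw [← h3, ← h4, h5]
    exact (hc t₀ (Finset.mem_Icc.2 ⟨h0, h1.trans ht⟩)).wnorm_le_bonus hp hrun hθ hv h0
      (h1.trans ht)

lemma wsum_mono (hv : ∀ s ∈ Finset.Icc 1 T, 0 ≤ v s ∧ v s ≤ 1) {t t' : ℕ} (h : t ≤ t')
    (ht : t' ≤ T + 1) (ℓ : ℕ) : τ.wsum v t ℓ ≤ τ.wsum v t' ℓ := by
  refine Finset.sum_le_sum_of_subset_of_nonneg (idx_mono τ h ℓ) fun s hs _ => ?_
  rw [mem_idx] at hs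
  exact mul_nonneg (sq_nonneg _) (hv s (Finset.mem_Icc.2 ⟨hs.1.1, by omega⟩)).1

lemma Estimated.mono (hp : p.Valid) {t t' ℓ : ℕ} (h : Estimated p t' ℓ) (ht : 1 ≤ t)
    (htt : t ≤ t') : Estimated p t ℓ := by
  refine le_trans ?_ h
  have := hp.link.kappa_pos
  have h2 := this.trans_le hp.link.kappa_le
  have h3 : (1 : ℝ) ≤ t := by exact_mod_cast ht
  have h4 : (t : ℝ) ≤ t' := by exact_mod_cast htt
  gcongr
  exact hp.logTerm_mono (by linarith) (by linarith)

lemma Concentrated.bonus_le (hp : p.Valid) (hθ : ‖θ‖ ≤ 1) {t ℓ : ℕ} (ht1 : 1 ≤ t)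
    (hV : 0 ≤ τ.wsum v t ℓ) (hc : τ.Concentrated p θ v t ℓ) (hest : Estimated p t ℓ) :
    τ.bonus p t ℓ ≤ (1 / 2) ^ ℓ * ((96 * √(τ.wsum v t ℓ * p.logTerm t) +
      135 * p.logTerm (t + 1)) / p.κ + 18) := by
  have hκ := hp.link.kappa_pos
  have hr : (0 : ℝ) < (1 / 2) ^ ℓ := by positivity
  have h1 : (1 : ℝ) ≤ t := by exact_mod_cast ht1
  have hi1 := hp.one_le_logTerm h1
  have hi := hp.logTerm_mono h1 (y := t + 1) (by linarith)
  have hD := hc.prediction_error hp hθ ht1 hV hest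
  have hmain := sqrt_varEst_le hκ (by linarith) hi hV hD
    (wsum_nonneg τ fun s _ => sq_nonneg _) hc.sq_le
    (Y := τ.varEst p t ℓ) (by
      rw [varEst_of_estimated hest]
      have := wsum_sq_le_of_add τ (f := fun s => τ.o s - p.μ (inner ℝ (τ.z s) (τ.est p t ℓ)))
        (g := fun s => τ.noise p.μ θ s)
        (h := fun s => p.μ (inner ℝ (τ.z s) θ) - p.μ (inner ℝ (τ.z s) (τ.est p t ℓ))) t ℓ
        fun s => by rw [noise]; ring
      refine this.trans (le_of_eq ?_)
      congr 3
      funext s; ring)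
  rw [bonus_eq]
  set r : ℝ := (1 / 2) ^ ℓ
  set U := √(τ.wsum v t ℓ * p.logTerm t)
  set I := p.logTerm (t + 1)
  calc _ ≤ 16 * r / p.κ * (6 * U + 8 * I + p.κ) + 6 * r / p.κ * I + 2 * r := by gcongr
    _ = r * ((96 * U + 134 * I) / p.κ + 18) := by field_simp; ring
    _ ≤ _ := by
      have : 134 * I ≤ 135 * I := by linarith
      gcongr

/-- The size of the radius, in a layer where the variance is estimated throughout. -/
lemma rad_le_of_estimated (hp : p.Valid) (hθ : ‖θ‖ ≤ 1)
    (hv : ∀ s ∈ Finset.Icc 1 T, 0 ≤ v s ∧ v s ≤ 1) {t ℓ : ℕ} (ht : t ≤ T)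
    (hc : ∀ t ∈ Finset.Icc 1 T, τ.Concentrated p θ v t ℓ) (hest : Estimated p T ℓ) :
    τ.rad p t ℓ ≤ (1 / 2) ^ ℓ * ((96 * √(τ.wsum v (T + 1) ℓ * p.logTerm (T + 1)) +
      135 * p.logTerm (T + 1)) / p.κ + 18) := by
  have hκ := hp.link.kappa_pos
  have hr : (0 : ℝ) < (1 / 2) ^ ℓ := by positivity
  rcases rad_spec p τ t ℓ with ⟨h1, h2⟩ | ⟨t₀, h0, h1, h2, h3, h4, h5⟩
  · rw [h2]
    have h5 : (1 : ℝ) ≤ T + 1 := by linarith [(Nat.cast_nonneg T : (0 : ℝ) ≤ T)]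
    have := hp.one_le_logTerm h5
    gcongr (1 / 2) ^ ℓ * ?_
    rw [add_comm]
    gcongr
    · linarith [Real.sqrt_nonneg (τ.wsum v (T + 1) ℓ * p.logTerm (T + 1))]
    · norm_num
  · rw [h5]
    have ht1 : (1 : ℝ) ≤ t₀ := by exact_mod_cast h0
    have htT : (t₀ : ℝ) ≤ T := by exact_mod_cast h1.trans ht
    have hV : 0 ≤ τ.wsum v t₀ ℓ := wsum_nonneg τ fun s hs => by
      rw [mem_idx] at hs
      exact (hv s (Finset.mem_Icc.2 ⟨hs.1.1, by omega⟩)).1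
    have hVT := wsum_mono (τ := τ) hv (t := t₀) (t' := T + 1) (by omega) le_rfl ℓ
    refine ((hc t₀ (Finset.mem_Icc.2 ⟨h0, h1.trans ht⟩)).bonus_le hp hθ h0 hV
      (hest.mono hp h0 (h1.trans ht))).trans ?_
    have h6 := hp.logTerm_mono ht1 (y := T + 1) (by linarith)
    have h7 := hp.logTerm_mono (x := t₀ + 1) (y := T + 1) (by linarith) (by linarith)
    have := hp.one_le_logTerm ht1
    have hs : √(τ.wsum v t₀ ℓ * p.logTerm t₀) ≤ √(τ.wsum v (T + 1) ℓ * p.logTerm (T + 1)) := by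
      apply Real.sqrt_le_sqrt
      exact mul_le_mul hVT h6 (by linarith) (hV.trans hVT)
    gcongr

/-- A crude bound of the radius, in any layer. -/
lemma IsRun.rad_le (hp : p.Valid) (hrun : τ.IsRun p T) (hθ : ‖θ‖ ≤ 1)
    (hv : ∀ s ∈ Finset.Icc 1 T, 0 ≤ v s ∧ v s ≤ 1) {t ℓ : ℕ} (ht : t ≤ T)
    (hc : ∀ t ∈ Finset.Icc 1 T, τ.Concentrated p θ v t ℓ) :
    τ.rad p t ℓ ≤ (96 * √(T * p.logTerm (T + 1)) + 135 * p.logTerm (T + 1)) / p.κ + 18 := by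
  have hκ := hp.link.kappa_pos
  have hr : (0 : ℝ) < (1 / 2) ^ ℓ := by positivity
  have hr1 : (1 / 2 : ℝ) ^ ℓ ≤ 1 := pow_le_one₀ (by norm_num) (by norm_num)
  have h5 : (1 : ℝ) ≤ T + 1 := by linarith [(Nat.cast_nonneg T : (0 : ℝ) ≤ T)]
  have hI := hp.one_le_logTerm h5
  have hU := Real.sqrt_nonneg (T * p.logTerm (T + 1))
  suffices h : τ.rad p t ℓ ≤
      (1 / 2) ^ ℓ * ((96 * √(T * p.logTerm (T + 1)) + 135 * p.logTerm (T + 1)) / p.κ + 18) by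
    refine h.trans (mul_le_of_le_one_left ?_ hr1)
    positivity
  rcases rad_spec p τ t ℓ with ⟨h1, h2⟩ | ⟨t₀, h0, h1, h2, h3, h4, h5⟩
  · rw [h2]
    gcongr (1 / 2) ^ ℓ * ?_
    rw [add_comm]
    gcongr
    · linarith
    · norm_num
  · rw [h5]
    have ht1 : (1 : ℝ) ≤ t₀ := by exact_mod_cast h0
    have htT : (t₀ : ℝ) ≤ T := by exact_mod_cast h1.trans ht
    have hV : 0 ≤ τ.wsum v t₀ ℓ := wsum_nonneg τ fun s hs => by
      rw [mem_idx] at hs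
      exact (hv s (Finset.mem_Icc.2 ⟨hs.1.1, by omega⟩)).1
    have hcard : ((τ.idx t₀ ℓ).card : ℝ) ≤ T := by
      have := (Finset.card_le_card (idx_mono τ (show t₀ ≤ T + 1 by omega) ℓ)).trans
        (Trajectory.card_idx_le τ T ℓ)
      exact_mod_cast this
    have hVT : τ.wsum v t₀ ℓ ≤ T := (hrun.wsum_le_card hv (by omega) ℓ).trans hcard
    have h6 := hp.logTerm_mono ht1 (y := T + 1) (by linarith)
    have h7 := hp.logTerm_mono (x := t₀ + 1) (y := T + 1) (by linarith) (by linarith)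
    have h8 := hp.one_le_logTerm ht1
    have hT0 : (0 : ℝ) ≤ T := Nat.cast_nonneg T
    by_cases hest : Estimated p t₀ ℓ
    · refine ((hc t₀ (Finset.mem_Icc.2 ⟨h0, h1.trans ht⟩)).bonus_le hp hθ h0 hV hest).trans ?_
      have hs : √(τ.wsum v t₀ ℓ * p.logTerm t₀) ≤ √(T * p.logTerm (T + 1)) := by
        apply Real.sqrt_le_sqrt
        exact mul_le_mul hVT h6 (by linarith) hT0
      gcongr
    · rw [bonus_eq, varEst_of_not_estimated hest]
      set I := p.logTerm (T + 1)
      have hs : √((8 * ((τ.idx t₀ ℓ).card : ℝ) + 18 * p.logTerm (t₀ + 1)) * p.logTerm t₀) ≤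
          3 * √(T * I) + 5 * I := by
        rw [Real.sqrt_le_left (by positivity)]
        have e1 : (8 * ((τ.idx t₀ ℓ).card : ℝ) + 18 * p.logTerm (t₀ + 1)) * p.logTerm t₀ ≤
            (8 * T + 18 * I) * I := by gcongr
        have e2 : √(T * I) ^ 2 = T * I := Real.sq_sqrt (by positivity)
        have e3 : 0 ≤ √(T * I) * I := by positivity
        nlinarith [mul_nonneg hT0 (by linarith : (0 : ℝ) ≤ I), sq_nonneg I]
      set r : ℝ := (1 / 2) ^ ℓ
      calc _ ≤ 16 * r / p.κ * (3 * √(T * I) + 5 * I) + 6 * r / p.κ * I + 2 * r := by gcongr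
        _ = r * ((48 * √(T * I) + 86 * I) / p.κ + 2) := by field_simp; ring
        _ ≤ _ := by
          have e1 : 48 * √(T * I) ≤ 96 * √(T * I) := by linarith
          have e2 : 86 * I ≤ 135 * I := by linarith
          gcongr
          norm_num

end Trajectory

/-! ### The regret on the concentration event -/

namespace Trajectory
variable {d : ℕ} {p : Params} {τ : Trajectory d} {T : ℕ} {θ : Vec d} {v : ℕ → ℝ}

/-- Twice the regret of round `t`. -/
def gap (τ : Trajectory d) (θ : Vec d) (t : ℕ) : ℝ :=
  2 * (⨆ x : {x // x ∈ τ.arms t}, inner ℝ x.1 θ) - inner ℝ (τ.x t + τ.y t) θ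

lemma exists_best {t : ℕ} (h : (τ.arms t).Nonempty) :
    ∃ b ∈ τ.arms t, (∀ x ∈ τ.arms t, inner ℝ x θ ≤ inner ℝ b θ) ∧
      τ.gap θ t = (inner ℝ b θ - inner ℝ (τ.x t) θ) + (inner ℝ b θ - inner ℝ (τ.y t) θ) := by
  obtain ⟨b, hb, hmax⟩ := Finset.exists_max_image (τ.arms t) (fun x => inner ℝ x θ) h
  refine ⟨b, hb, hmax, ?_⟩
  have : Nonempty {x // x ∈ τ.arms t} := ⟨⟨b, hb⟩⟩
  have hs : (⨆ x : {x // x ∈ τ.arms t}, inner ℝ x.1 θ) = inner ℝ b θ := by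
    apply le_antisymm
    · exact ciSup_le fun x => hmax _ x.2
    · exact le_ciSup (f := fun x : {x // x ∈ τ.arms t} => inner ℝ x.1 θ)
        (Set.finite_range _).bddAbove ⟨b, hb⟩
  rw [gap, hs, inner_add_left]
  ring

lemma abs_inner_sub_le {t ℓ : ℕ} {β : ℝ} (hβ : wnorm (τ.cov t ℓ) (τ.est p t ℓ - θ) ≤ β)
    (x y : Vec d) : |(inner ℝ x (τ.est p t ℓ) - inner ℝ y (τ.est p t ℓ)) -
      (inner ℝ x θ - inner ℝ y θ)| ≤ τ.width t ℓ x y * β := by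
  have h := abs_inner_le (cov_posDef τ t ℓ) (x - y) (τ.est p t ℓ - θ)
  have e : (inner ℝ x (τ.est p t ℓ) - inner ℝ y (τ.est p t ℓ)) - (inner ℝ x θ - inner ℝ y θ) =
      inner ℝ (x - y) (τ.est p t ℓ - θ) := by
    rw [inner_sub_left, inner_sub_right, inner_sub_right]; ring
  rw [e]
  refine h.trans ?_
  have := wnorm_nonneg (τ.cov t ℓ)⁻¹ (x - y)
  rw [width]
  gcongr

/-- The confidence ellipsoids contain the parameter in round `t`, in all layers. -/
def Confident (p : Params) (τ : Trajectory d) (θ : Vec d) (t : ℕ) : Prop :=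
  ∀ ℓ, 1 ≤ ℓ → ℓ ≤ p.numLayers → wnorm (τ.cov t ℓ) (τ.est p t ℓ - θ) ≤ τ.rad p t ℓ

/-- The best arm is never eliminated. -/
lemma LoopReaches.best_mem (hp : p.Valid) {t ℓ : ℕ} {B : Finset (Vec d)}
    (h : τ.LoopReaches p t ℓ B) (hconf : τ.Confident p θ t) {b : Vec d} (hb : b ∈ τ.arms t)
    (hmax : ∀ x ∈ τ.arms t, inner ℝ x θ ≤ inner ℝ b θ) : b ∈ B := by
  induction h with
  | start => exact hb
  | eliminate ℓ B hB h1 h2 ih =>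
    rw [Finset.mem_filter]
    refine ⟨ih, fun x' hx' => ?_⟩
    have hβ := hconf ℓ hB.one_le (hB.le_numLayers hp.alpha_pos hp.one_le_numLayers)
    have h3 := (abs_le.1 (abs_inner_sub_le hβ x' b)).2
    have h4 := hmax x' (hB.subset hx')
    have h5 : τ.width t ℓ x' b * τ.rad p t ℓ ≤ (1 / 2) ^ ℓ * τ.rad p t ℓ :=
      mul_le_mul_of_nonneg_right (h2 x' hx' b ih) ((wnorm_nonneg _ _).trans hβ)
    linarith

/-- The arms that survive the elimination in layer `ℓ` are nearly optimal. -/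
lemma LoopReaches.inner_best_sub_le (hp : p.Valid) {t ℓ : ℕ} {B : Finset (Vec d)} (hℓ : 1 ≤ ℓ)
    (h : τ.LoopReaches p t (ℓ + 1) B) (hconf : τ.Confident p θ t) {b : Vec d}
    (hb : b ∈ τ.arms t) (hmax : ∀ x ∈ τ.arms t, inner ℝ x θ ≤ inner ℝ b θ) {x : Vec d}
    (hx : x ∈ B) : inner ℝ b θ - inner ℝ x θ ≤ 2 * ((1 / 2) ^ ℓ * τ.rad p t ℓ) := by
  cases h with
  | start => omega
  | eliminate ℓ B hB h1 h2 =>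
    rw [Finset.mem_filter] at hx
    have hbB := hB.best_mem hp hconf hb hmax
    have hβ := hconf ℓ hB.one_le (hB.le_numLayers hp.alpha_pos hp.one_le_numLayers)
    have h3 := (abs_le.1 (abs_inner_sub_le hβ b x)).1
    have h4 := hx.2 b hbB
    have h5 : τ.width t ℓ b x * τ.rad p t ℓ ≤ (1 / 2) ^ ℓ * τ.rad p t ℓ :=
      mul_le_mul_of_nonneg_right (h2 b hbB x hx.1) ((wnorm_nonneg _ _).trans hβ)
    linarith

lemma IsRun.gap_le_of_explored (hp : p.Valid) (hrun : τ.IsRun p T) {t ℓ : ℕ} (h1 : 1 ≤ t)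
    (h2 : t ≤ T) (hℓ : 1 ≤ ℓ) (hl : τ.layer t = some (ℓ + 1)) (hconf : τ.Confident p θ t) :
    τ.gap θ t ≤ 4 * ((1 / 2) ^ ℓ * τ.rad p t ℓ) := by
  obtain ⟨b, hb, hmax, hgap⟩ := exists_best (θ := θ) ⟨_, (hrun.mem_arms h1 h2).1⟩
  obtain ⟨B, hB, hx, hy, -⟩ := hrun.explored h1 h2 hl
  have := hB.inner_best_sub_le hp hℓ hconf hb hmax hx
  have := hB.inner_best_sub_le hp hℓ hconf hb hmax hy
  linarith

/-- In an exploitation round the pair of the best arm with itself scores at most as much as the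
selected pair. -/
lemma IsRun.gap_le_of_exploited (hp : p.Valid) (hrun : τ.IsRun p T) {t : ℕ} (h1 : 1 ≤ t)
    (h2 : t ≤ T) (hl : τ.layer t = none) (hconf : τ.Confident p θ t) :
    ∃ ℓ, 1 ≤ ℓ ∧ ℓ ≤ p.numLayers ∧ τ.gap θ t ≤ 3 * (p.α * τ.rad p t ℓ) := by
  obtain ⟨b, hb, hmax, hgap⟩ := exists_best (θ := θ) ⟨_, (hrun.mem_arms h1 h2).1⟩
  obtain ⟨ℓ, B, hB, hx, hy, hw, hs⟩ := hrun.exploited h1 h2 hl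
  have hL := hB.le_numLayers hp.alpha_pos hp.one_le_numLayers
  refine ⟨ℓ, hB.one_le, hL, ?_⟩
  have hbB := hB.best_mem hp hconf hb hmax
  have hβ := hconf ℓ hB.one_le hL
  have hβ0 := (wnorm_nonneg _ _).trans hβ
  have hsc := hs b hbB b hbB
  rw [score, score, inner_add_left, inner_add_left] at hsc
  have h0 : 0 ≤ τ.rad p t ℓ * τ.width t ℓ b b := mul_nonneg hβ0 (wnorm_nonneg _ _)
  have e1 := (abs_le.1 (abs_inner_sub_le hβ b (τ.x t))).1
  have e2 := (abs_le.1 (abs_inner_sub_le hβ b (τ.y t))).1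
  have e3 := mul_le_mul_of_nonneg_right (hw b hbB _ hx) hβ0
  have e4 := mul_le_mul_of_nonneg_right (hw b hbB _ hy) hβ0
  have e5 := mul_le_mul_of_nonneg_right (hw _ hx _ hy) hβ0
  linarith

lemma IsRun.gap_le (hrun : τ.IsRun p T) (hθ : ‖θ‖ ≤ 1) {A : ℝ}
    (hA : ∀ t ∈ Finset.Icc 1 T, ∀ x ∈ τ.arms t, ‖x‖ ≤ A) {t : ℕ} (h1 : 1 ≤ t) (h2 : t ≤ T) :
    τ.gap θ t ≤ 4 * A := by
  obtain ⟨b, hb, -, hgap⟩ := exists_best (θ := θ) ⟨_, (hrun.mem_arms h1 h2).1⟩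
  obtain ⟨hx, hy⟩ := hrun.mem_arms h1 h2
  have key : ∀ x ∈ τ.arms t, |inner ℝ x θ| ≤ A := fun x hx => by
    have h3 := hA t (Finset.mem_Icc.2 ⟨h1, h2⟩) x hx
    calc |inner ℝ x θ| ≤ ‖x‖ * ‖θ‖ := abs_real_inner_le_norm _ _
      _ ≤ ‖x‖ * 1 := by gcongr
      _ ≤ A := by linarith
  have := (abs_le.1 (key b hb)).2
  have := (abs_le.1 (key _ hx)).1
  have := (abs_le.1 (key _ hy)).1
  linarith

/-- Grouping the rounds by the branch of the algorithm. -/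
lemma IsRun.sum_eq (hp : p.Valid) (hrun : τ.IsRun p T) (f : ℕ → ℝ) : ∑ t ∈ Finset.Icc 1 T, f t =
    ∑ t ∈ Finset.Icc 1 T with τ.layer t = none, f t +
      ∑ ℓ ∈ Finset.Icc 1 p.numLayers, ∑ t ∈ τ.idx (T + 1) ℓ, f t := by
  have h1 : ∀ ℓ, ∑ t ∈ τ.idx (T + 1) ℓ, f t =
      ∑ t ∈ Finset.Icc 1 T, if τ.layer t = some ℓ then f t else 0 := by
    intro ℓ
    rw [idx, Finset.sum_filter]
    rfl
  simp only [h1]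
  rw [Finset.sum_comm, Finset.sum_filter, ← Finset.sum_add_distrib]
  refine Finset.sum_congr rfl fun t ht => ?_
  obtain ⟨ht1, ht2⟩ := Finset.mem_Icc.1 ht
  rcases hl : τ.layer t with _ | ℓ
  · simp
  · obtain ⟨B, hB, -⟩ := hrun.explored ht1 ht2 hl
    have : ℓ ∈ Finset.Icc 1 p.numLayers := Finset.mem_Icc.2
      ⟨hB.one_le, hB.le_numLayers hp.alpha_pos hp.one_le_numLayers⟩
    simp only [Option.some.injEq, reduceCtorEq, if_false, zero_add]
    rw [Finset.sum_ite_eq, if_pos this]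

lemma IsRun.wsum_le_sum (hrun : τ.IsRun p T) (hv : ∀ s ∈ Finset.Icc 1 T, 0 ≤ v s ∧ v s ≤ 1)
    (ℓ : ℕ) : τ.wsum v (T + 1) ℓ ≤ ∑ t ∈ Finset.Icc 1 T with τ.x t ≠ τ.y t, v t := by
  have h1 : τ.wsum v (T + 1) ℓ ≤ ∑ s ∈ τ.idx (T + 1) ℓ, v s := by
    refine Finset.sum_le_sum fun s hs => ?_
    rw [mem_idx] at hs
    obtain ⟨h0, -⟩ := hv s (Finset.mem_Icc.2 ⟨hs.1.1, by omega⟩)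
    have h2 := hrun.weight_le_one hs.1.1 (by omega) hs.2
    have h3 := (hrun.weight_pos hs.1.1 (by omega) hs.2).le
    exact mul_le_of_le_one_left h0 (pow_le_one₀ h3 h2)
  refine h1.trans (Finset.sum_le_sum_of_subset_of_nonneg (fun s hs => ?_) fun s hs _ => ?_)
  · rw [mem_idx] at hs
    exact Finset.mem_filter.2 ⟨Finset.mem_Icc.2 ⟨hs.1.1, by omega⟩,
      hrun.x_ne_y hs.1.1 (by omega) hs.2⟩
  · exact (hv s (Finset.mem_filter.1 hs).1).1

/-- The regret of the explorations of one layer. If the variance is estimated in the layer below,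
the number `4^ℓ` of explorations cancels against the width of the layer and the factor `2^{-ℓ}` of
the radius; otherwise `4^ℓ` is at most of order `(Lμ / κ)²`. -/
lemma IsRun.sum_gap_layer_le (hp : p.Valid) (hrun : τ.IsRun p T) (hT : 1 ≤ T) (hθ : ‖θ‖ ≤ 1)
    (hv : ∀ s ∈ Finset.Icc 1 T, 0 ≤ v s ∧ v s ≤ 1) {A : ℝ} (hA0 : 0 ≤ A)
    (hA : ∀ t ∈ Finset.Icc 1 T, ∀ x ∈ τ.arms t, ‖x‖ ≤ A)
    (hc : ∀ ℓ ∈ Finset.Icc 1 p.numLayers, ∀ t ∈ Finset.Icc 1 T, τ.Concentrated p θ v t ℓ)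
    {S N : ℝ} (hS : ∑ t ∈ Finset.Icc 1 T with τ.x t ≠ τ.y t, v t ≤ S)
    (hN : 2 * d * Real.log (1 + 4 ^ p.numLayers * (4 * A ^ 2 * T)) ≤ N) {ℓ : ℕ}
    (hℓ : ℓ ∈ Finset.Icc 1 p.numLayers) : ∑ t ∈ τ.idx (T + 1) ℓ, τ.gap θ t ≤
      N * (16 * ((96 * √(S * p.logTerm (T + 1)) + 135 * p.logTerm (T + 1)) / p.κ + 18) +
        65536 * A * (p.Lμ / p.κ) ^ 2 * p.logTerm (T + 1)) := by
  have hκ := hp.link.kappa_pos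
  obtain ⟨hℓ1, hℓ2⟩ := Finset.mem_Icc.1 hℓ
  have hI : 1 ≤ p.logTerm (T + 1) :=
    hp.one_le_logTerm (by linarith [(Nat.cast_nonneg T : (0 : ℝ) ≤ T)])
  have hcard : ((τ.idx (T + 1) ℓ).card : ℝ) ≤ 4 ^ ℓ * N := by
    refine (hrun.card_idx_le hA le_rfl ℓ).trans ?_
    have : Real.log (1 + 4 ^ ℓ * (4 * A ^ 2 * T)) ≤
        Real.log (1 + 4 ^ p.numLayers * (4 * A ^ 2 * T)) := by
      apply Real.log_le_log (by positivity)
      have : (4 : ℝ) ^ ℓ ≤ 4 ^ p.numLayers := pow_le_pow_right₀ (by norm_num) hℓ2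
      gcongr
    calc _ ≤ 2 * 4 ^ ℓ * d * Real.log (1 + 4 ^ p.numLayers * (4 * A ^ 2 * T)) := by gcongr
      _ = 4 ^ ℓ * (2 * d * Real.log (1 + 4 ^ p.numLayers * (4 * A ^ 2 * T))) := by ring
      _ ≤ _ := by gcongr
  have hN0 : 0 ≤ N := le_trans (by
    have : 0 ≤ Real.log (1 + 4 ^ p.numLayers * (4 * A ^ 2 * T)) :=
      Real.log_nonneg (le_add_of_nonneg_right (by positivity))
    positivity) hN
  set R := (96 * √(S * p.logTerm (T + 1)) + 135 * p.logTerm (T + 1)) / p.κ + 18 with hR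
  have hR0 : 0 ≤ R := by positivity
  have hratio : 1 ≤ (p.Lμ / p.κ) ^ 2 := one_le_pow₀ ((one_le_div hκ).2 hp.link.kappa_le)
  -- The trivial bound of the regret, for the first layer and below the variance threshold.
  have hcoarse : (4 : ℝ) ^ ℓ ≤ 16384 * (p.Lμ / p.κ) ^ 2 * p.logTerm (T + 1) →
      ∑ t ∈ τ.idx (T + 1) ℓ, τ.gap θ t ≤
        N * (16 * R + 65536 * A * (p.Lμ / p.κ) ^ 2 * p.logTerm (T + 1)) := by
    intro h4
    have : ∑ t ∈ τ.idx (T + 1) ℓ, τ.gap θ t ≤ (τ.idx (T + 1) ℓ).card • (4 * A) :=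
      Finset.sum_le_card_nsmul _ _ _ fun t ht => by
        rw [mem_idx] at ht
        exact hrun.gap_le hθ hA ht.1.1 (by omega)
    rw [nsmul_eq_mul] at this
    calc _ ≤ _ := this
      _ ≤ 4 ^ ℓ * N * (4 * A) := by gcongr
      _ ≤ 16384 * (p.Lμ / p.κ) ^ 2 * p.logTerm (T + 1) * N * (4 * A) := by gcongr
      _ = N * (0 + 65536 * A * (p.Lμ / p.κ) ^ 2 * p.logTerm (T + 1)) := by ring
      _ ≤ _ := by gcongr; positivity
  obtain ⟨j, rfl⟩ : ∃ j, ℓ = j + 1 := ⟨ℓ - 1, by omega⟩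
  rcases Nat.eq_zero_or_pos j with rfl | hj
  · apply hcoarse
    nlinarith
  by_cases hest : Estimated p T j
  · have hj' : j ∈ Finset.Icc 1 p.numLayers := Finset.mem_Icc.2 ⟨hj, by omega⟩
    have hpow : (1 / 2 : ℝ) ^ j * (1 / 2) ^ j * 4 ^ (j + 1) = 4 := by
      rw [← mul_pow, pow_succ, ← mul_assoc, ← mul_pow]; norm_num
    have hr : (0 : ℝ) < (1 / 2) ^ j := by positivity
    have : ∑ t ∈ τ.idx (T + 1) (j + 1), τ.gap θ t ≤
        (τ.idx (T + 1) (j + 1)).card • (4 * ((1 / 2) ^ j * ((1 / 2) ^ j * R))) := by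
      refine Finset.sum_le_card_nsmul _ _ _ fun t ht => ?_
      rw [mem_idx] at ht
      refine (hrun.gap_le_of_explored hp ht.1.1 (by omega) hj ht.2 fun ℓ h1 h2 =>
        wnorm_le_rad hp hrun hθ hv (by omega) (hc ℓ (Finset.mem_Icc.2 ⟨h1, h2⟩))).trans ?_
      have h5 := rad_le_of_estimated hp hθ hv (t := t) (by omega) (hc j hj') hest
      have h6 : √(τ.wsum v (T + 1) j * p.logTerm (T + 1)) ≤ √(S * p.logTerm (T + 1)) := by
        apply Real.sqrt_le_sqrt
        gcongr
        exact (hrun.wsum_le_sum hv j).trans hS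
      gcongr
      refine h5.trans ?_
      rw [hR]
      gcongr
    rw [nsmul_eq_mul] at this
    calc _ ≤ _ := this
      _ ≤ 4 ^ (j + 1) * N * (4 * ((1 / 2) ^ j * ((1 / 2) ^ j * R))) := by gcongr
      _ = ((1 / 2) ^ j * (1 / 2) ^ j * 4 ^ (j + 1)) * (N * (4 * R)) := by ring
      _ = N * (16 * R + 0) := by rw [hpow]; ring
      _ ≤ _ := by gcongr; positivity
  · apply hcoarse
    rw [Estimated, not_le] at hest
    have h1 : ((2 : ℝ) ^ j) ^ 2 ≤ (64 * (p.Lμ / p.κ) * √(p.logTerm (T + 1))) ^ 2 := by gcongr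
    rw [mul_pow, Real.sq_sqrt (by linarith)] at h1
    have h2 : (4 : ℝ) ^ (j + 1) = 4 * ((2 : ℝ) ^ j) ^ 2 := by
      rw [pow_succ, ← pow_mul, mul_comm j 2, pow_mul]; norm_num; ring
    rw [h2]
    calc 4 * ((2 : ℝ) ^ j) ^ 2 ≤ 4 * ((64 * (p.Lμ / p.κ)) ^ 2 * p.logTerm (T + 1)) := by gcongr
      _ = _ := by ring

/-- The regret bound on the concentration event. -/
lemma IsRun.regret_le (hp : p.Valid) (hrun : τ.IsRun p T) (hT : 1 ≤ T) (hθ : ‖θ‖ ≤ 1)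
    (hα : p.α * T * √T ≤ 1)
    (hv : ∀ s ∈ Finset.Icc 1 T, 0 ≤ v s ∧ v s ≤ 1) {A : ℝ} (hA0 : 0 ≤ A)
    (hA : ∀ t ∈ Finset.Icc 1 T, ∀ x ∈ τ.arms t, ‖x‖ ≤ A)
    (hc : ∀ ℓ ∈ Finset.Icc 1 p.numLayers, ∀ t ∈ Finset.Icc 1 T, τ.Concentrated p θ v t ℓ)
    {S N : ℝ} (hS : ∑ t ∈ Finset.Icc 1 T with τ.x t ≠ τ.y t, v t ≤ S)
    (hN : 2 * d * Real.log (1 + 4 ^ p.numLayers * (4 * A ^ 2 * T)) ≤ N) :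
    2 * τ.regret θ T ≤ 3 * (231 * p.logTerm (T + 1) / p.κ + 18) + p.numLayers * (N *
      (16 * ((96 * √(S * p.logTerm (T + 1)) + 135 * p.logTerm (T + 1)) / p.κ + 18) +
        65536 * A * (p.Lμ / p.κ) ^ 2 * p.logTerm (T + 1))) := by
  have hκ := hp.link.kappa_pos
  have hI : 1 ≤ p.logTerm (T + 1) :=
    hp.one_le_logTerm (by linarith [(Nat.cast_nonneg T : (0 : ℝ) ≤ T)])
  have e : 2 * τ.regret θ T = ∑ t ∈ Finset.Icc 1 T, τ.gap θ t := by
    rw [regret]; simp only [gap]; ring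
  rw [e, hrun.sum_eq hp]
  gcongr ?_ + ?_
  · set I := p.logTerm (T + 1)
    set R := (96 * √(T * I) + 135 * I) / p.κ + 18 with hR
    have hR0 : 0 ≤ R := by positivity
    have hα0 := hp.alpha_pos
    have h1 : ∑ t ∈ Finset.Icc 1 T with τ.layer t = none, τ.gap θ t ≤
        ({t ∈ Finset.Icc 1 T | τ.layer t = none}).card • (3 * (p.α * R)) := by
      refine Finset.sum_le_card_nsmul _ _ _ fun t ht => ?_
      rw [Finset.mem_filter, Finset.mem_Icc] at ht
      obtain ⟨ℓ, h1, h2, h3⟩ := hrun.gap_le_of_exploited hp ht.1.1 ht.1.2 ht.2 fun ℓ h1 h2 =>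
        wnorm_le_rad hp hrun hθ hv (by omega) (hc ℓ (Finset.mem_Icc.2 ⟨h1, h2⟩))
      refine h3.trans ?_
      have := hrun.rad_le hp hθ hv ht.1.2 (hc ℓ (Finset.mem_Icc.2 ⟨h1, h2⟩))
      gcongr
    have h2 : (({t ∈ Finset.Icc 1 T | τ.layer t = none}).card : ℝ) ≤ T := by
      have := Finset.card_filter_le (Finset.Icc 1 T) (fun t => τ.layer t = none)
      rw [Nat.card_Icc] at this
      exact_mod_cast this
    rw [nsmul_eq_mul] at h1
    have hT1 : (1 : ℝ) ≤ √T := by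
      rw [Real.one_le_sqrt]; exact_mod_cast hT
    have h3 : p.α * T ≤ 1 := by
      have : 0 ≤ p.α * T := by positivity
      nlinarith
    have h4 : √(T * I) ≤ √T * I := by
      rw [Real.sqrt_mul (Nat.cast_nonneg T)]
      gcongr
      exact Real.sqrt_le_self_iff.2 (Or.inr hI)
    have h5 : R ≤ (96 * (√T * I) + 135 * I) / p.κ + 18 := by rw [hR]; gcongr
    calc _ ≤ _ := h1
      _ ≤ T * (3 * (p.α * ((96 * (√T * I) + 135 * I) / p.κ + 18))) := by gcongr
      _ = 3 * ((96 * (p.α * T * √T) * I + 135 * (p.α * T) * I) / p.κ + 18 * (p.α * T)) := by ring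
      _ ≤ 3 * ((96 * 1 * I + 135 * 1 * I) / p.κ + 18 * 1) := by gcongr
      _ = _ := by ring
  · have := Finset.sum_le_card_nsmul (Finset.Icc 1 p.numLayers) _ _ fun ℓ hℓ =>
      hrun.sum_gap_layer_le hp hT hθ hv hA0 hA hc hS hN hℓ
    rw [nsmul_eq_mul, Nat.card_Icc, Nat.add_sub_cancel] at this
    exact this

end Trajectory

/-! ### One-step inequalities for the noise -/

section Recursion
namespace Trajectory
variable {d : ℕ} {p : Params} {τ : Trajectory d} {T : ℕ} {θ : Vec d} {v : ℕ → ℝ}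

/-- The squared weight with which round `t` enters layer `ℓ`: zero unless the round explores the
layer. -/
def sqWeight (τ : Trajectory d) (t ℓ : ℕ) : ℝ :=
  if 1 ≤ t ∧ τ.layer t = some ℓ then τ.weight t ^ 2 else 0

lemma cov_succ (τ : Trajectory d) (t ℓ : ℕ) : τ.cov (t + 1) ℓ =
    τ.cov t ℓ + τ.sqWeight t ℓ • vecMulVec (τ.z t).ofLp (τ.z t).ofLp := by
  rw [sqWeight]
  split_ifs with h
  · exact cov_succ_pos τ h
  · rw [cov_succ_neg τ h, zero_smul, add_zero]

lemma wsum_succ (τ : Trajectory d) (v : ℕ → ℝ) (t ℓ : ℕ) :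
    τ.wsum v (t + 1) ℓ = τ.wsum v t ℓ + τ.sqWeight t ℓ * v t := by
  rw [sqWeight]
  split_ifs with h
  · rw [wsum, idx_succ_pos τ h, Finset.sum_insert (notMem_idx_self τ t ℓ), wsum, add_comm]
  · rw [wsum, idx_succ_neg τ h, wsum, zero_mul, add_zero]

lemma noiseSum_succ (μ : ℝ → ℝ) (θ : Vec d) (τ : Trajectory d) (t ℓ : ℕ) :
    τ.noiseSum μ θ (t + 1) ℓ =
      τ.noiseSum μ θ t ℓ + (τ.sqWeight t ℓ * τ.noise μ θ t) • τ.z t := by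
  rw [sqWeight]
  split_ifs with h
  · rw [noiseSum, idx_succ_pos τ h, Finset.sum_insert (notMem_idx_self τ t ℓ), noiseSum, add_comm]
  · rw [noiseSum, idx_succ_neg τ h, noiseSum, zero_mul, zero_smul, add_zero]

lemma sqWeight_nonneg (τ : Trajectory d) (t ℓ : ℕ) : 0 ≤ τ.sqWeight t ℓ := by
  rw [sqWeight]
  split_ifs
  · exact sq_nonneg _
  · exact le_rfl

lemma IsRun.sqWeight_le_one (h : τ.IsRun p T) {t : ℕ} (ht : t ≤ T) (ℓ : ℕ) :
    τ.sqWeight t ℓ ≤ 1 := by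
  rw [sqWeight]
  split_ifs with hl
  · exact pow_le_one₀ (h.weight_pos hl.1 ht hl.2).le (h.weight_le_one hl.1 ht hl.2)
  · exact zero_le_one

lemma IsRun.sqWeight_mul_le (h : τ.IsRun p T) {t : ℕ} (ht : t ≤ T) (ℓ : ℕ) :
    τ.sqWeight t ℓ * wnorm (τ.cov t ℓ)⁻¹ (τ.z t) ^ 2 ≤ ((1 / 2) ^ ℓ) ^ 2 := by
  rw [sqWeight]
  split_ifs with hl
  · rw [← mul_pow, h.wnorm_weight_smul hl.1 ht hl.2]
  · rw [zero_mul]; positivity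

/-- The normalized size `√(1 + s² 4^ℓ ‖S‖²)` of the noise sum in the dual norm. -/
def height (μ : ℝ → ℝ) (θ : Vec d) (τ : Trajectory d) (s : ℝ) (t ℓ : ℕ) : ℝ :=
  √(1 + (s * 2 ^ ℓ * wnorm (τ.cov t ℓ)⁻¹ (τ.noiseSum μ θ t ℓ)) ^ 2)

lemma one_le_height (μ : ℝ → ℝ) (θ : Vec d) (τ : Trajectory d) (s : ℝ) (t ℓ : ℕ) :
    1 ≤ τ.height μ θ s t ℓ := by
  rw [height, Real.one_le_sqrt]
  exact le_add_of_nonneg_right (sq_nonneg _)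

/-- The coefficient of the noise of round `t` in the increment of the height. -/
def slope (μ : ℝ → ℝ) (θ : Vec d) (τ : Trajectory d) (s : ℝ) (t ℓ : ℕ) : ℝ :=
  (s * 2 ^ ℓ) ^ 2 * (τ.sqWeight t ℓ * form (τ.cov t ℓ)⁻¹ (τ.noiseSum μ θ t ℓ) (τ.z t)) /
    τ.height μ θ s t ℓ

lemma two_pow_mul_half_pow (ℓ : ℕ) : (2 : ℝ) ^ ℓ * (1 / 2) ^ ℓ = 1 := by
  rw [← mul_pow]; norm_num

lemma IsRun.abs_slope_le (h : τ.IsRun p T) {t : ℕ} (ht : t ≤ T) (ℓ : ℕ) {s : ℝ} (hs : 0 ≤ s)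
    (μ : ℝ → ℝ) : |τ.slope μ θ s t ℓ| ≤ s * √(τ.sqWeight t ℓ) := by
  have hH := one_le_height μ θ τ s t ℓ
  have ha := sqWeight_nonneg τ t ℓ
  set a := τ.sqWeight t ℓ
  set n := wnorm (τ.cov t ℓ)⁻¹ (τ.noiseSum μ θ t ℓ) with hn
  have hn0 : 0 ≤ n := wnorm_nonneg _ _
  set k := wnorm (τ.cov t ℓ)⁻¹ (τ.z t)
  have hk0 : 0 ≤ k := wnorm_nonneg _ _
  have h1 : √a * k ≤ (1 / 2) ^ ℓ := by
    apply le_of_sq_le_sq _ (by positivity)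
    rw [mul_pow, Real.sq_sqrt ha]
    exact h.sqWeight_mul_le ht ℓ
  have h2 := abs_form_le (cov_posDef τ t ℓ).inv (τ.noiseSum μ θ t ℓ) (τ.z t)
  have h3 : s * 2 ^ ℓ * n ≤ τ.height μ θ s t ℓ := by
    rw [height]
    exact Real.le_sqrt_of_sq_le (by linarith)
  rw [slope, abs_div, abs_of_pos (by linarith : 0 < τ.height μ θ s t ℓ),
    div_le_iff₀ (by linarith), abs_mul, abs_mul, abs_of_nonneg ha,
    abs_of_nonneg (sq_nonneg (s * 2 ^ ℓ))]
  have h4 : a = √a * √a := (Real.mul_self_sqrt ha).symm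
  calc (s * 2 ^ ℓ) ^ 2 * (a * |_|) ≤ (s * 2 ^ ℓ) ^ 2 * (a * (n * k)) := by gcongr
    _ = (s * √a) * (s * 2 ^ ℓ * n) * (2 ^ ℓ * (√a * k)) := by
      conv_lhs => rw [h4]
      ring
    _ ≤ (s * √a) * (s * 2 ^ ℓ * n) * (2 ^ ℓ * (1 / 2) ^ ℓ) := by gcongr
    _ = (s * √a) * (s * 2 ^ ℓ * n) := by rw [two_pow_mul_half_pow, mul_one]
    _ ≤ _ := by gcongr

/-- One step of the height: adding the rank-one term to the matrix only decreases the dual norm, and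
the square root is below its tangent. -/
lemma IsRun.height_succ_le (h : τ.IsRun p T) {t : ℕ} (ht : t ≤ T) (ℓ : ℕ) {s : ℝ}
    (μ : ℝ → ℝ) : τ.height μ θ s (t + 1) ℓ ≤ τ.height μ θ s t ℓ +
      τ.slope μ θ s t ℓ * τ.noise μ θ t + s ^ 2 * τ.sqWeight t ℓ * τ.noise μ θ t ^ 2 / 2 := by
  have hH := one_le_height μ θ τ s t ℓ
  have ha := sqWeight_nonneg τ t ℓ
  have hM := cov_posDef τ t ℓ
  have hstep : form (τ.cov (t + 1) ℓ)⁻¹ (τ.noiseSum μ θ (t + 1) ℓ) (τ.noiseSum μ θ (t + 1) ℓ) ≤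
      form (τ.cov t ℓ)⁻¹ (τ.noiseSum μ θ (t + 1) ℓ) (τ.noiseSum μ θ (t + 1) ℓ) := by
    refine form_inv_anti hM (cov_posDef τ (t + 1) ℓ) (fun u => ?_) _
    rw [cov_succ, form_add_mat, form_smul_mat, form_vecMulVec]
    exact le_add_of_nonneg_right (mul_nonneg ha (mul_self_nonneg _))
  have hexp : form (τ.cov t ℓ)⁻¹ (τ.noiseSum μ θ (t + 1) ℓ) (τ.noiseSum μ θ (t + 1) ℓ) =
      wnorm (τ.cov t ℓ)⁻¹ (τ.noiseSum μ θ t ℓ) ^ 2 + 2 * (τ.noise μ θ t) *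
        (τ.sqWeight t ℓ * form (τ.cov t ℓ)⁻¹ (τ.noiseSum μ θ t ℓ) (τ.z t)) +
      τ.sqWeight t ℓ * τ.noise μ θ t ^ 2 *
        (τ.sqWeight t ℓ * wnorm (τ.cov t ℓ)⁻¹ (τ.z t) ^ 2) := by
    rw [noiseSum_succ, form_add_left, form_add_right, form_add_right, form_smul_left,
      form_smul_left, form_smul_right, form_smul_right, form_comm hM.inv (τ.z t), wnorm_sq hM.inv,
      wnorm_sq hM.inv]
    ring
  have hlast := mul_le_mul_of_nonneg_left (h.sqWeight_mul_le ht ℓ)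
    (mul_nonneg ha (sq_nonneg (τ.noise μ θ t)))
  have hslope : τ.slope μ θ s t ℓ * τ.height μ θ s t ℓ =
      (s * 2 ^ ℓ) ^ 2 * (τ.sqWeight t ℓ * form (τ.cov t ℓ)⁻¹ (τ.noiseSum μ θ t ℓ) (τ.z t)) := by
    rw [slope, div_mul_cancel₀ _ (by linarith)]
  have hsq : τ.height μ θ s t ℓ ^ 2 =
      1 + (s * 2 ^ ℓ) ^ 2 * wnorm (τ.cov t ℓ)⁻¹ (τ.noiseSum μ θ t ℓ) ^ 2 := by
    rw [height, Real.sq_sqrt (by positivity), mul_pow]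
  have hsq' : τ.height μ θ s (t + 1) ℓ ^ 2 =
      1 + (s * 2 ^ ℓ) ^ 2 * wnorm (τ.cov (t + 1) ℓ)⁻¹ (τ.noiseSum μ θ (t + 1) ℓ) ^ 2 := by
    rw [height, Real.sq_sqrt (by positivity), mul_pow]
  have hH' := one_le_height μ θ τ s (t + 1) ℓ
  set H := τ.height μ θ s t ℓ
  set H' := τ.height μ θ s (t + 1) ℓ
  set e := τ.noise μ θ t
  set a := τ.sqWeight t ℓ
  set b := τ.slope μ θ s t ℓ
  rw [wnorm_sq (cov_posDef τ (t + 1) ℓ).inv] at hsq'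
  have e1 : (s * 2 ^ ℓ) ^ 2 * (a * e ^ 2 * ((1 / 2 : ℝ) ^ ℓ) ^ 2) = s ^ 2 * a * e ^ 2 := by
    calc _ = s ^ 2 * a * e ^ 2 * ((2 : ℝ) ^ ℓ * (1 / 2) ^ ℓ) ^ 2 := by ring
      _ = _ := by rw [two_pow_mul_half_pow]; ring
  have h1 : H' ^ 2 ≤ H ^ 2 + 2 * e * (b * H) + s ^ 2 * a * e ^ 2 := by
    rw [hsq', hsq, hslope]
    have := mul_le_mul_of_nonneg_left (hstep.trans (hexp.le.trans (add_le_add_right hlast _)))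
      (sq_nonneg (s * 2 ^ ℓ))
    rw [← e1]
    linarith
  have h0 : 0 ≤ s ^ 2 * a * e ^ 2 := by positivity
  have h2 : 2 * H * H' ≤ H ^ 2 + H' ^ 2 := two_mul_le_add_sq H H'
  have h3 : s ^ 2 * a * e ^ 2 ≤ s ^ 2 * a * e ^ 2 * H := le_mul_of_one_le_right h0 hH
  have h4 : H * H' ≤ H * (H + b * e + s ^ 2 * a * e ^ 2 / 2) := by linarith
  exact le_of_mul_le_mul_left h4 (by linarith)

end Trajectory
end Recursion

lemma exp_le_one_add_add_sq {x : ℝ} (h : |x| ≤ 1) : Real.exp x ≤ 1 + x + x ^ 2 := by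
  have := (abs_le.1 (Real.abs_exp_sub_one_sub_id_le h)).2
  linarith

lemma exp_neg_mul_one_add_le (u : ℝ) : Real.exp (-u) * (1 + u) ≤ 1 := by
  have := Real.add_one_le_exp u
  calc Real.exp (-u) * (1 + u) ≤ Real.exp (-u) * Real.exp u := by gcongr; linarith
    _ = 1 := by rw [← Real.exp_add]; simp

/-- The exponential step behind the Bernstein bound. The scale is at most `1/2` so that the exponent
is at most `1` in absolute value, where `exp x ≤ 1 + x + x²`. -/
lemma exp_bernstein_step {s a b e v : ℝ} (hs : 0 ≤ s) (hs2 : s ≤ 1 / 2) (ha : 0 ≤ a) (ha1 : a ≤ 1)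
    (hb : |b| ≤ s * √a) (he : |e| ≤ 1) :
    Real.exp (b * e + s ^ 2 * a * e ^ 2 / 2 - 17 / 8 * s ^ 2 * (a * v)) ≤
      1 + e * (b * Real.exp (-(17 / 8 * s ^ 2 * (a * v)))) +
        (e ^ 2 - v) * (17 / 8 * s ^ 2 * a * Real.exp (-(17 / 8 * s ^ 2 * (a * v)))) ∧
    |b * e + s ^ 2 * a * e ^ 2 / 2| ≤ 1 := by
  set u := 17 / 8 * s ^ 2 * (a * v) with hu
  set y := b * e + s ^ 2 * a * e ^ 2 / 2 with hy
  have hra : √a * √a = a := Real.mul_self_sqrt ha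
  have hr0 := Real.sqrt_nonneg a
  have hr1 : √a ≤ 1 := Real.sqrt_le_one.2 ha1
  have h1 : |y| ≤ 5 / 4 * (s * √a) * |e| := by
    have e1 : y = (b + s ^ 2 * a * e / 2) * e := by rw [hy]; ring
    rw [e1, abs_mul]
    gcongr
    refine (abs_add_le _ _).trans ?_
    have e2 : |s ^ 2 * a * e / 2| ≤ 1 / 4 * (s * √a) := by
      rw [abs_div, abs_mul, abs_of_nonneg (by positivity : 0 ≤ s ^ 2 * a), abs_two]
      have : s ^ 2 * a * |e| ≤ s ^ 2 * a * 1 := by gcongr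
      have h2 : s ^ 2 * a = s * √a * (s * √a) := by
        calc s ^ 2 * a = s ^ 2 * (√a * √a) := by rw [hra]
          _ = _ := by ring
      have h3 : s * √a * (s * √a) ≤ s * √a * (1 / 2 * 1) := by gcongr
      linarith
    linarith
  have hsr : s * √a ≤ 1 / 2 := by
    calc s * √a ≤ 1 / 2 * 1 := by gcongr
      _ = _ := by norm_num
  have h2 : |y| ≤ 1 := by
    refine h1.trans ?_
    calc 5 / 4 * (s * √a) * |e| ≤ 5 / 4 * (1 / 2) * 1 := by gcongr
      _ ≤ 1 := by norm_num
  refine ⟨?_, h2⟩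
  have h3 : y ^ 2 ≤ 25 / 16 * (s ^ 2 * a * e ^ 2) := by
    calc y ^ 2 = |y| ^ 2 := (sq_abs y).symm
      _ ≤ (5 / 4 * (s * √a) * |e|) ^ 2 := by gcongr
      _ = 25 / 16 * (s ^ 2 * √a ^ 2 * |e| ^ 2) := by ring
      _ = _ := by rw [Real.sq_sqrt ha, sq_abs]
  have h4 : Real.exp y ≤ 1 + b * e + 17 / 8 * s ^ 2 * a * e ^ 2 := by
    have := exp_le_one_add_add_sq h2
    have : 0 ≤ s ^ 2 * a * e ^ 2 := by positivity
    linarith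
  have h5 := exp_neg_mul_one_add_le u
  calc Real.exp (y - u) = Real.exp (-u) * Real.exp y := by rw [← Real.exp_add]; ring_nf
    _ ≤ Real.exp (-u) * (1 + b * e + 17 / 8 * s ^ 2 * a * e ^ 2) := by gcongr
    _ = Real.exp (-u) * (1 + u) + e * (b * Real.exp (-u)) +
        (e ^ 2 - v) * (17 / 8 * s ^ 2 * a * Real.exp (-u)) := by rw [hu]; ring
    _ ≤ _ := by gcongr

/-- The exponential step behind the upper bound of the conditional variance by the realized one. -/
lemma exp_lower_step {a e v : ℝ} (ha : 0 ≤ a) (ha1 : a ≤ 1) (he : |e| ≤ 1) :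
    Real.exp (-(a * e ^ 2) / 2 + a * v / 4) ≤
      1 + (e ^ 2 - v) * (-(a / 4 * Real.exp (a * v / 4))) := by
  set x := a * e ^ 2 with hx
  have hx0 : 0 ≤ x := by positivity
  have hx1 : x ≤ 1 := by
    have : e ^ 2 ≤ 1 := (sq_le_one_iff_abs_le_one e).2 he
    nlinarith
  have h1 : Real.exp (-x / 2) ≤ 1 - x / 4 := by
    have := exp_le_one_add_add_sq (x := -x / 2) (by rw [abs_le]; constructor <;> linarith)
    nlinarith
  have h5 := exp_neg_mul_one_add_le (-(a * v / 4))
  rw [neg_neg] at h5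
  calc Real.exp (-x / 2 + a * v / 4) = Real.exp (a * v / 4) * Real.exp (-x / 2) := by
        rw [← Real.exp_add]; ring_nf
    _ ≤ Real.exp (a * v / 4) * (1 - x / 4) := by gcongr
    _ = Real.exp (a * v / 4) * (1 + -(a * v / 4)) +
        (e ^ 2 - v) * (-(a / 4 * Real.exp (a * v / 4))) := by rw [hx]; ring
    _ ≤ _ := by gcongr

/-- The exponential step behind the upper bound of the realized variance by the conditional one. -/
lemma exp_upper_step {a e v : ℝ} (ha : 0 ≤ a) (ha1 : a ≤ 1) (he : |e| ≤ 1) :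
    Real.exp (a * e ^ 2 / 2 - 3 * (a * v) / 4) ≤
      1 + (e ^ 2 - v) * (3 * a / 4 * Real.exp (-(3 * (a * v) / 4))) := by
  set x := a * e ^ 2 with hx
  have hx0 : 0 ≤ x := by positivity
  have hx1 : x ≤ 1 := by
    have : e ^ 2 ≤ 1 := (sq_le_one_iff_abs_le_one e).2 he
    nlinarith
  have h1 : Real.exp (x / 2) ≤ 1 + 3 * x / 4 := by
    have := exp_le_one_add_add_sq (x := x / 2) (by rw [abs_le]; constructor <;> linarith)
    nlinarith
  have h5 := exp_neg_mul_one_add_le (3 * (a * v) / 4)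
  calc Real.exp (x / 2 - 3 * (a * v) / 4) = Real.exp (-(3 * (a * v) / 4)) * Real.exp (x / 2) := by
        rw [← Real.exp_add]; ring_nf
    _ ≤ Real.exp (-(3 * (a * v) / 4)) * (1 + 3 * x / 4) := by gcongr
    _ = Real.exp (-(3 * (a * v) / 4)) * (1 + 3 * (a * v) / 4) +
        (e ^ 2 - v) * (3 * a / 4 * Real.exp (-(3 * (a * v) / 4))) := by rw [hx]; ring
    _ ≤ _ := by gcongr

/-! ### Measurability and exponential supermartingales -/

section Measurability

lemma measurable_matrix_det {α : Type*} {m : MeasurableSpace α} {n : ℕ}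
    {M : α → Matrix (Fin n) (Fin n) ℝ} (hM : ∀ i j, Measurable fun ω => M ω i j) :
    Measurable fun ω => (M ω).det := by
  simp only [Matrix.det_apply']
  refine Finset.measurable_sum _ fun σ _ => ?_
  exact measurable_const.mul (Finset.measurable_prod _ fun i _ => hM _ _)

lemma measurable_matrix_inv {α : Type*} {m : MeasurableSpace α} {n : ℕ}
    {M : α → Matrix (Fin n) (Fin n) ℝ} (hM : ∀ i j, Measurable fun ω => M ω i j) (i j : Fin n) :
    Measurable fun ω => (M ω)⁻¹ i j := by
  simp only [Matrix.inv_def, Matrix.smul_apply, Ring.inverse_eq_inv', Matrix.adjugate_apply,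
    smul_eq_mul]
  refine (measurable_matrix_det hM).inv.mul (measurable_matrix_det fun k l => ?_)
  by_cases h : k = j
  · subst h; simp
  · simpa [Matrix.updateRow_ne h] using hM k l

lemma measurable_ofLp_apply {α : Type*} {m : MeasurableSpace α} {d : ℕ} {u : α → Vec d}
    (hu : Measurable u) (i : Fin d) : Measurable fun ω => (u ω).ofLp i :=
  (EuclideanSpace.proj (𝕜 := ℝ) i).continuous.measurable.comp hu

lemma measurable_form {α : Type*} {m : MeasurableSpace α} {d : ℕ}
    {M : α → Matrix (Fin d) (Fin d) ℝ} (hM : ∀ i j, Measurable fun ω => M ω i j)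
    {u v : α → Vec d} (hu : Measurable u) (hv : Measurable v) :
    Measurable fun ω => form (M ω) (u ω) (v ω) := by
  simp only [form, dotProduct, mulVec]
  refine Finset.measurable_sum _ fun i _ => (measurable_ofLp_apply hu i).mul ?_
  exact Finset.measurable_sum _ fun j _ => (hM i j).mul (measurable_ofLp_apply hv j)

lemma measurable_wnorm {α : Type*} {m : MeasurableSpace α} {d : ℕ}
    {M : α → Matrix (Fin d) (Fin d) ℝ} (hM : ∀ i j, Measurable fun ω => M ω i j)
    {u : α → Vec d} (hu : Measurable u) : Measurable fun ω => wnorm (M ω) (u ω) :=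
  (measurable_form hM hu hu).sqrt

end Measurability

section Supermartingale

variable {Ω : Type*} [mΩ : MeasurableSpace Ω] {P : Measure Ω} [IsProbabilityMeasure P]

/-- One step of an exponential supermartingale: `e` has conditional mean zero and conditional
second moment `v`. -/
lemma integral_le_of_step {m : MeasurableSpace Ω} (hm : m ≤ mΩ) {X Y B G e v : Ω → ℝ} {K : ℝ}
    (hX : Measurable[m] X) (hB : Measurable[m] B) (hG : Measurable[m] G)
    (hXK : ∀ᵐ ω ∂P, |X ω| ≤ K) (hBK : ∀ᵐ ω ∂P, |B ω| ≤ K) (hGK : ∀ᵐ ω ∂P, |G ω| ≤ K)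
    (he : Measurable[mΩ] e) (heK : ∀ᵐ ω ∂P, |e ω| ≤ 1) (hmean : P[e | m] =ᵐ[P] 0)
    (hv : v = P[fun ω => e ω ^ 2 | m]) (hY0 : ∀ᵐ ω ∂P, 0 ≤ Y ω)
    (hY : ∀ᵐ ω ∂P, Y ω ≤ X ω * (1 + e ω * B ω + (e ω ^ 2 - v ω) * G ω)) :
    ∫ ω, Y ω ∂P ≤ ∫ ω, X ω ∂P := by
  have hei : Integrable e P :=
    Integrable.of_bound he.aestronglyMeasurable 1 (by simpa [Real.norm_eq_abs] using heK)
  have he2i : Integrable (fun ω => e ω ^ 2) P := by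
    refine Integrable.of_bound (he.pow_const 2).aestronglyMeasurable 1 ?_
    filter_upwards [heK] with ω h
    rw [Real.norm_eq_abs, abs_pow]
    exact pow_le_one₀ (abs_nonneg _) h
  have hXi : Integrable X P := Integrable.of_bound (hX.mono hm le_rfl).aestronglyMeasurable K
    (by simpa [Real.norm_eq_abs] using hXK)
  have hXB : ∀ᵐ ω ∂P, ‖(X * B) ω‖ ≤ K * K := by
    filter_upwards [hXK, hBK] with ω h1 h2
    rw [Pi.mul_apply, norm_mul, Real.norm_eq_abs, Real.norm_eq_abs]
    exact mul_le_mul h1 h2 (abs_nonneg _) ((abs_nonneg _).trans h1)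
  have hXG : ∀ᵐ ω ∂P, ‖(X * G) ω‖ ≤ K * K := by
    filter_upwards [hXK, hGK] with ω h1 h2
    rw [Pi.mul_apply, norm_mul, Real.norm_eq_abs, Real.norm_eq_abs]
    exact mul_le_mul h1 h2 (abs_nonneg _) ((abs_nonneg _).trans h1)
  have hXBm : StronglyMeasurable[m] (X * B) := (hX.mul hB).stronglyMeasurable
  have hXGm : StronglyMeasurable[m] (X * G) := (hX.mul hG).stronglyMeasurable
  have i1 : Integrable (X * B * e) P :=
    hei.bdd_mul (hXBm.mono hm).aestronglyMeasurable hXB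
  have i2 : Integrable (X * G * fun ω => e ω ^ 2) P :=
    he2i.bdd_mul (hXGm.mono hm).aestronglyMeasurable hXG
  have i3 : Integrable (X * G * v) P := by
    rw [hv]
    exact integrable_condExp.bdd_mul (hXGm.mono hm).aestronglyMeasurable hXG
  have z1 : ∫ ω, (X * B * e) ω ∂P = 0 := by
    rw [← integral_condExp hm]
    have h1 := condExp_mul_of_stronglyMeasurable_left hXBm i1 hei
    rw [integral_congr_ae h1]
    refine integral_eq_zero_of_ae ?_
    filter_upwards [hmean] with ω h
    simp [h]
  have z2 : ∫ ω, (X * G * fun ω => e ω ^ 2) ω ∂P = ∫ ω, (X * G * v) ω ∂P := by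
    rw [← integral_condExp hm]
    have h1 := condExp_mul_of_stronglyMeasurable_left hXGm i2 he2i
    rw [integral_congr_ae h1, hv]
  calc ∫ ω, Y ω ∂P ≤ ∫ ω, (X ω + (X * B * e) ω +
        ((X * G * fun ω => e ω ^ 2) ω - (X * G * v) ω)) ∂P := by
        refine integral_mono_of_nonneg hY0 ((hXi.add i1).add (i2.sub i3)) ?_
        filter_upwards [hY] with ω h
        refine h.trans (le_of_eq ?_)
        simp only [Pi.mul_apply]
        ring
    _ = ∫ ω, X ω ∂P := by
        have e1 := integral_add' (hXi.add i1) (i2.sub i3)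
        rw [integral_add' hXi i1, integral_sub' i2 i3, z1, z2, sub_self, add_zero, add_zero] at e1
        exact e1

/-- Exponential tail bound for a process whose exponential is a supermartingale up to round
`T + 1`. -/
lemma measureReal_ge_le {ℱ : Filtration ℕ mΩ} {T : ℕ} {W B G e v : ℕ → Ω → ℝ} {c K : ℝ}
    (hW : ∀ t ∈ Finset.Icc 1 (T + 1), Measurable[ℱ t] (W t))
    (hB : ∀ t ∈ Finset.Icc 1 T, Measurable[ℱ t] (B t))
    (hG : ∀ t ∈ Finset.Icc 1 T, Measurable[ℱ t] (G t))
    (hBK : ∀ t ∈ Finset.Icc 1 T, ∀ᵐ ω ∂P, |B t ω| ≤ K)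
    (hGK : ∀ t ∈ Finset.Icc 1 T, ∀ᵐ ω ∂P, |G t ω| ≤ K)
    (he : ∀ t ∈ Finset.Icc 1 T, Measurable (e t))
    (heK : ∀ t ∈ Finset.Icc 1 T, ∀ᵐ ω ∂P, |e t ω| ≤ 1)
    (hmean : ∀ t ∈ Finset.Icc 1 T, P[e t | ℱ t] =ᵐ[P] 0)
    (hv : ∀ t ∈ Finset.Icc 1 T, v t = P[fun ω => e t ω ^ 2 | ℱ t])
    (hW1 : ∀ ω, W 1 ω = c)
    (hWs : ∀ t ∈ Finset.Icc 1 T, ∀ᵐ ω ∂P, W (t + 1) ω ≤ W t ω + 1)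
    (hstep : ∀ t ∈ Finset.Icc 1 T, ∀ᵐ ω ∂P, Real.exp (W (t + 1) ω - W t ω) ≤
      1 + e t ω * B t ω + (e t ω ^ 2 - v t ω) * G t ω)
    {t : ℕ} (ht1 : 1 ≤ t) (ht : t ≤ T + 1) (x : ℝ) :
    P.real {ω | x ≤ W t ω} ≤ Real.exp (c - x) := by
  have hbd : ∀ t, 1 ≤ t → t ≤ T + 1 → ∀ᵐ ω ∂P, W t ω ≤ c + t := by
    intro t ht1
    induction t, ht1 using Nat.le_induction with
    | base => intro _; exact Filter.Eventually.of_forall fun ω => by rw [hW1]; simp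
    | succ t h1 ih =>
      intro h2
      filter_upwards [ih (by omega), hWs t (Finset.mem_Icc.2 ⟨h1, by omega⟩)] with ω h3 h4
      push_cast
      linarith
  have hm : ∀ t ∈ Finset.Icc 1 (T + 1), Measurable fun ω => Real.exp (W t ω) := fun t ht =>
    Real.measurable_exp.comp ((hW t ht).mono (ℱ.le t) le_rfl)
  have hi : ∀ t ∈ Finset.Icc 1 (T + 1), Integrable (fun ω => Real.exp (W t ω)) P := by
    intro t ht
    obtain ⟨h1, h2⟩ := Finset.mem_Icc.1 ht
    refine Integrable.of_bound (hm t ht).aestronglyMeasurable (Real.exp (c + t)) ?_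
    filter_upwards [hbd t h1 h2] with ω h
    rw [Real.norm_eq_abs, Real.abs_exp]
    exact Real.exp_le_exp.2 h
  have hint : ∀ t, 1 ≤ t → t ≤ T + 1 → ∫ ω, Real.exp (W t ω) ∂P ≤ Real.exp c := by
    intro t ht1
    induction t, ht1 using Nat.le_induction with
    | base => intro _; simp [hW1]
    | succ t h1 ih =>
      intro h2
      have ht : t ∈ Finset.Icc 1 T := Finset.mem_Icc.2 ⟨h1, by omega⟩
      refine le_trans ?_ (ih (by omega))
      refine integral_le_of_step (ℱ.le t) (B := B t) (G := G t) (e := e t) (v := v t)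
        (K := max K (Real.exp (c + t)))
        (Real.measurable_exp.comp (hW t (Finset.mem_Icc.2 ⟨h1, by omega⟩))) (hB t ht) (hG t ht)
        ?_ ?_ ?_ (he t ht) (heK t ht) (hmean t ht) (hv t ht)
        (Filter.Eventually.of_forall fun ω => (Real.exp_pos _).le) ?_
      · filter_upwards [hbd t h1 (by omega)] with ω h
        rw [Real.abs_exp]
        exact (Real.exp_le_exp.2 h).trans (le_max_right _ _)
      · filter_upwards [hBK t ht] with ω h using h.trans (le_max_left _ _)
      · filter_upwards [hGK t ht] with ω h using h.trans (le_max_left _ _)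
      · filter_upwards [hstep t ht] with ω h
        calc Real.exp (W (t + 1) ω) = Real.exp (W t ω) * Real.exp (W (t + 1) ω - W t ω) := by
              rw [← Real.exp_add]; ring_nf
          _ ≤ _ := by gcongr
  have h1 := mul_meas_ge_le_integral_of_nonneg
    (Filter.Eventually.of_forall fun ω => (Real.exp_pos (W t ω)).le)
    (hi t (Finset.mem_Icc.2 ⟨ht1, ht⟩)) (Real.exp x)
  simp only [Real.exp_le_exp] at h1
  have h2 := h1.trans (hint t ht1 ht)
  rw [Real.exp_sub, le_div_iff₀ (Real.exp_pos x), mul_comm]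
  exact h2

end Supermartingale

section Noise

variable {d : ℕ} {Ω : Type*} [mΩ : MeasurableSpace Ω] {P : Measure Ω}
  {ℱ : Filtration ℕ mΩ} {τ : Ω → Trajectory d} {p : Params} {θ : Vec d} {A : ℝ} {T t : ℕ}

namespace IsDuelingModel

variable (h : IsDuelingModel P ℱ τ p.μ θ A T)
include h

lemma measurable_z (ht : t ∈ Finset.Icc 1 T) : Measurable[ℱ t] fun ω => (τ ω).z t :=
  (h.measurable_x t ht).sub (h.measurable_y t ht)

lemma measurable_prob (hp : p.Valid) (ht : t ∈ Finset.Icc 1 T) :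
    Measurable[ℱ t] (prob p.μ θ τ t) :=
  hp.link.differentiable.continuous.measurable.comp ((h.measurable_z ht).inner measurable_const)

lemma measurable_noise (hp : p.Valid) (ht : t ∈ Finset.Icc 1 T) :
    Measurable[ℱ (t + 1)] fun ω => (τ ω).noise p.μ θ t :=
  (h.measurable_o t ht).sub ((h.measurable_prob hp ht).mono (ℱ.mono (Nat.le_succ t)) le_rfl)

lemma integrable_o [IsProbabilityMeasure P] (ht : t ∈ Finset.Icc 1 T) :
    Integrable (fun ω => (τ ω).o t) P := by
  refine Integrable.of_bound ((h.measurable_o t ht).mono (ℱ.le _) le_rfl).aestronglyMeasurable 1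
    (Filter.Eventually.of_forall fun ω => ?_)
  rcases h.binary t ht ω with h | h <;> simp [h]

lemma prob_mem [IsProbabilityMeasure P] (ht : t ∈ Finset.Icc 1 T) :
    ∀ᵐ ω ∂P, 0 ≤ prob p.μ θ τ t ω ∧ prob p.μ θ τ t ω ≤ 1 := by
  have h1 : 0 ≤ᵐ[P] P[fun ω => (τ ω).o t | ℱ t] :=
    condExp_nonneg (Filter.Eventually.of_forall fun ω => by
      rcases h.binary t ht ω with h | h <;> simp [h])
  have h2 : P[fun ω => (τ ω).o t | ℱ t] ≤ᵐ[P] P[fun _ => (1 : ℝ) | ℱ t] :=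
    condExp_mono (h.integrable_o ht) (integrable_const _) (Filter.Eventually.of_forall fun ω => by
      rcases h.binary t ht ω with h | h <;> simp [h])
  rw [condExp_const (ℱ.le t)] at h2
  filter_upwards [h1, h2, h.condMean t ht] with ω e1 e2 e3
  rw [← e3]
  exact ⟨e1, e2⟩

lemma abs_noise_le [IsProbabilityMeasure P] (ht : t ∈ Finset.Icc 1 T) :
    ∀ᵐ ω ∂P, |(τ ω).noise p.μ θ t| ≤ 1 := by
  filter_upwards [h.prob_mem ht] with ω ⟨h1, h2⟩
  rw [prob] at h1 h2
  rw [Trajectory.noise, abs_le]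
  rcases h.binary t ht ω with h | h <;> rw [h] <;> constructor <;> linarith

lemma condExp_noise [IsProbabilityMeasure P] (hp : p.Valid) (ht : t ∈ Finset.Icc 1 T) :
    P[fun ω => (τ ω).noise p.μ θ t | ℱ t] =ᵐ[P] 0 := by
  have hpm := h.measurable_prob hp ht
  have hpi : Integrable (prob p.μ θ τ t) P := integrable_condExp.congr (h.condMean t ht)
  have h1 : P[(fun ω => (τ ω).o t) - prob p.μ θ τ t | ℱ t] =ᵐ[P]
      P[fun ω => (τ ω).o t | ℱ t] - P[prob p.μ θ τ t | ℱ t] :=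
    condExp_sub (h.integrable_o ht) hpi _
  rw [condExp_of_stronglyMeasurable (ℱ.le t) hpm.stronglyMeasurable hpi] at h1
  refine h1.trans ?_
  filter_upwards [h.condMean t ht] with ω e
  simp [e]

lemma noiseVar_mem [IsProbabilityMeasure P] (hp : p.Valid) (ht : t ∈ Finset.Icc 1 T) :
    ∀ᵐ ω ∂P, 0 ≤ noiseVar P ℱ τ p.μ θ t ω ∧ noiseVar P ℱ τ p.μ θ t ω ≤ 1 := by
  have hm : Measurable fun ω => ((τ ω).noise p.μ θ t) ^ 2 :=
    ((h.measurable_noise hp ht).mono (ℱ.le _) le_rfl).pow_const 2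
  have hle : ∀ᵐ ω ∂P, ((τ ω).noise p.μ θ t) ^ 2 ≤ 1 := by
    filter_upwards [h.abs_noise_le ht] with ω e using (sq_le_one_iff_abs_le_one _).2 e
  have hi : Integrable (fun ω => ((τ ω).noise p.μ θ t) ^ 2) P := by
    refine Integrable.of_bound hm.aestronglyMeasurable 1 ?_
    filter_upwards [hle] with ω e
    rwa [Real.norm_eq_abs, abs_of_nonneg (sq_nonneg _)]
  have h1 : 0 ≤ᵐ[P] P[fun ω => ((τ ω).noise p.μ θ t) ^ 2 | ℱ t] :=
    condExp_nonneg (Filter.Eventually.of_forall fun ω => sq_nonneg _)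
  have h2 : P[fun ω => ((τ ω).noise p.μ θ t) ^ 2 | ℱ t] ≤ᵐ[P] P[fun _ => (1 : ℝ) | ℱ t] :=
    condExp_mono hi (integrable_const _) hle
  rw [condExp_const (ℱ.le t)] at h2
  filter_upwards [h1, h2] with ω e1 e2 using ⟨e1, e2⟩

lemma measurable_sqWeight_of_cov (ht : t ∈ Finset.Icc 1 T) {ℓ : ℕ}
    (hc : ∀ i j, Measurable[ℱ t] fun ω => (τ ω).cov t ℓ i j) :
    Measurable[ℱ t] fun ω => (τ ω).sqWeight t ℓ := by
  have e : (fun ω => (τ ω).sqWeight t ℓ) = fun ω => if (τ ω).layer t = some ℓ then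
      ((1 / 2 : ℝ) ^ ℓ / wnorm ((τ ω).cov t ℓ)⁻¹ ((τ ω).z t)) ^ 2 else 0 := by
    funext ω
    rw [Trajectory.sqWeight]
    by_cases hl : (τ ω).layer t = some ℓ
    · rw [if_pos ⟨(Finset.mem_Icc.1 ht).1, hl⟩, if_pos hl, Trajectory.weight_eq _ hl]
    · rw [if_neg fun h => hl h.2, if_neg hl]
  rw [e]
  refine Measurable.ite (h.measurable_layer t ht ℓ) ?_ measurable_const
  exact (measurable_const.div
    (measurable_wnorm (measurable_matrix_inv hc) (h.measurable_z ht))).pow_const 2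

lemma measurable_cov {t : ℕ} (ht1 : 1 ≤ t) (ht : t ≤ T + 1) (ℓ : ℕ) (i j : Fin d) :
    Measurable[ℱ t] fun ω => (τ ω).cov t ℓ i j := by
  induction t, ht1 using Nat.le_induction generalizing i j with
  | base =>
    have : ∀ ω, (τ ω).cov 1 ℓ = ((1 / 2 : ℝ) ^ (2 * ℓ)) • 1 := fun ω => by
      exact (Trajectory.cov_succ_neg (τ ω) (t := 0) (by simp)).trans (by rw [Trajectory.cov])
    simp only [this]
    exact measurable_const
  | succ t h1 ih =>
    have htT : t ∈ Finset.Icc 1 T := Finset.mem_Icc.2 ⟨h1, by omega⟩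
    have hc := fun i j => ih (by omega) i j
    refine Measurable.mono ?_ (ℱ.mono (Nat.le_succ t)) le_rfl
    simp only [Trajectory.cov_succ, Matrix.add_apply, Matrix.smul_apply, vecMulVec_apply,
      smul_eq_mul]
    exact (hc i j).add ((h.measurable_sqWeight_of_cov htT hc).mul
      ((measurable_ofLp_apply (h.measurable_z htT) i).mul
        (measurable_ofLp_apply (h.measurable_z htT) j)))

lemma measurable_sqWeight (ht : t ∈ Finset.Icc 1 T) (ℓ : ℕ) :
    Measurable[ℱ t] fun ω => (τ ω).sqWeight t ℓ :=
  h.measurable_sqWeight_of_cov ht fun i j => h.measurable_cov (Finset.mem_Icc.1 ht).1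
    ((Finset.mem_Icc.1 ht).2.trans (Nat.le_succ T)) ℓ i j

lemma measurable_noiseSum (hp : p.Valid) {t : ℕ} (ht1 : 1 ≤ t) (ht : t ≤ T + 1) (ℓ : ℕ) :
    Measurable[ℱ t] fun ω => (τ ω).noiseSum p.μ θ t ℓ := by
  induction t, ht1 using Nat.le_induction with
  | base =>
    simp only [Trajectory.noiseSum, Trajectory.idx_one, Finset.sum_empty]
    exact measurable_const
  | succ t h1 ih =>
    have htT : t ∈ Finset.Icc 1 T := Finset.mem_Icc.2 ⟨h1, by omega⟩
    have hle := ℱ.mono (Nat.le_succ t)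
    simp only [Trajectory.noiseSum_succ]
    exact ((ih (by omega)).mono hle le_rfl).add
      ((((h.measurable_sqWeight htT ℓ).mono hle le_rfl).mul (h.measurable_noise hp htT)).smul
        ((h.measurable_z htT).mono hle le_rfl))

lemma measurable_wsum {v : ℕ → Ω → ℝ}
    (hv : ∀ t ∈ Finset.Icc 1 T, Measurable[ℱ (t + 1)] (v t)) {t : ℕ} (ht1 : 1 ≤ t)
    (ht : t ≤ T + 1) (ℓ : ℕ) : Measurable[ℱ t] fun ω => (τ ω).wsum (fun s => v s ω) t ℓ := by
  induction t, ht1 using Nat.le_induction with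
  | base =>
    simp only [Trajectory.wsum, Trajectory.idx_one, Finset.sum_empty]
    exact measurable_const
  | succ t h1 ih =>
    have htT : t ∈ Finset.Icc 1 T := Finset.mem_Icc.2 ⟨h1, by omega⟩
    have hle := ℱ.mono (Nat.le_succ t)
    simp only [Trajectory.wsum_succ]
    exact ((ih (by omega)).mono hle le_rfl).add
      (((h.measurable_sqWeight htT ℓ).mono hle le_rfl).mul (hv t htT))

lemma measurable_height (hp : p.Valid) {t : ℕ} (ht1 : 1 ≤ t) (ht : t ≤ T + 1) (s : ℝ) (ℓ : ℕ) :
    Measurable[ℱ t] fun ω => (τ ω).height p.μ θ s t ℓ :=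
  (measurable_const.add ((measurable_const.mul (measurable_wnorm
    (measurable_matrix_inv (h.measurable_cov ht1 ht ℓ))
    (h.measurable_noiseSum hp ht1 ht ℓ))).pow_const 2)).sqrt

lemma measurable_slope (hp : p.Valid) (ht : t ∈ Finset.Icc 1 T) (s : ℝ) (ℓ : ℕ) :
    Measurable[ℱ t] fun ω => (τ ω).slope p.μ θ s t ℓ := by
  obtain ⟨h1, h2⟩ := Finset.mem_Icc.1 ht
  exact (measurable_const.mul ((h.measurable_sqWeight ht ℓ).mul (measurable_form
    (measurable_matrix_inv (h.measurable_cov h1 (by omega) ℓ))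
    (h.measurable_noiseSum hp h1 (by omega) ℓ) (h.measurable_z ht)))).div
    (h.measurable_height hp h1 (by omega) s ℓ)

end IsDuelingModel

end Noise

/-! ### Tail bounds -/

namespace Trajectory
variable {d : ℕ} {p : Params} {τ : Trajectory d} {T : ℕ} {θ : Vec d} {v : ℕ → ℝ}

lemma wsum_one (τ : Trajectory d) (v : ℕ → ℝ) (ℓ : ℕ) : τ.wsum v 1 ℓ = 0 := by
  rw [wsum, idx_one, Finset.sum_empty]

lemma height_one (μ : ℝ → ℝ) (θ : Vec d) (τ : Trajectory d) (s : ℝ) (ℓ : ℕ) :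
    τ.height μ θ s 1 ℓ = 1 := by
  have e : τ.noiseSum μ θ 1 ℓ = (0 : ℝ) • 0 := by simp [noiseSum, idx_one]
  rw [height, e, wnorm_smul]
  simp

/-- A bound of the height for all scales `s = 1 / m` gives the Bernstein bound; the scale is chosen
as `m ≈ √(V / ι)`. -/
lemma noiseSum_le_of_height_le {μ : ℝ → ℝ} {t ℓ : ℕ} {V i : ℝ} (hi : 1 ≤ i) (hV : 0 ≤ V)
    (hVt : V ≤ t) (h : ∀ m ∈ Finset.Icc 2 (t + 2),
      τ.height μ θ (1 / (m : ℝ)) t ℓ - 17 / 8 * (1 / (m : ℝ)) ^ 2 * V ≤ 2 * i) :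
    wnorm (τ.cov t ℓ)⁻¹ (τ.noiseSum μ θ t ℓ) ≤ (1 / 2) ^ ℓ * (5 * √(V * i) + 5 * i) := by
  set n := wnorm (τ.cov t ℓ)⁻¹ (τ.noiseSum μ θ t ℓ) with hn
  have hn0 : 0 ≤ n := wnorm_nonneg _ _
  set x := √(V / i) with hx
  have hi0 : 0 < i := by linarith
  have hx0 : 0 ≤ x := Real.sqrt_nonneg _
  have hxx : x * x = V / i := Real.mul_self_sqrt (by positivity)
  have hxi : √(V * i) = x * i := by
    rw [← Real.sqrt_sq hi0.le, hx, ← Real.sqrt_mul (by positivity), Real.sqrt_sq hi0.le]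
    congr 1
    field_simp
  set m : ℕ := max 2 ⌈x⌉₊ with hm
  have hm2 : 2 ≤ m := le_max_left _ _
  have hxm : x ≤ m := (Nat.le_ceil x).trans (by exact_mod_cast le_max_right _ _)
  have hmx : (m : ℝ) ≤ x + 2 := by
    rcases max_choice 2 ⌈x⌉₊ with h | h
    · rw [hm, h]; push_cast; linarith
    · rw [hm, h]; linarith [Nat.ceil_lt_add_one hx0]
  -- `V ≤ t` keeps the scale within the range of the union bound.
  have hmt : m ≤ t + 2 := by
    have : x ≤ t := by
      rw [hx, Real.sqrt_le_left (Nat.cast_nonneg t)]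
      rcases Nat.eq_zero_or_pos t with rfl | ht
      · have : V = 0 := le_antisymm (by simpa using hVt) hV
        simp [this]
      · have h1 : V / i ≤ V := div_le_self hV hi
        have h2 : (1 : ℝ) ≤ t := by exact_mod_cast ht
        nlinarith
    exact max_le (by omega) ((Nat.ceil_le.2 (by exact_mod_cast this)).trans (by omega))
  have hm0 : (0 : ℝ) < m := by
    have : 0 < m := by omega
    exact_mod_cast this
  have h1 := h m (Finset.mem_Icc.2 ⟨hm2, hmt⟩)
  have h2 : 1 / (m : ℝ) * 2 ^ ℓ * n ≤ τ.height μ θ (1 / (m : ℝ)) t ℓ := by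
    rw [height]
    exact Real.le_sqrt_of_sq_le (by linarith)
  have h3 : 1 / (m : ℝ) * 2 ^ ℓ * n ≤ 2 * i + 17 / 8 * (1 / (m : ℝ)) ^ 2 * V := by linarith
  have h4 : 2 ^ ℓ * n ≤ 2 * i * m + 17 / 8 * (V / m) := by
    have := mul_le_mul_of_nonneg_left h3 hm0.le
    have e1 : (m : ℝ) * (1 / (m : ℝ) * 2 ^ ℓ * n) = 2 ^ ℓ * n := by field_simp
    have e2 : (m : ℝ) * (2 * i + 17 / 8 * (1 / (m : ℝ)) ^ 2 * V) =
      2 * i * m + 17 / 8 * (V / m) := by field_simp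
    linarith
  have h5 : V / m ≤ x * i := by
    rw [div_le_iff₀ hm0]
    have : V = x * x * i := by rw [hxx]; field_simp
    rw [this]
    have : x * i * x ≤ x * i * m := by gcongr
    linarith
  have h6 : 2 * i * m ≤ 2 * i * (x + 2) := by gcongr
  have h7 : 2 ^ ℓ * n ≤ 5 * √(V * i) + 5 * i := by
    rw [hxi]
    have : 0 ≤ x * i := by positivity
    linarith
  calc n = (1 / 2) ^ ℓ * (2 ^ ℓ * n) := by
        rw [← mul_assoc, mul_comm ((1 / 2 : ℝ) ^ ℓ), two_pow_mul_half_pow, one_mul]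
    _ ≤ _ := by gcongr

end Trajectory

section Tails

variable {d : ℕ} {Ω : Type*} [mΩ : MeasurableSpace Ω] {P : Measure Ω} [IsProbabilityMeasure P]
  {ℱ : Filtration ℕ mΩ} {τ : Ω → Trajectory d} {p : Params} {θ : Vec d} {A : ℝ} {T t : ℕ}

omit [IsProbabilityMeasure P] in
lemma measurable_noiseVar (μ : ℝ → ℝ) (s : ℕ) : Measurable[ℱ s] (noiseVar P ℱ τ μ θ s) :=
  stronglyMeasurable_condExp.measurable

lemma abs_mul_exp_neg_le {b u : ℝ} (hb : |b| ≤ 1) (hu : 0 ≤ u) : |b * Real.exp (-u)| ≤ 1 := by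
  rw [abs_mul, Real.abs_exp]
  exact mul_le_one₀ hb (Real.exp_pos _).le (Real.exp_le_one_iff.2 (by linarith))

namespace IsDuelingModel

/-- The Bernstein tail for the noise sum at scale `s`. -/
lemma height_tail (h : IsDuelingModel P ℱ τ p.μ θ A T) (hp : p.Valid)
    (hrun : ∀ ω, (τ ω).IsRun p T) (ht1 : 1 ≤ t) (ht : t ≤ T + 1) (ℓ : ℕ) {s : ℝ} (hs : 0 ≤ s)
    (hs2 : s ≤ 1 / 2) (x : ℝ) :
    P.real {ω | x ≤ (τ ω).height p.μ θ s t ℓ -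
      17 / 8 * s ^ 2 * (τ ω).wsum (fun r => noiseVar P ℱ τ p.μ θ r ω) t ℓ} ≤ Real.exp (1 - x) := by
  have ha : ∀ t ω, 0 ≤ (τ ω).sqWeight t ℓ := fun t ω => Trajectory.sqWeight_nonneg _ _ _
  have ha1 : ∀ t ∈ Finset.Icc 1 T, ∀ ω, (τ ω).sqWeight t ℓ ≤ 1 := fun t ht ω =>
    (hrun ω).sqWeight_le_one (Finset.mem_Icc.1 ht).2 ℓ
  have hb : ∀ t ∈ Finset.Icc 1 T, ∀ ω,
      |(τ ω).slope p.μ θ s t ℓ| ≤ s * √((τ ω).sqWeight t ℓ) := fun t ht ω =>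
    (hrun ω).abs_slope_le (Finset.mem_Icc.1 ht).2 ℓ hs p.μ
  have hs22 : s ^ 2 ≤ 1 / 4 := by nlinarith
  have hwm : ∀ t ∈ Finset.Icc 1 T, Measurable[ℱ t] fun ω =>
      17 / 8 * s ^ 2 * ((τ ω).sqWeight t ℓ * noiseVar P ℱ τ p.μ θ t ω) := fun t ht =>
    measurable_const.mul ((h.measurable_sqWeight ht ℓ).mul (measurable_noiseVar p.μ t))
  have hu0 : ∀ t ω, 0 ≤ noiseVar P ℱ τ p.μ θ t ω →
      0 ≤ 17 / 8 * s ^ 2 * ((τ ω).sqWeight t ℓ * noiseVar P ℱ τ p.μ θ t ω) := fun t ω h0 =>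
    mul_nonneg (by positivity) (mul_nonneg (ha t ω) h0)
  refine measureReal_ge_le (ℱ := ℱ) (T := T) (e := fun t ω => (τ ω).noise p.μ θ t)
    (v := noiseVar P ℱ τ p.μ θ) (K := 1)
    (W := fun t ω => (τ ω).height p.μ θ s t ℓ -
      17 / 8 * s ^ 2 * (τ ω).wsum (fun r => noiseVar P ℱ τ p.μ θ r ω) t ℓ)
    (B := fun t ω => (τ ω).slope p.μ θ s t ℓ *
      Real.exp (-(17 / 8 * s ^ 2 * ((τ ω).sqWeight t ℓ * noiseVar P ℱ τ p.μ θ t ω))))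
    (G := fun t ω => 17 / 8 * s ^ 2 * (τ ω).sqWeight t ℓ *
      Real.exp (-(17 / 8 * s ^ 2 * ((τ ω).sqWeight t ℓ * noiseVar P ℱ τ p.μ θ t ω))))
    ?_ ?_ ?_ ?_ ?_ ?_ ?_ ?_ ?_ ?_ ?_ ?_ ht1 ht x
  · intro t ht
    obtain ⟨h1, h2⟩ := Finset.mem_Icc.1 ht
    exact (h.measurable_height hp h1 h2 s ℓ).sub (measurable_const.mul
      (h.measurable_wsum (fun r _ => (measurable_noiseVar p.μ r).mono
        (ℱ.mono (Nat.le_succ r)) le_rfl) h1 h2 ℓ))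
  · exact fun t ht => (h.measurable_slope hp ht s ℓ).mul
      (Real.measurable_exp.comp (hwm t ht).neg)
  · exact fun t ht => (measurable_const.mul (h.measurable_sqWeight ht ℓ)).mul
      (Real.measurable_exp.comp (hwm t ht).neg)
  · intro t ht
    filter_upwards [h.noiseVar_mem hp ht] with ω h0
    refine abs_mul_exp_neg_le ((hb t ht ω).trans ?_) (hu0 t ω h0.1)
    exact mul_le_one₀ (by linarith) (Real.sqrt_nonneg _) (Real.sqrt_le_one.2 (ha1 t ht ω))
  · intro t ht
    filter_upwards [h.noiseVar_mem hp ht] with ω h0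
    refine abs_mul_exp_neg_le ?_ (hu0 t ω h0.1)
    rw [abs_of_nonneg (mul_nonneg (by positivity) (ha t ω))]
    exact mul_le_one₀ (by linarith) (ha t ω) (ha1 t ht ω)
  · exact fun t ht => (h.measurable_noise hp ht).mono (ℱ.le _) le_rfl
  · exact fun t ht => h.abs_noise_le ht
  · exact fun t ht => h.condExp_noise hp ht
  · exact fun t _ => rfl
  · intro ω
    rw [Trajectory.height_one, Trajectory.wsum_one, mul_zero, sub_zero]
  · intro t ht
    filter_upwards [h.noiseVar_mem hp ht, h.abs_noise_le ht] with ω h0 he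
    have h1 := (hrun ω).height_succ_le (θ := θ) (Finset.mem_Icc.1 ht).2 ℓ (s := s) p.μ
    have h2 := (abs_le.1 (exp_bernstein_step (v := noiseVar P ℱ τ p.μ θ t ω) hs hs2 (ha t ω)
      (ha1 t ht ω) (hb t ht ω) he).2).2
    have h3 := hu0 t ω h0.1
    rw [Trajectory.wsum_succ]
    linarith
  · intro t ht
    filter_upwards [h.abs_noise_le ht] with ω he
    have h1 := (hrun ω).height_succ_le (θ := θ) (Finset.mem_Icc.1 ht).2 ℓ (s := s) p.μ
    refine le_trans (Real.exp_le_exp.2 ?_) (exp_bernstein_step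
      (v := noiseVar P ℱ τ p.μ θ t ω) hs hs2 (ha t ω) (ha1 t ht ω) (hb t ht ω) he).1
    rw [Trajectory.wsum_succ]
    linarith

/-- The tail for the conditional variance exceeding twice the realized one. -/
lemma var_tail (h : IsDuelingModel P ℱ τ p.μ θ A T) (hp : p.Valid)
    (hrun : ∀ ω, (τ ω).IsRun p T) (ht1 : 1 ≤ t) (ht : t ≤ T + 1) (ℓ : ℕ) (x : ℝ) :
    P.real {ω | x ≤ -(τ ω).wsum (fun r => (τ ω).noise p.μ θ r ^ 2) t ℓ / 2 +
      (τ ω).wsum (fun r => noiseVar P ℱ τ p.μ θ r ω) t ℓ / 4} ≤ Real.exp (0 - x) := by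
  have ha : ∀ t ω, 0 ≤ (τ ω).sqWeight t ℓ := fun t ω => Trajectory.sqWeight_nonneg _ _ _
  have ha1 : ∀ t ∈ Finset.Icc 1 T, ∀ ω, (τ ω).sqWeight t ℓ ≤ 1 := fun t ht ω =>
    (hrun ω).sqWeight_le_one (Finset.mem_Icc.1 ht).2 ℓ
  have hwm : ∀ t ∈ Finset.Icc 1 T, Measurable[ℱ t] fun ω =>
      (τ ω).sqWeight t ℓ * noiseVar P ℱ τ p.μ θ t ω / 4 := fun t ht =>
    ((h.measurable_sqWeight ht ℓ).mul (measurable_noiseVar p.μ t)).div_const 4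
  refine measureReal_ge_le (ℱ := ℱ) (T := T) (e := fun t ω => (τ ω).noise p.μ θ t)
    (v := noiseVar P ℱ τ p.μ θ) (K := 1)
    (W := fun t ω => -(τ ω).wsum (fun r => (τ ω).noise p.μ θ r ^ 2) t ℓ / 2 +
      (τ ω).wsum (fun r => noiseVar P ℱ τ p.μ θ r ω) t ℓ / 4)
    (B := fun _ _ => 0)
    (G := fun t ω => -((τ ω).sqWeight t ℓ / 4 *
      Real.exp ((τ ω).sqWeight t ℓ * noiseVar P ℱ τ p.μ θ t ω / 4)))
    ?_ ?_ ?_ ?_ ?_ ?_ ?_ ?_ ?_ ?_ ?_ ?_ ht1 ht x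
  · intro t ht
    obtain ⟨h1, h2⟩ := Finset.mem_Icc.1 ht
    exact ((h.measurable_wsum (v := fun r ω => (τ ω).noise p.μ θ r ^ 2)
        (fun r hr => (h.measurable_noise hp hr).pow_const 2) h1 h2 ℓ).neg.div_const 2).add
      ((h.measurable_wsum (fun r _ => (measurable_noiseVar p.μ r).mono
        (ℱ.mono (Nat.le_succ r)) le_rfl) h1 h2 ℓ).div_const 4)
  · exact fun t ht => measurable_const
  · exact fun t ht => (((h.measurable_sqWeight ht ℓ).div_const 4).mul
      (Real.measurable_exp.comp (hwm t ht))).neg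
  · exact fun t ht => Filter.Eventually.of_forall fun ω => by simp
  · intro t ht
    filter_upwards [h.noiseVar_mem hp ht] with ω h0
    have e0 : (τ ω).sqWeight t ℓ * noiseVar P ℱ τ p.μ θ t ω ≤ 1 * 1 :=
      mul_le_mul (ha1 t ht ω) h0.2 h0.1 zero_le_one
    have e1 : Real.exp ((τ ω).sqWeight t ℓ * noiseVar P ℱ τ p.μ θ t ω / 4) ≤ 4 := by
      refine (Real.exp_le_exp.2 (show _ ≤ (1 : ℝ) by linarith)).trans ?_
      linarith [Real.exp_one_lt_d9]
    have e2 := ha t ω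
    have e3 := ha1 t ht ω
    rw [abs_neg, abs_mul, Real.abs_exp, abs_of_nonneg (by positivity)]
    calc (τ ω).sqWeight t ℓ / 4 * _ ≤ 1 / 4 * 4 := by gcongr
      _ = 1 := by norm_num
  · exact fun t ht => (h.measurable_noise hp ht).mono (ℱ.le _) le_rfl
  · exact fun t ht => h.abs_noise_le ht
  · exact fun t ht => h.condExp_noise hp ht
  · exact fun t _ => rfl
  · intro ω
    rw [Trajectory.wsum_one, Trajectory.wsum_one]
    norm_num
  · intro t ht
    filter_upwards [h.noiseVar_mem hp ht] with ω h0
    have e0 : (τ ω).sqWeight t ℓ * noiseVar P ℱ τ p.μ θ t ω ≤ 1 * 1 :=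
      mul_le_mul (ha1 t ht ω) h0.2 h0.1 zero_le_one
    have e1 := mul_nonneg (ha t ω) (sq_nonneg ((τ ω).noise p.μ θ t))
    rw [Trajectory.wsum_succ, Trajectory.wsum_succ]
    linarith
  · intro t ht
    filter_upwards [h.abs_noise_le ht] with ω he
    refine le_trans (le_of_eq ?_) ((exp_lower_step (v := noiseVar P ℱ τ p.μ θ t ω) (ha t ω)
      (ha1 t ht ω) he).trans (le_of_eq ?_))
    · rw [Trajectory.wsum_succ, Trajectory.wsum_succ]
      congr 1
      ring
    · ring

/-- The tail for the realized variance exceeding `3/2` times the conditional one. -/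
lemma sq_tail (h : IsDuelingModel P ℱ τ p.μ θ A T) (hp : p.Valid)
    (hrun : ∀ ω, (τ ω).IsRun p T) (ht1 : 1 ≤ t) (ht : t ≤ T + 1) (ℓ : ℕ) (x : ℝ) :
    P.real {ω | x ≤ (τ ω).wsum (fun r => (τ ω).noise p.μ θ r ^ 2) t ℓ / 2 -
      3 * (τ ω).wsum (fun r => noiseVar P ℱ τ p.μ θ r ω) t ℓ / 4} ≤ Real.exp (0 - x) := by
  have ha : ∀ t ω, 0 ≤ (τ ω).sqWeight t ℓ := fun t ω => Trajectory.sqWeight_nonneg _ _ _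
  have ha1 : ∀ t ∈ Finset.Icc 1 T, ∀ ω, (τ ω).sqWeight t ℓ ≤ 1 := fun t ht ω =>
    (hrun ω).sqWeight_le_one (Finset.mem_Icc.1 ht).2 ℓ
  have hwm : ∀ t ∈ Finset.Icc 1 T, Measurable[ℱ t] fun ω =>
      3 * ((τ ω).sqWeight t ℓ * noiseVar P ℱ τ p.μ θ t ω) / 4 := fun t ht =>
    (measurable_const.mul
      ((h.measurable_sqWeight ht ℓ).mul (measurable_noiseVar p.μ t))).div_const 4
  refine measureReal_ge_le (ℱ := ℱ) (T := T) (e := fun t ω => (τ ω).noise p.μ θ t)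
    (v := noiseVar P ℱ τ p.μ θ) (K := 1)
    (W := fun t ω => (τ ω).wsum (fun r => (τ ω).noise p.μ θ r ^ 2) t ℓ / 2 -
      3 * (τ ω).wsum (fun r => noiseVar P ℱ τ p.μ θ r ω) t ℓ / 4)
    (B := fun _ _ => 0)
    (G := fun t ω => 3 * (τ ω).sqWeight t ℓ / 4 *
      Real.exp (-(3 * ((τ ω).sqWeight t ℓ * noiseVar P ℱ τ p.μ θ t ω) / 4)))
    ?_ ?_ ?_ ?_ ?_ ?_ ?_ ?_ ?_ ?_ ?_ ?_ ht1 ht x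
  · intro t ht
    obtain ⟨h1, h2⟩ := Finset.mem_Icc.1 ht
    exact ((h.measurable_wsum (v := fun r ω => (τ ω).noise p.μ θ r ^ 2)
        (fun r hr => (h.measurable_noise hp hr).pow_const 2) h1 h2 ℓ).div_const 2).sub
      ((measurable_const.mul (h.measurable_wsum (fun r _ => (measurable_noiseVar p.μ r).mono
        (ℱ.mono (Nat.le_succ r)) le_rfl) h1 h2 ℓ)).div_const 4)
  · exact fun t ht => measurable_const
  · exact fun t ht => ((measurable_const.mul (h.measurable_sqWeight ht ℓ)).div_const 4).mul
      (Real.measurable_exp.comp (hwm t ht).neg)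
  · exact fun t ht => Filter.Eventually.of_forall fun ω => by simp
  · intro t ht
    filter_upwards [h.noiseVar_mem hp ht] with ω h0
    have e2 := ha t ω
    have e3 := ha1 t ht ω
    have e4 := mul_nonneg e2 h0.1
    refine abs_mul_exp_neg_le ?_ (by positivity)
    rw [abs_of_nonneg (by positivity)]
    linarith
  · exact fun t ht => (h.measurable_noise hp ht).mono (ℱ.le _) le_rfl
  · exact fun t ht => h.abs_noise_le ht
  · exact fun t ht => h.condExp_noise hp ht
  · exact fun t _ => rfl
  · intro ω
    rw [Trajectory.wsum_one, Trajectory.wsum_one]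
    norm_num
  · intro t ht
    filter_upwards [h.noiseVar_mem hp ht, h.abs_noise_le ht] with ω h0 he
    have e0 := mul_nonneg (ha t ω) h0.1
    have e1 : (τ ω).sqWeight t ℓ * (τ ω).noise p.μ θ t ^ 2 ≤ 1 * 1 :=
      mul_le_mul (ha1 t ht ω) ((sq_le_one_iff_abs_le_one _).2 he) (sq_nonneg _) zero_le_one
    rw [Trajectory.wsum_succ, Trajectory.wsum_succ]
    linarith
  · intro t ht
    filter_upwards [h.abs_noise_le ht] with ω he
    refine le_trans (le_of_eq ?_) ((exp_upper_step (v := noiseVar P ℱ τ p.μ θ t ω) (ha t ω)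
      (ha1 t ht ω) he).trans (le_of_eq ?_))
    · rw [Trajectory.wsum_succ, Trajectory.wsum_succ]
      congr 1
      ring
    · ring

end IsDuelingModel

end Tails

/-! ### The concentration event and the final bound -/

lemma sum_one_div_sq_le (T : ℕ) : ∑ t ∈ Finset.Icc 1 T, 1 / (t : ℝ) ^ 2 ≤ 2 := by
  suffices h : ∀ T : ℕ, ∑ t ∈ Finset.Icc 1 (T + 1), 1 / (t : ℝ) ^ 2 ≤ 2 - 1 / ((T : ℝ) + 1) by
    rcases T with _ | T
    · simp
    · refine (h T).trans ?_
      have : (0 : ℝ) ≤ 1 / ((T : ℝ) + 1) := by positivity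
      linarith
  intro T
  induction T with
  | zero => norm_num
  | succ T ih =>
    rw [Finset.sum_Icc_succ_top (by omega)]
    push_cast
    have h1 : 1 / ((T : ℝ) + 1 + 1) ^ 2 ≤ 1 / (T + 1) - 1 / (T + 1 + 1) := by
      rw [div_sub_div _ _ (by positivity) (by positivity), div_le_div_iff₀ (by positivity)
        (by positivity)]
      nlinarith [(Nat.cast_nonneg T : (0 : ℝ) ≤ T)]
    linarith

section

variable {d : ℕ} {Ω : Type*} [mΩ : MeasurableSpace Ω] {P : Measure Ω} [IsProbabilityMeasure P]
  {ℱ : Filtration ℕ mΩ} {τ : Ω → Trajectory d} {p : Params} {θ : Vec d} {A : ℝ} {T t : ℕ}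

namespace IsDuelingModel

lemma measureReal_not_concentrated_le (h : IsDuelingModel P ℱ τ p.μ θ A T) (hp : p.Valid)
    (hrun : ∀ ω, (τ ω).IsRun p T) (ht1 : 1 ≤ t) (ht : t ≤ T) (ℓ : ℕ) :
    P.real {ω | (∀ s ∈ Finset.Icc 1 T,
        0 ≤ noiseVar P ℱ τ p.μ θ s ω ∧ noiseVar P ℱ τ p.μ θ s ω ≤ 1) ∧
      ¬ (τ ω).Concentrated p θ (fun s => noiseVar P ℱ τ p.μ θ s ω) t ℓ} ≤
      p.δ / (t ^ 2 * p.numLayers) := by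
  have h1 : (1 : ℝ) ≤ t := by exact_mod_cast ht1
  have hi1 := hp.one_le_logTerm h1
  have hi := hp.logTerm_mono h1 (y := t + 1) (by linarith)
  set i := p.logTerm t with hi_def
  set i' := p.logTerm (t + 1)
  set X : ℝ := 4 * t ^ 2 * p.numLayers / p.δ with hX
  have hX4 : 4 ≤ X := hp.four_le h1
  have hexp : Real.exp (-i) = 1 / X := by
    rw [hi_def, Params.logTerm, Real.exp_neg, Real.exp_log (by linarith), one_div]
  let H : ℕ → Set Ω := fun m => {ω | 2 * i ≤ (τ ω).height p.μ θ (1 / (m : ℝ)) t ℓ -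
      17 / 8 * (1 / (m : ℝ)) ^ 2 * (τ ω).wsum (fun r => noiseVar P ℱ τ p.μ θ r ω) t ℓ}
  let U : Set Ω := {ω | i' ≤ -(τ ω).wsum (fun r => (τ ω).noise p.μ θ r ^ 2) t ℓ / 2 +
      (τ ω).wsum (fun r => noiseVar P ℱ τ p.μ θ r ω) t ℓ / 4}
  let D : Set Ω := {ω | i' ≤ (τ ω).wsum (fun r => (τ ω).noise p.μ θ r ^ 2) t ℓ / 2 -
      3 * (τ ω).wsum (fun r => noiseVar P ℱ τ p.μ θ r ω) t ℓ / 4}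
  have hsub : {ω | (∀ s ∈ Finset.Icc 1 T,
        0 ≤ noiseVar P ℱ τ p.μ θ s ω ∧ noiseVar P ℱ τ p.μ θ s ω ≤ 1) ∧
      ¬ (τ ω).Concentrated p θ (fun s => noiseVar P ℱ τ p.μ θ s ω) t ℓ} ⊆
      (⋃ m ∈ Finset.Icc 2 (t + 2), H m) ∪ (U ∪ D) := by
    rintro ω ⟨hv, hc⟩
    by_contra hcon
    simp only [Set.mem_union, Set.mem_iUnion, not_or, not_exists] at hcon
    obtain ⟨hH, hU, hD⟩ := hcon
    have hV0 : 0 ≤ (τ ω).wsum (fun r => noiseVar P ℱ τ p.μ θ r ω) t ℓ :=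
      Trajectory.wsum_nonneg _ fun s hs => by
        rw [Trajectory.mem_idx] at hs
        exact (hv s (Finset.mem_Icc.2 ⟨hs.1.1, by omega⟩)).1
    have hU' := not_le.1 (show ¬ i' ≤ _ from hU)
    have hD' := not_le.1 (show ¬ i' ≤ _ from hD)
    refine hc ⟨Trajectory.noiseSum_le_of_height_le hi1 hV0 ?_ fun m hm => ?_, ?_, ?_⟩
    · refine ((hrun ω).wsum_le_card hv (by omega) ℓ).trans ?_
      have := (Finset.card_le_card (Trajectory.idx_mono (τ ω) (Nat.le_succ t) ℓ)).trans
        (Trajectory.card_idx_le (τ ω) t ℓ)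
      exact_mod_cast this
    · exact (not_le.1 (show ¬ 2 * i ≤ _ from hH m hm)).le
    · linarith
    · linarith
  have hHm : ∀ m ∈ Finset.Icc 2 (t + 2), P.real (H m) ≤ Real.exp (1 - 2 * i) := by
    intro m hm
    have h2 : (2 : ℝ) ≤ m := by exact_mod_cast (Finset.mem_Icc.1 hm).1
    exact h.height_tail hp hrun ht1 (by omega) ℓ (by positivity)
      (one_div_le_one_div_of_le (by norm_num) h2) _
  have hHs : P.real (⋃ m ∈ Finset.Icc 2 (t + 2), H m) ≤ (t + 1) * Real.exp (1 - 2 * i) := by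
    refine (measureReal_biUnion_finset_le _ _).trans ((Finset.sum_le_card_nsmul _ _ _ hHm).trans ?_)
    rw [nsmul_eq_mul, Nat.card_Icc]
    push_cast [show t + 2 + 1 - 2 = t + 1 by omega]
    exact le_rfl
  have hUp : P.real U ≤ Real.exp (0 - i') := h.var_tail hp hrun ht1 (by omega) ℓ i'
  have hDp : P.real D ≤ Real.exp (0 - i') := h.sq_tail hp hrun ht1 (by omega) ℓ i'
  have hi'e : Real.exp (0 - i') ≤ 1 / X := by
    rw [← hexp]; exact Real.exp_le_exp.2 (by linarith)
  -- The threshold `2ι` gives `exp (-2ι) = X⁻²`, which absorbs the union over `t + 1` scales.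
  have he2 : (t + 1) * Real.exp (1 - 2 * i) ≤ 2 / X := by
    have e1 : Real.exp (1 - 2 * i) = Real.exp 1 * (1 / X * (1 / X)) := by
      rw [← hexp, ← Real.exp_add, ← Real.exp_add]; ring_nf
    have e2 : 4 * (t : ℝ) ^ 2 ≤ X := by
      rw [hX, le_div_iff₀ hp.delta_pos]
      have hL : (1 : ℝ) ≤ p.numLayers := by exact_mod_cast hp.one_le_numLayers
      have := hp.delta_lt_one
      have := hp.delta_pos
      have ht2 : (0 : ℝ) ≤ 4 * t ^ 2 := by positivity
      calc 4 * (t : ℝ) ^ 2 * p.δ ≤ 4 * (t : ℝ) ^ 2 * 1 := by gcongr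
        _ ≤ _ := by gcongr
    have e3 : (t + 1) * Real.exp 1 ≤ 2 * X := by
      have := Real.exp_one_lt_d9
      calc (t + 1) * Real.exp 1 ≤ (t + 1) * 4 := by gcongr; linarith
        _ ≤ 2 * (4 * (t : ℝ) ^ 2) := by nlinarith
        _ ≤ _ := by gcongr
    rw [e1]
    have hX0 : 0 < X := by linarith
    calc (t + 1) * (Real.exp 1 * (1 / X * (1 / X)))
        = ((t + 1) * Real.exp 1) * (1 / X * (1 / X)) := by ring
      _ ≤ (2 * X) * (1 / X * (1 / X)) := by gcongr
      _ = 2 / X := by field_simp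
  calc _ ≤ P.real ((⋃ m ∈ Finset.Icc 2 (t + 2), H m) ∪ (U ∪ D)) := measureReal_mono hsub
    _ ≤ P.real (⋃ m ∈ Finset.Icc 2 (t + 2), H m) + (P.real U + P.real D) :=
        (measureReal_union_le _ _).trans (add_le_add_right (measureReal_union_le _ _) _)
    _ ≤ 2 / X + (1 / X + 1 / X) := add_le_add (hHs.trans he2)
        (add_le_add (hUp.trans hi'e) (hDp.trans hi'e))
    _ = p.δ / (t ^ 2 * p.numLayers) := by
        rw [hX]
        have := hp.delta_pos
        have hL : (0 : ℝ) < p.numLayers := by exact_mod_cast hp.one_le_numLayers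
        field_simp
        ring

/-- With probability at least `1 - 2δ` the concentration events hold in all layers and rounds. The
arms need not be measurable, so the good set is obtained as the complement of a measurable hull. -/
lemma exists_good_event (h : IsDuelingModel P ℱ τ p.μ θ A T) (hp : p.Valid)
    (hrun : ∀ ω, (τ ω).IsRun p T) : ∃ E : Set Ω, MeasurableSet E ∧ 1 - 2 * p.δ ≤ P.real E ∧
    ∀ ω ∈ E, (∀ s ∈ Finset.Icc 1 T,
        0 ≤ noiseVar P ℱ τ p.μ θ s ω ∧ noiseVar P ℱ τ p.μ θ s ω ≤ 1) ∧
      ∀ ℓ ∈ Finset.Icc 1 p.numLayers, ∀ t ∈ Finset.Icc 1 T,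
        (τ ω).Concentrated p θ (fun s => noiseVar P ℱ τ p.μ θ s ω) t ℓ := by
  let N : Set Ω := {ω | ¬ ∀ s ∈ Finset.Icc 1 T,
    0 ≤ noiseVar P ℱ τ p.μ θ s ω ∧ noiseVar P ℱ τ p.μ θ s ω ≤ 1}
  let F : ℕ → ℕ → Set Ω := fun t ℓ => {ω | (∀ s ∈ Finset.Icc 1 T,
        0 ≤ noiseVar P ℱ τ p.μ θ s ω ∧ noiseVar P ℱ τ p.μ θ s ω ≤ 1) ∧
      ¬ (τ ω).Concentrated p θ (fun s => noiseVar P ℱ τ p.μ θ s ω) t ℓ}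
  let Z : Set Ω := N ∪ ⋃ t ∈ Finset.Icc 1 T, ⋃ ℓ ∈ Finset.Icc 1 p.numLayers, F t ℓ
  have hN : P.real N = 0 := by
    have : ∀ᵐ ω ∂P, ∀ s ∈ Finset.Icc 1 T,
        0 ≤ noiseVar P ℱ τ p.μ θ s ω ∧ noiseVar P ℱ τ p.μ θ s ω ≤ 1 :=
      (Finset.eventually_all _).2 fun s hs => h.noiseVar_mem hp hs
    rw [measureReal_def, ae_iff.1 this]
    rfl
  have hL : (0 : ℝ) < p.numLayers := by exact_mod_cast hp.one_le_numLayers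
  have hZ : P.real Z ≤ 2 * p.δ := by
    refine (measureReal_union_le _ _).trans ?_
    rw [hN, zero_add]
    calc _ ≤ ∑ t ∈ Finset.Icc 1 T, ∑ ℓ ∈ Finset.Icc 1 p.numLayers, P.real (F t ℓ) :=
          (measureReal_biUnion_finset_le _ _).trans
            (Finset.sum_le_sum fun t _ => measureReal_biUnion_finset_le _ _)
      _ ≤ ∑ t ∈ Finset.Icc 1 T, ∑ ℓ ∈ Finset.Icc 1 p.numLayers,
            p.δ / ((t : ℝ) ^ 2 * p.numLayers) :=
          Finset.sum_le_sum fun t ht => Finset.sum_le_sum fun ℓ _ =>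
            h.measureReal_not_concentrated_le hp hrun (Finset.mem_Icc.1 ht).1
              (Finset.mem_Icc.1 ht).2 ℓ
      _ = p.δ * ∑ t ∈ Finset.Icc 1 T, 1 / (t : ℝ) ^ 2 := by
          rw [Finset.mul_sum]
          refine Finset.sum_congr rfl fun t ht => ?_
          rw [Finset.sum_const, Nat.card_Icc, nsmul_eq_mul, Nat.add_sub_cancel]
          have : (0 : ℝ) < t := by exact_mod_cast (Finset.mem_Icc.1 ht).1
          field_simp
      _ ≤ p.δ * 2 := by
          have := hp.delta_pos
          gcongr
          exact sum_one_div_sq_le T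
      _ = 2 * p.δ := mul_comm _ _
  refine ⟨(toMeasurable P Z)ᶜ, (measurableSet_toMeasurable P Z).compl, ?_, fun ω hω => ?_⟩
  · rw [probReal_compl_eq_one_sub (measurableSet_toMeasurable P Z), measureReal_def,
      measure_toMeasurable, ← measureReal_def]
    linarith
  · have hωZ : ω ∉ Z := fun hz => hω (subset_toMeasurable P Z hz)
    have hv : ∀ s ∈ Finset.Icc 1 T,
        0 ≤ noiseVar P ℱ τ p.μ θ s ω ∧ noiseVar P ℱ τ p.μ θ s ω ≤ 1 := by
      by_contra hcon
      exact hωZ (Or.inl hcon)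
    refine ⟨hv, fun ℓ hℓ t ht => ?_⟩
    by_contra hcon
    exact hωZ (Or.inr (Set.mem_biUnion ht (Set.mem_biUnion hℓ ⟨hv, hcon⟩)))

end IsDuelingModel
end

/-- The logarithmic quantities in the regret bound, for `α = T^{-3/2}`. -/
lemma log_bounds {d T : ℕ} {p : Params} (hT : 2 ≤ T) (hδ : 0 < p.δ) (hδ1 : p.δ < 1)
    (hα : p.α = (T : ℝ) ^ (-(3 / 2) : ℝ)) (A : ℝ) :
    1 ≤ p.numLayers ∧ 1 ≤ (64 * A ^ 2 + 9) * Real.log (T / p.δ) ∧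
    p.logTerm (T + 1) ≤ (64 * A ^ 2 + 9) * Real.log (T / p.δ) ∧
    (p.numLayers : ℝ) ≤ (64 * A ^ 2 + 9) * Real.log (T / p.δ) ∧
    2 * d * Real.log (1 + 4 ^ p.numLayers * (4 * A ^ 2 * T)) ≤
      d * ((64 * A ^ 2 + 9) * Real.log (T / p.δ)) := by
  have hT2 : (2 : ℝ) ≤ T := by exact_mod_cast hT
  have hT0 : (0 : ℝ) < T := by linarith
  have hlT : Real.log 2 ≤ Real.log T := Real.log_le_log (by norm_num) hT2
  have hl2 := Real.log_two_gt_d9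
  have hlΛ : Real.log T ≤ Real.log (T / p.δ) :=
    Real.log_le_log hT0 (by rw [le_div_iff₀ hδ]; nlinarith)
  set Λ := Real.log (T / p.δ) with hΛ
  have hA := sq_nonneg A
  have hlog : Real.logb 2 (1 / p.α) = 3 / 2 * (Real.log T / Real.log 2) := by
    rw [hα, Real.rpow_neg hT0.le, one_div, inv_inv, Real.logb, Real.log_rpow hT0]; ring
  have hlog0 : 0 < Real.logb 2 (1 / p.α) := by
    rw [hlog]
    have : 0 < Real.log T := by linarith
    positivity
  have hL1 : 1 ≤ p.numLayers := Nat.ceil_pos.2 hlog0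
  have hLlt : (p.numLayers : ℝ) < Real.logb 2 (1 / p.α) + 1 := Nat.ceil_lt_add_one hlog0.le
  have hdiv : Real.log T / Real.log 2 ≤ 1.5 * Real.log T := by
    rw [div_le_iff₀ (by linarith)]
    nlinarith
  have hL : (p.numLayers : ℝ) ≤ 2.25 * Real.log T + 1 := by
    rw [hlog] at hLlt; linarith
  have hΛ0 : 0.69 ≤ Λ := by linarith
  have hmono : ∀ c : ℝ, c ≤ 9 → c * Λ ≤ (64 * A ^ 2 + 9) * Λ := fun c hc =>
    mul_le_mul_of_nonneg_right (by linarith) (by linarith)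
  refine ⟨hL1, le_trans (by linarith) (hmono 9 le_rfl), ?_,
    le_trans (by linarith) (hmono 9 le_rfl), ?_⟩
  · refine le_trans ?_ (hmono 9 le_rfl)
    have hLT : (p.numLayers : ℝ) ≤ 3 * T := by
      have := Real.log_le_sub_one_of_pos hT0
      linarith
    have hpow : 4 * ((T : ℝ) + 1) ^ 2 * p.numLayers / p.δ ≤ (T / p.δ) ^ 9 := by
      have e1 : 4 * ((T : ℝ) + 1) ^ 2 * p.numLayers ≤ 4 * (2 * T) ^ 2 * (3 * T) := by
        gcongr; linarith
      have e2 : 4 * (2 * (T : ℝ)) ^ 2 * (3 * T) ≤ T ^ 9 := by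
        have h6 : (2 : ℝ) ^ 6 ≤ T ^ 6 := by gcongr
        have h3 : (0 : ℝ) ≤ T ^ 3 := by positivity
        have : (T : ℝ) ^ 9 = T ^ 6 * T ^ 3 := by ring
        rw [this]
        nlinarith
      have e3 : p.δ ^ 9 ≤ p.δ := pow_le_of_le_one hδ.le hδ1.le (by norm_num)
      rw [div_pow]
      exact div_le_div₀ (by positivity) (e1.trans e2) (by positivity) e3
    have hL0 : (0 : ℝ) < p.numLayers := by exact_mod_cast hL1
    have := Real.log_le_log (by positivity) hpow
    rw [Real.log_pow] at this
    rw [Params.logTerm]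
    exact_mod_cast this
  · have h2L : (2 : ℝ) ^ p.numLayers ≤ 2 * (T : ℝ) ^ (3 / 2 : ℝ) := by
      rw [← Real.rpow_natCast]
      calc (2 : ℝ) ^ (p.numLayers : ℝ) ≤ 2 ^ (Real.logb 2 (1 / p.α) + 1) :=
            Real.rpow_le_rpow_of_exponent_le (by norm_num) hLlt.le
        _ = 2 * (T : ℝ) ^ (3 / 2 : ℝ) := by
            have : 1 / p.α = (T : ℝ) ^ (3 / 2 : ℝ) := by
              rw [hα, Real.rpow_neg hT0.le, one_div, inv_inv]
            rw [Real.rpow_add (by norm_num), this,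
              Real.rpow_logb (by norm_num) (by norm_num) (by positivity), Real.rpow_one, mul_comm]
    have h4L : (4 : ℝ) ^ p.numLayers ≤ 4 * T ^ 3 := by
      have e1 : (4 : ℝ) ^ p.numLayers = (2 ^ p.numLayers) ^ 2 := by
        rw [← pow_mul, mul_comm, pow_mul]; norm_num
      have e2 : ((T : ℝ) ^ (3 / 2 : ℝ)) ^ 2 = T ^ 3 := by
        rw [← Real.rpow_natCast, ← Real.rpow_mul hT0.le, ← Real.rpow_natCast]; norm_num
      rw [e1]
      calc _ ≤ (2 * (T : ℝ) ^ (3 / 2 : ℝ)) ^ 2 := by gcongr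
        _ = 4 * T ^ 3 := by rw [mul_pow, e2]; norm_num
    have hle : 1 + 4 ^ p.numLayers * (4 * A ^ 2 * T) ≤ (1 + 16 * A ^ 2) * (T : ℝ) ^ 4 := by
      have e1 : (4 : ℝ) ^ p.numLayers * (4 * A ^ 2 * T) ≤ 4 * T ^ 3 * (4 * A ^ 2 * T) := by gcongr
      have e2 : (1 : ℝ) ≤ (T : ℝ) ^ 4 := one_le_pow₀ (by linarith)
      nlinarith
    have hlog2 := Real.log_le_log (by positivity) hle
    rw [Real.log_mul (by positivity) (by positivity), Real.log_pow] at hlog2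
    have h16 := Real.log_le_sub_one_of_pos (show 0 < 1 + 16 * A ^ 2 by positivity)
    have hfin : 2 * Real.log (1 + 4 ^ p.numLayers * (4 * A ^ 2 * T)) ≤ (64 * A ^ 2 + 9) * Λ := by
      push_cast at hlog2
      nlinarith
    have hd : (0 : ℝ) ≤ d := Nat.cast_nonneg d
    nlinarith

/-- The explicit regret bound, simplified: `M` bounds all logarithmic quantities, `B` stands for
`(Lμ / κ)²`, and `D` for the dimension. -/
lemma regret_arith {R M I L N S A κ B D : ℝ} (hκ : 0 < κ) (hA : 0 ≤ A) (hB : 1 ≤ B) (hD : 1 ≤ D)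
    (hM : 1 ≤ M) (hI : 1 ≤ I) (hIM : I ≤ M) (hL : L ≤ M) (hN0 : 0 ≤ N)
    (hN : N ≤ D * M)
    (h : 2 * R ≤ 3 * (231 * I / κ + 18) + L * (N *
      (16 * ((96 * √(S * I) + 135 * I) / κ + 18) + 65536 * A * B * I))) :
    R ≤ 33000 * (1 + A) * M ^ 3 * (D / κ * √S + D * (B + 1 / κ)) := by
  have hs : √(S * I) ≤ √S * M := by
    rcases le_total 0 S with hS | hS
    · rw [Real.sqrt_mul hS]
      gcongr
      exact (Real.sqrt_le_self_iff.2 (Or.inr hI)).trans hIM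
    · rw [Real.sqrt_eq_zero_of_nonpos (mul_nonpos_of_nonpos_of_nonneg hS (by linarith))]
      positivity
  have hb : 2 * R ≤ 3 * (231 * M / κ + 18) + M * ((D * M) *
      (16 * ((96 * (√S * M) + 135 * M) / κ + 18) + 65536 * A * B * M)) := by
    refine h.trans ?_
    gcongr
  have hS0 := Real.sqrt_nonneg S
  have hDB : 1 ≤ D * B := one_le_mul_of_one_le_of_one_le hD hB
  have hM3 : M ≤ M ^ 3 := le_self_pow₀ hM (by norm_num)
  have hM23 : M ^ 2 ≤ M ^ 3 := pow_le_pow_right₀ hM (by norm_num)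
  have hM31 : 1 ≤ M ^ 3 := one_le_pow₀ hM
  have t1 : M * (1 / κ) ≤ M ^ 3 * (D * (1 / κ)) := by
    calc M * (1 / κ) ≤ M ^ 3 * (1 * (1 / κ)) := by rw [one_mul]; gcongr
      _ ≤ _ := by gcongr
  have t2 : (1 : ℝ) ≤ M ^ 3 * (D * B) := one_le_mul_of_one_le_of_one_le hM31 hDB
  have t3 : M ^ 2 * D ≤ M ^ 3 * (D * B) := by
    calc M ^ 2 * D ≤ M ^ 3 * (D * 1) := by rw [mul_one]; gcongr
      _ ≤ _ := by gcongr
  have e : 3 * (231 * M / κ + 18) + M * ((D * M) *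
      (16 * ((96 * (√S * M) + 135 * M) / κ + 18) + 65536 * A * B * M)) =
      693 * (M * (1 / κ)) + 54 * 1 + 1536 * (M ^ 3 * (D / κ * √S)) +
      2160 * (M ^ 3 * (D * (1 / κ))) + 288 * (M ^ 2 * D) + 65536 * (A * (M ^ 3 * (D * B))) := by
    ring
  rw [e] at hb
  have q1 : 0 ≤ M ^ 3 * (D / κ * √S) := by positivity
  have q2 : 0 ≤ M ^ 3 * (D * (1 / κ)) := by positivity
  have q3 : 0 ≤ A * (M ^ 3 * (D / κ * √S)) := by positivity
  have q4 : 0 ≤ A * (M ^ 3 * (D * (1 / κ))) := by positivity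
  have e2 : 33000 * (1 + A) * M ^ 3 * (D / κ * √S + D * (B + 1 / κ)) =
      33000 * (M ^ 3 * (D / κ * √S)) + 33000 * (A * (M ^ 3 * (D / κ * √S))) +
      33000 * (M ^ 3 * (D * B)) + 33000 * (A * (M ^ 3 * (D * B))) +
      33000 * (M ^ 3 * (D * (1 / κ))) + 33000 * (A * (M ^ 3 * (D * (1 / κ)))) := by ring
  rw [e2]
  have q5 : 0 ≤ A * (M ^ 3 * (D * B)) := by positivity
  linarith

end VACDB

end

theorem theorem1 :
    ∃ k : ℕ, ∀ A : ℝ, 0 < A → ∃ C : ℝ, 0 < C ∧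
      ∀ (d T : ℕ) (δ κ Lμ : ℝ) (μ : ℝ → ℝ) (θ : VACDB.Vec d)
        (Ω : Type*) [mΩ : MeasurableSpace Ω] (P : Measure Ω) [IsProbabilityMeasure P]
        (ℱ : Filtration ℕ mΩ) (τ : Ω → VACDB.Trajectory d),
        2 ≤ T → 0 < δ → δ < 1 → VACDB.IsLink μ κ Lμ → ‖θ‖ ≤ 1 →
        VACDB.IsDuelingModel P ℱ τ μ θ A T →
        (∀ ω, (τ ω).IsRun ⟨(T : ℝ) ^ (-(3 / 2) : ℝ), δ, κ, Lμ, μ⟩ T) →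
        ∃ E : Set Ω, MeasurableSet E ∧ 1 - 2 * δ ≤ P.real E ∧ ∀ ω ∈ E,
          (τ ω).regret θ T ≤ C * Real.log (T / δ) ^ k *
            (d / κ * Real.sqrt (∑ t ∈ Finset.Icc 1 T, VACDB.noiseVar P ℱ τ μ θ t ω) +
              d * (Lμ ^ 2 / κ ^ 2 + 1 / κ)) ∧
          ((∀ t ∈ Finset.Icc 1 T, (τ ω).x t ≠ (τ ω).y t →
              VACDB.noiseVar P ℱ τ μ θ t ω = 0) →
            (τ ω).regret θ T ≤ C * Real.log (T / δ) ^ k *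
              (d * (Lμ ^ 2 / κ ^ 2 + 1 / κ))) := by
  refine ⟨3, fun A hA => ⟨33000 * (1 + A) * (64 * A ^ 2 + 9) ^ 3, by positivity, ?_⟩⟩
  intro d T δ κ Lμ μ θ Ω mΩ P _ ℱ τ hT hδ hδ1 hlink hθ hmodel hrun
  set p : VACDB.Params := ⟨(T : ℝ) ^ (-(3 / 2) : ℝ), δ, κ, Lμ, μ⟩ with hp_def
  have hT0 : (0 : ℝ) < T := by
    have : 0 < T := by omega
    exact_mod_cast this
  obtain ⟨hL1, hM, hI, hL, hN⟩ := VACDB.log_bounds (d := d) (p := p) hT hδ hδ1 rfl A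
  have hp : p.Valid := ⟨hlink, Real.rpow_pos_of_pos hT0 _, hδ, hδ1, hL1⟩
  have hα : p.α * T * √T ≤ 1 := by
    have : p.α * T * √T = 1 := by
      change (T : ℝ) ^ (-(3 / 2) : ℝ) * T * √T = 1
      rw [Real.sqrt_eq_rpow]
      nth_rw 2 [← Real.rpow_one (T : ℝ)]
      rw [← Real.rpow_add hT0, ← Real.rpow_add hT0]
      norm_num
    exact this.le
  have hκ : 0 < κ := hlink.kappa_pos
  obtain ⟨E, hE, hPE, hgood⟩ := VACDB.IsDuelingModel.exists_good_event (p := p) hmodel hp hrun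
  refine ⟨E, hE, hPE, fun ω hω => ?_⟩
  obtain ⟨hv, hc⟩ := hgood ω hω
  have key : ∀ S : ℝ, ∑ t ∈ Finset.Icc 1 T with (τ ω).x t ≠ (τ ω).y t,
      VACDB.noiseVar P ℱ τ μ θ t ω ≤ S → (τ ω).regret θ T ≤
        33000 * (1 + A) * (64 * A ^ 2 + 9) ^ 3 * Real.log (T / δ) ^ 3 *
          (d / κ * √S + d * (Lμ ^ 2 / κ ^ 2 + 1 / κ)) := by
    intro S hS
    rcases Nat.eq_zero_or_pos d with rfl | hd
    · -- In dimension zero there is only one arm, and no regret.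
      have h0 : ∀ x : VACDB.Vec 0, inner ℝ x θ = 0 := fun x => by
        rw [Subsingleton.elim x 0, inner_zero_left]
      simp [VACDB.Trajectory.regret, h0]
    have hd1 : (1 : ℝ) ≤ d := by exact_mod_cast hd
    have hreg := (hrun ω).regret_le hp (by omega) hθ hα hv hA.le
      (fun t ht => hmodel.norm_arm_le t ht ω) hc hS le_rfl
    have hI1 : 1 ≤ p.logTerm (T + 1) := hp.one_le_logTerm (by linarith)
    have hB : 1 ≤ (Lμ / κ) ^ 2 := one_le_pow₀ ((one_le_div hκ).2 hlink.kappa_le)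
    have := VACDB.regret_arith hκ hA.le hB hd1 hM hI1 hI hL
      (by
        have : 0 ≤ Real.log (1 + 4 ^ p.numLayers * (4 * A ^ 2 * T)) :=
          Real.log_nonneg (le_add_of_nonneg_right (by positivity))
        positivity) hN hreg
    rw [mul_pow, div_pow, ← mul_assoc] at this
    exact this
  -- The two claims take for `S` the sum of all conditional variances, and zero.
  refine ⟨key _ (Finset.sum_le_sum_of_subset_of_nonneg (Finset.filter_subset _ _)
    fun s hs _ => (hv s hs).1), fun hdet => ?_⟩
  have := key 0 (Finset.sum_eq_zero fun t ht =>
    hdet t (Finset.mem_filter.1 ht).1 (Finset.mem_filter.1 ht).2).le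
  simpa using this
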